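/- Let $M$ be a complex manifold of dimension $n$. Functions and tensors are complex-valued; $z^k,\bar z^l$ are local holomorphic coordinates and their conjugates, $\zeta_k,\bar\zeta_l$ are the dual fibre coordinates on $T^*M$, and repeated indices are summed. Let $Z\subset T^*M$ be the zero section and let $C^\infty(T^*M,Z)$ be the algebra of smooth functions on its formal neighbourhood, i.e. of formal power series $\Phi=\Phi_0+\Phi_1+\dots$ in the fibre variables with smooth coefficients, $\Phi_r$ being homogeneous of degree $r$; let $E\Phi=\Phi_0$. The canonical Poisson bracket $\{\cdot,\cdot\}_{T^*M}$ is normalised by $\{\zeta_k,z^j\}=\delta_k^j$, $\{\bar\zeta_l,\bar z^j\}=\delta_l^j$. Let $\epsilon$ be a formal parameter with $\epsilon^2=0$; brackets on $T^*M$ are extended $\epsilon$-bilinearly. For $F$ starting with a term of degree at least two in the fibre variables, put $H_FQ=\{F,Q\}_{T^*M}$; then $e^{H_F}$ is a well-defined formal series. A Kähler–Poisson tensor is a smooth tensor $g^{lk}$ of type $(1,1)$ ($l$ antiholomorphic, $k$ holomorphic) with $$g^{lk}\frac{\partial g^{qp}}{\partial z^k}=g^{qk}\frac{\partial g^{lp}}{\partial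 z^k},\qquad g^{lk}\frac{\partial g^{qp}}{\partial\bar z^l}=g^{lp}\frac{\partial g^{qk}}{\partial\bar z^l};$$ its Poisson bracket is $\{u,v\}_0=g^{lk}\bigl(\frac{\partial u}{\partial\bar z^l}\frac{\partial v}{\partial z^k}-\frac{\partial u}{\partial z^k}\frac{\partial v}{\partial\bar z^l}\bigr)$. An infinitesimal deformation $g^{lk}+\epsilon h^{lk}$ of it is given by a smooth tensor $h^{lk}$ of type $(1,1)$ with $$g^{lk}\frac{\partial h^{qp}}{\partial z^k}+h^{lk}\frac{\partial g^{qp}}{\partial z^k}=g^{qk}\frac{\partial h^{lp}}{\partial z^k}+h^{qk}\frac{\partial g^{lp}}{\partial z^k},\qquad g^{lk}\frac{\partial h^{qp}}{\partial\bar z^l}+h^{lk}\frac{\partial g^{qp}}{\partial\bar z^l}=g^{lp}\frac{\partial h^{qk}}{\partial\bar z^l}+h^{lp}\frac{\partial g^{qk}}{\partial\bar z^l};$$ it gives the $\epsilon$-bilinear bracket $\{\cdot,\cdot\}=\{\cdot,\cdot\}_0+\epsilon\{\cdot,\cdot\}_1$ on $C^\infty(M)[\epsilon]$, where $\{\cdot,\cdot\}_1$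 is defined by $h^{lk}$ as $\{\cdot,\cdot\}_0$ is by $g^{lk}$. Let $\mathcal K[\epsilon]$ be the set of all $F=K+\epsilon J\in C^\infty(T^*M,Z)[\epsilon]$ whose expansion in the fibre variables starts at least with the quadratic term and such that $$\{e^{H_F}a,\tilde a\}_{T^*M}=0\quad\text{and}\quad\{e^{H_F}b,\tilde b\}_{T^*M}=0$$ for all local holomorphic functions $a,\tilde a$ and all local antiholomorphic functions $b,\tilde b$. Let $\mathcal K\subset C^\infty(T^*M,Z)$ be the set defined in the same way without $\epsilon$. A deformation formal symplectic groupoid over $(M,g^{lk}+\epsilon h^{lk})$, on the formal neighbourhood $(T^*M,Z)$, is given by its source and target mappings, i.e. by $\epsilon$-linear algebra homomorphisms $S,T:C^\infty(M)[\epsilon]\to C^\infty(T^*M,Z)[\epsilon]$ such that for all $u,v$ $$E(Su)=u,\quad E(Tu)=u,\quad S\{u,v\}=\{Su,Sv\}_{T^*M},\quad T\{u,v\}=-\{Tu,Tv\}_{T^*M},\quad\{Su,Tv\}_{T^*M}=0.$$ It is with separation of variables if $Sa=a$ and $Tb=b$ for all local holomorphic $a$ and local antiholomorphic $b$. Formal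 symplectic groupoids (with separation of variables) over $(M,g^{lk})$ are defined in the same way without $\epsilon$. **Theorem.** There is a bijection of the set of all infinitesimal deformations $g^{lk}+\epsilon h^{lk}$ of Kähler–Poisson tensors on $M$ onto $\mathcal K[\epsilon]$ which relates to each $g^{lk}+\epsilon h^{lk}$ the unique element $F=K+\epsilon J\in\mathcal K[\epsilon]$ such that $$K_2=g^{lk}\zeta_k\bar\zeta_l\quad\text{and}\quad J_2=h^{lk}\zeta_k\bar\zeta_l.$$ Every $F=K+\epsilon J\in\mathcal K[\epsilon]$ is even in the fibre variables: $K=K_2+K_4+\dots$ and $J=J_2+J_4+\dots$. Moreover, for each infinitesimal deformation $g^{lk}+\epsilon h^{lk}$ on $M$ there exists a unique deformation formal symplectic groupoid with separation of variables over $(M,g^{lk}+\epsilon h^{lk})$. Its source and target mappings $S=S_0+\epsilon S_1$ and $T=T_0+\epsilon T_1$ satisfy $$S(ab)=a\,\bigl(e^{H_F}b\bigr)\quad\text{and}\quad T(ab)=\bigl(e^{H_F}a\bigr)\,b$$ for all local holomorphic $a$ and local antiholomorphic $b$, where $F=K+\epsilon J$ is the element of $\mathcal K[\epsilon]$ corresponding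 to $g^{lk}+\epsilon h^{lk}$. The components $S_0$ and $T_0$ are the source and target mappings of the unique formal symplectic groupoid with separation of variables over $(M,g^{lk})$, $K$ is the unique element of $\mathcal K$ with $K_2=g^{lk}\zeta_k\bar\zeta_l$, and $$S_0(ab)=a\,\bigl(e^{H_K}b\bigr)\quad\text{and}\quad T_0(ab)=\bigl(e^{H_K}a\bigr)\,b.$$ -/

import Mathlib

open scoped Manifold ContDiff DualNumber ComplexConjugate

noncomputable section

namespace KahlerPoisson

/-! ### Local calculus on `ℂⁿ` -/

/-- The Wirtinger derivative `∂f/∂zᵏ = (∂f/∂xᵏ - i ∂f/∂yᵏ) / 2`. -/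
def dz {n : ℕ} (k : Fin n) (f : (Fin n → ℂ) → ℂ) (y : Fin n → ℂ) : ℂ :=
  (fderiv ℝ f y (Pi.single k 1) - Complex.I * fderiv ℝ f y (Pi.single k Complex.I)) / 2

/-- The Wirtinger derivative `∂f/∂z̄ˡ = (∂f/∂xˡ + i ∂f/∂yˡ) / 2`. -/
def dzbar {n : ℕ} (l : Fin n) (f : (Fin n → ℂ) → ℂ) (y : Fin n → ℂ) : ℂ :=
  (fderiv ℝ f y (Pi.single l 1) + Complex.I * fderiv ℝ f y (Pi.single l Complex.I)) / 2

/-- Complex-valued formal power series on one cotangent space: `X (inl k)` is the fibre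
coordinate `ζ_k` and `X (inr l)` is the fibre coordinate `ζ̄_l`, dual to `zᵏ` and `z̄ˡ`. -/
abbrev FiberSeries (n : ℕ) : Type := MvPowerSeries (Fin n ⊕ Fin n) ℂ

/-- `∂/∂zᵏ` of a series in the fibre variables whose coefficients depend on `z`. -/
def dzSeries {n : ℕ} (k : Fin n) (P : (Fin n → ℂ) → FiberSeries n) (y : Fin n → ℂ) :
    FiberSeries n :=
  fun m => dz k (fun y' => MvPowerSeries.coeff m (P y')) y

/-- `∂/∂z̄ˡ` of a series in the fibre variables whose coefficients depend on `z`. -/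
def dzbarSeries {n : ℕ} (l : Fin n) (P : (Fin n → ℂ) → FiberSeries n) (y : Fin n → ℂ) :
    FiberSeries n :=
  fun m => dzbar l (fun y' => MvPowerSeries.coeff m (P y')) y

/-- The canonical Poisson bracket of the cotangent bundle in coordinates, normalised by
`{ζ_k, zʲ} = δ_kʲ` and `{ζ̄_l, z̄ʲ} = δ_lʲ`. -/
def localBracket {n : ℕ} (P Q : (Fin n → ℂ) → FiberSeries n) (y : Fin n → ℂ) :
    FiberSeries n :=
  ∑ k : Fin n,
    (MvPowerSeries.pderiv ℂ (Sum.inl k) (P y) * dzSeries k Q y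
      - dzSeries k P y * MvPowerSeries.pderiv ℂ (Sum.inl k) (Q y)
      + MvPowerSeries.pderiv ℂ (Sum.inr k) (P y) * dzbarSeries k Q y
      - dzbarSeries k P y * MvPowerSeries.pderiv ℂ (Sum.inr k) (Q y))

/-! ### Objects on a complex manifold `M`

Values at `x` of tensors and of formal functions on the cotangent bundle are written in the
coordinates given by the preferred chart `chartAt _ x` (as for Mathlib's tangent bundle);
`coord` rewrites them in an arbitrary chart. -/

section Manifold

variable {n : ℕ} {M : Type*} [TopologicalSpace M] [ChartedSpace (Fin n → ℂ) M]

/-- The matrix `∂zᵏ/∂wʲ` at `x`, where `z` are the coordinates of the chart `c` and `w` those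
of the preferred chart at `x`. -/
def jacobian (c : OpenPartialHomeomorph M (Fin n → ℂ)) (x : M) (k j : Fin n) : ℂ :=
  fderiv ℂ (c ∘ (chartAt (Fin n → ℂ) x).symm) (chartAt (Fin n → ℂ) x x) (Pi.single j 1) k

variable (n M) in
/-- The algebra `C^∞(M)` of complex-valued smooth functions (`M` as a real manifold). -/
def SmoothFun : Subalgebra ℂ (M → ℂ) where
  carrier := {f | ContMDiff 𝓘(ℝ, Fin n → ℂ) 𝓘(ℝ, ℂ) ∞ f}
  mul_mem' := fun {f g} hf hg => by
    have h : ContDiff ℝ ∞ (fun p : ℂ × ℂ => p.1 * p.2) := contDiff_mul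
    exact h.contMDiff.comp (hf.prodMk_space hg)
  add_mem' := fun {f g} hf hg => ContMDiff.add hf hg
  algebraMap_mem' := fun _ => contMDiff_const

variable (n M) in
/-- Smooth tensor fields `g^{lk}` of type `(1,1)`: a bivector field pairing an
antiholomorphic index `l` (first) and a holomorphic index `k` (second). -/
structure Tensor where
  /-- Components in the preferred chart at each point. -/
  val : M → Fin n → Fin n → ℂ
  smooth' : ∀ c ∈ atlas (Fin n → ℂ) M, ∀ l k : Fin n,
    ContDiffOn ℝ ∞ (fun y : Fin n → ℂ => ∑ j : Fin n, ∑ i : Fin n,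
      conj (jacobian c (c.symm y) l j) * jacobian c (c.symm y) k i * val (c.symm y) j i) c.target

/-- The components `g^{lk}` of a tensor in the chart `c`, at the point with coordinates `y`. -/
def Tensor.coord (g : Tensor n M) (c : OpenPartialHomeomorph M (Fin n → ℂ)) (l k : Fin n)
    (y : Fin n → ℂ) : ℂ :=
  ∑ j : Fin n, ∑ i : Fin n,
    conj (jacobian c (c.symm y) l j) * jacobian c (c.symm y) k i * g.val (c.symm y) j i

/-- The value at `x` of `{f, f'} = g^{lk} (∂f/∂z̄ˡ ∂f'/∂zᵏ - ∂f/∂zᵏ ∂f'/∂z̄ˡ)`. -/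
def Tensor.bracketAt (g : Tensor n M) (f f' : M → ℂ) (x : M) : ℂ :=
  let c := chartAt (Fin n → ℂ) x
  ∑ l : Fin n, ∑ k : Fin n, g.val x l k *
    (dzbar l (f ∘ c.symm) (c x) * dz k (f' ∘ c.symm) (c x)
      - dz k (f ∘ c.symm) (c x) * dzbar l (f' ∘ c.symm) (c x))

/-! ### Smoothness of the Poisson bracket of two smooth functions -/

theorem contDiffOn_transition [IsManifold 𝓘(ℂ, Fin n → ℂ) ω M]
    {c c' : OpenPartialHomeomorph M (Fin n → ℂ)} (hc : c ∈ atlas (Fin n → ℂ) M)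
    (hc' : c' ∈ atlas (Fin n → ℂ) M) :
    ContDiffOn ℂ ω (c ∘ c'.symm) (c'.symm.trans c).source := by
  have h1 : ContMDiffOn 𝓘(ℂ, Fin n → ℂ) 𝓘(ℂ, Fin n → ℂ) ω c c.source :=
    contMDiffOn_of_mem_maximalAtlas (IsManifold.subset_maximalAtlas hc)
  have h2 : ContMDiffOn 𝓘(ℂ, Fin n → ℂ) 𝓘(ℂ, Fin n → ℂ) ω c'.symm c'.target :=
    contMDiffOn_symm_of_mem_maximalAtlas (IsManifold.subset_maximalAtlas hc')
  have h3 := h1.comp' h2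
  rw [contMDiffOn_iff_contDiffOn] at h3
  simpa [OpenPartialHomeomorph.trans_source] using h3

/-- A complex manifold is in particular a smooth real manifold. -/
theorem isManifold_real [IsManifold 𝓘(ℂ, Fin n → ℂ) ω M] :
    IsManifold 𝓘(ℝ, Fin n → ℂ) ∞ M := by
  refine isManifold_of_contDiffOn _ _ _ fun c c' hc hc' => ?_
  have h := ((contDiffOn_transition hc' hc).restrict_scalars ℝ).of_le
    (le_top : (∞ : WithTop ℕ∞) ≤ ω)
  simpa using h

theorem wirtinger_linear (L : (Fin n → ℂ) →L[ℝ] ℂ) (v : Fin n → ℂ) :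
    L v = ∑ k : Fin n,
      (v k * ((L (Pi.single k 1) - Complex.I * L (Pi.single k Complex.I)) / 2)
        + conj (v k) * ((L (Pi.single k 1) + Complex.I * L (Pi.single k Complex.I)) / 2)) := by
  have hv : v = ∑ k : Fin n, ((v k).re • (Pi.single k (1 : ℂ) : Fin n → ℂ)
      + (v k).im • (Pi.single k Complex.I : Fin n → ℂ)) := by
    ext i
    simp [Finset.sum_apply, Pi.single_apply, Finset.sum_add_distrib, Complex.re_add_im]
  conv_lhs => rw [hv]
  rw [map_sum]
  refine Finset.sum_congr rfl fun k _ => ?_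
  rw [map_add, map_smul, map_smul]
  have h1 : v k = (v k).re + (v k).im * Complex.I := (Complex.re_add_im _).symm
  have h2 : conj (v k) = (v k).re - (v k).im * Complex.I := by
    apply Complex.ext <;> simp
  rw [h2]
  nth_rewrite 3 [h1]
  simp only [Complex.real_smul]
  linear_combination ((v k).im * L (Pi.single k Complex.I)) * Complex.I_sq

theorem dz_comp {F : (Fin n → ℂ) → ℂ} {φ : (Fin n → ℂ) → (Fin n → ℂ)} {w : Fin n → ℂ}
    (hF : DifferentiableAt ℝ F (φ w)) (hφ : DifferentiableAt ℂ φ w) (j : Fin n) :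
    dz j (F ∘ φ) w = ∑ k : Fin n, fderiv ℂ φ w (Pi.single j 1) k * dz k F (φ w) ∧
    dzbar j (F ∘ φ) w =
      ∑ k : Fin n, conj (fderiv ℂ φ w (Pi.single j 1) k) * dzbar k F (φ w) := by
  have hI : (Pi.single j Complex.I : Fin n → ℂ) = Complex.I • Pi.single j (1 : ℂ) := by
    ext i; simp [Pi.single_apply]
  have hd : ∀ v, fderiv ℝ (F ∘ φ) w v = fderiv ℝ F (φ w) (fderiv ℂ φ w v) := by
    intro v
    rw [fderiv_comp w hF (hφ.restrictScalars ℝ), hφ.fderiv_restrictScalars ℝ]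
    rfl
  unfold dz dzbar
  rw [hd, hd, hI, map_smul, wirtinger_linear (fderiv ℝ F (φ w)) (fderiv ℂ φ w _),
    wirtinger_linear (fderiv ℝ F (φ w)) (Complex.I • _)]
  constructor
  · rw [Finset.mul_sum, ← Finset.sum_sub_distrib, Finset.sum_div]
    refine Finset.sum_congr rfl fun k _ => ?_
    simp only [Pi.smul_apply, smul_eq_mul, map_mul, Complex.conj_I]
    ring_nf
    rw [Complex.I_sq, show Complex.I ^ 3 = -Complex.I by rw [pow_succ, Complex.I_sq]; ring]
    ring
  · rw [Finset.mul_sum, ← Finset.sum_add_distrib, Finset.sum_div]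
    refine Finset.sum_congr rfl fun k _ => ?_
    simp only [Pi.smul_apply, smul_eq_mul, map_mul, Complex.conj_I]
    ring_nf
    rw [Complex.I_sq, show Complex.I ^ 3 = -Complex.I by rw [pow_succ, Complex.I_sq]; ring]
    ring

theorem SmoothFun.contDiffOn_coord [IsManifold 𝓘(ℂ, Fin n → ℂ) ω M]
    (f : SmoothFun n M) {c : OpenPartialHomeomorph M (Fin n → ℂ)}
    (hc : c ∈ atlas (Fin n → ℂ) M) : ContDiffOn ℝ ∞ ((f : M → ℂ) ∘ c.symm) c.target := by
  have := isManifold_real (n := n) (M := M)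
  have h2 : ContMDiffOn 𝓘(ℝ, Fin n → ℂ) 𝓘(ℝ, Fin n → ℂ) ∞ c.symm c.target :=
    contMDiffOn_symm_of_mem_maximalAtlas (IsManifold.subset_maximalAtlas hc)
  have hf : ContMDiff 𝓘(ℝ, Fin n → ℂ) 𝓘(ℝ, ℂ) ∞ (f : M → ℂ) := f.2
  exact contMDiffOn_iff_contDiffOn.1 (hf.comp_contMDiffOn h2)

theorem sum_change (G B A : Fin n → Fin n → ℂ) (p q : Fin n → ℂ) :
    ∑ j, ∑ i, G j i * ((∑ l, B l j * p l) * ∑ k, A k i * q k)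
      = ∑ l, ∑ k, (∑ j, ∑ i, B l j * A k i * G j i) * (p l * q k) := by
  calc _ = ∑ a : Fin n × Fin n, ∑ b : Fin n × Fin n,
        G a.1 a.2 * ((B b.1 a.1 * p b.1) * (A b.2 a.2 * q b.2)) := by
        simp only [Fintype.sum_prod_type, Finset.sum_mul_sum]
        simp only [Finset.mul_sum]
    _ = _ := by
        rw [Finset.sum_comm]
        simp only [Fintype.sum_prod_type, Finset.sum_mul]
        refine Finset.sum_congr rfl fun l _ => Finset.sum_congr rfl fun k _ =>
          Finset.sum_congr rfl fun j _ => Finset.sum_congr rfl fun i _ => ?_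
        ring

/-- The bracket may be computed in any chart. -/
theorem Tensor.bracketAt_eq [IsManifold 𝓘(ℂ, Fin n → ℂ) ω M] (g : Tensor n M)
    (f f' : SmoothFun n M) {c : OpenPartialHomeomorph M (Fin n → ℂ)}
    (hc : c ∈ atlas (Fin n → ℂ) M) {x : M} (hx : x ∈ c.source) :
    g.bracketAt f f' x = ∑ l : Fin n, ∑ k : Fin n, g.coord c l k (c x) *
      (dzbar l ((f : M → ℂ) ∘ c.symm) (c x) * dz k ((f' : M → ℂ) ∘ c.symm) (c x)
        - dz k ((f : M → ℂ) ∘ c.symm) (c x) * dzbar l ((f' : M → ℂ) ∘ c.symm) (c x)) := by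
  set c' := chartAt (Fin n → ℂ) x with hc'
  have hx' : x ∈ c'.source := mem_chart_source _ x
  have hφx : (c ∘ c'.symm) (c' x) = c x := by simp [c'.left_inv hx']
  have hmem : c' x ∈ (c'.symm.trans c).source := by
    simp [c'.map_source hx', c'.left_inv hx', hx]
  have hopen := (c'.symm.trans c).open_source
  have hφ : DifferentiableAt ℂ (c ∘ c'.symm) (c' x) :=
    ((contDiffOn_transition hc (chart_mem_atlas _ x)).contDiffAt
      (hopen.mem_nhds hmem)).differentiableAt (by simp)
  have hdiff : ∀ u : SmoothFun n M, ∀ j : Fin n,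
      dz j ((u : M → ℂ) ∘ c'.symm) (c' x)
        = ∑ k, jacobian c x k j * dz k ((u : M → ℂ) ∘ c.symm) (c x) ∧
      dzbar j ((u : M → ℂ) ∘ c'.symm) (c' x)
        = ∑ k, conj (jacobian c x k j) * dzbar k ((u : M → ℂ) ∘ c.symm) (c x) := by
    intro u j
    have hu : DifferentiableAt ℝ ((u : M → ℂ) ∘ c.symm) ((c ∘ c'.symm) (c' x)) := by
      rw [hφx]
      exact ((SmoothFun.contDiffOn_coord u hc).contDiffAt
        (c.open_target.mem_nhds (c.map_source hx))).differentiableAt (by simp)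
    have heq : ((u : M → ℂ) ∘ c'.symm) =ᶠ[nhds (c' x)]
        (((u : M → ℂ) ∘ c.symm) ∘ (c ∘ c'.symm)) := by
      filter_upwards [hopen.mem_nhds hmem] with y hy
      have : c'.symm y ∈ c.source := by
        have := hy
        rw [OpenPartialHomeomorph.trans_source] at this
        exact this.2
      simp [c.left_inv this]
    have h := dz_comp hu hφ j
    rw [hφx] at h
    refine ⟨?_, ?_⟩
    · rw [← show _ = ∑ k, jacobian c x k j * dz k ((u : M → ℂ) ∘ c.symm) (c x) from h.1]
      simp only [dz, heq.fderiv_eq]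
    · rw [← show _ = ∑ k, conj (jacobian c x k j) * dzbar k ((u : M → ℂ) ∘ c.symm) (c x)
        from h.2]
      simp only [dzbar, heq.fderiv_eq]
  have hL : g.bracketAt f f' x = ∑ j : Fin n, ∑ i : Fin n, g.val x j i *
      (dzbar j ((f : M → ℂ) ∘ c'.symm) (c' x) * dz i ((f' : M → ℂ) ∘ c'.symm) (c' x)
        - dz i ((f : M → ℂ) ∘ c'.symm) (c' x) * dzbar j ((f' : M → ℂ) ∘ c'.symm) (c' x)) := rfl
  rw [hL]
  simp only [fun u j => (hdiff u j).1, fun u j => (hdiff u j).2, Tensor.coord, c.left_inv hx]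
  simp only [mul_sub, Finset.sum_sub_distrib]
  congr 1
  · exact sum_change (g.val x) (fun l j => conj (jacobian c x l j)) (jacobian c x) _ _
  · simp only [mul_comm (∑ k, jacobian c x k _ * _), mul_comm (dz _ ((f : M → ℂ) ∘ c.symm) (c x))]
    exact sum_change (g.val x) (fun l j => conj (jacobian c x l j)) (jacobian c x) _ _

theorem Tensor.bracketAt_mem [IsManifold 𝓘(ℂ, Fin n → ℂ) ω M] (g : Tensor n M)
    (f f' : SmoothFun n M) : g.bracketAt f f' ∈ SmoothFun n M := by
  have := isManifold_real (n := n) (M := M)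
  intro x
  set c := chartAt (Fin n → ℂ) x with hcdef
  have hc : c ∈ atlas (Fin n → ℂ) M := chart_mem_atlas _ x
  have hx : x ∈ c.source := mem_chart_source _ x
  have hd : ∀ u : SmoothFun n M, ∀ v : Fin n → ℂ,
      ContDiffOn ℝ ∞ (fun y => fderiv ℝ ((u : M → ℂ) ∘ c.symm) y v) c.target := fun u v =>
    ((SmoothFun.contDiffOn_coord u hc).fderiv_of_isOpen c.open_target (by simp)).clm_apply contDiffOn_const
  have hdz : ∀ u : SmoothFun n M, ∀ k : Fin n,
      ContDiffOn ℝ ∞ (dz k ((u : M → ℂ) ∘ c.symm)) c.target := fun u k =>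
    ((hd u _).sub (contDiffOn_const.mul (hd u _))).div_const 2
  have hdzb : ∀ u : SmoothFun n M, ∀ k : Fin n,
      ContDiffOn ℝ ∞ (dzbar k ((u : M → ℂ) ∘ c.symm)) c.target := fun u k =>
    ((hd u _).add (contDiffOn_const.mul (hd u _))).div_const 2
  have hG : ContDiffOn ℝ ∞ (fun y => ∑ l : Fin n, ∑ k : Fin n, g.coord c l k y *
      (dzbar l ((f : M → ℂ) ∘ c.symm) y * dz k ((f' : M → ℂ) ∘ c.symm) y
        - dz k ((f : M → ℂ) ∘ c.symm) y * dzbar l ((f' : M → ℂ) ∘ c.symm) y)) c.target :=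
    ContDiffOn.sum fun l _ => ContDiffOn.sum fun k _ => (g.smooth' c hc l k).mul
      (((hdzb f l).mul (hdz f' k)).sub ((hdz f k).mul (hdzb f' l)))
  have hcs : ContMDiffOn 𝓘(ℝ, Fin n → ℂ) 𝓘(ℝ, Fin n → ℂ) ∞ c c.source :=
    contMDiffOn_of_mem_maximalAtlas (IsManifold.subset_maximalAtlas hc)
  have hcomp := hG.contMDiffOn.comp hcs fun y hy => c.map_source hy
  refine (hcomp.contMDiffAt (c.open_source.mem_nhds hx)).congr_of_eventuallyEq ?_
  filter_upwards [c.open_source.mem_nhds hx] with y hy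
  exact g.bracketAt_eq f f' hc hy

/-- The bracket `{f, f'} = g^{lk} (∂f/∂z̄ˡ ∂f'/∂zᵏ - ∂f/∂zᵏ ∂f'/∂z̄ˡ)` on `C^∞(M)`. -/
def Tensor.bracket [IsManifold 𝓘(ℂ, Fin n → ℂ) ω M] (g : Tensor n M)
    (f f' : SmoothFun n M) : SmoothFun n M :=
  ⟨g.bracketAt f f', g.bracketAt_mem f f'⟩

/-! ### Kähler-Poisson tensors and their infinitesimal deformations -/

/-- The Jacobi identity for a tensor of type `(1,1)`. -/
def Tensor.IsKahlerPoisson (g : Tensor n M) : Prop :=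
  ∀ c ∈ atlas (Fin n → ℂ) M, ∀ y ∈ c.target,
    (∀ l q p : Fin n,
      ∑ k, g.coord c l k y * dz k (g.coord c q p) y
        = ∑ k, g.coord c q k y * dz k (g.coord c l p) y) ∧
    (∀ k q p : Fin n,
      ∑ l, g.coord c l k y * dzbar l (g.coord c q p) y
        = ∑ l, g.coord c l p y * dzbar l (g.coord c q k) y)

/-- The equations on `h` expressing that `g + ε h` (`ε² = 0`) satisfies the Jacobi identity to
first order in `ε`. -/
def Tensor.IsInfinitesimalDeformation (g h : Tensor n M) : Prop :=
  ∀ c ∈ atlas (Fin n → ℂ) M, ∀ y ∈ c.target,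
    (∀ l q p : Fin n,
      ∑ k, (g.coord c l k y * dz k (h.coord c q p) y
          + h.coord c l k y * dz k (g.coord c q p) y)
        = ∑ k, (g.coord c q k y * dz k (h.coord c l p) y
          + h.coord c q k y * dz k (g.coord c l p) y)) ∧
    (∀ k q p : Fin n,
      ∑ l, (g.coord c l k y * dzbar l (h.coord c q p) y
          + h.coord c l k y * dzbar l (g.coord c q p) y)
        = ∑ l, (g.coord c l p y * dzbar l (h.coord c q k) y
          + h.coord c l p y * dzbar l (g.coord c q k) y))

variable (n M) in
/-- An infinitesimal deformation `g + ε h` of a Kähler-Poisson tensor `g` on `M`. -/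
structure Deformation where
  /-- The undeformed tensor. -/
  g : Tensor n M
  /-- The first order term. -/
  h : Tensor n M
  isKahlerPoisson : g.IsKahlerPoisson
  isDeformation : g.IsInfinitesimalDeformation h

/-- The deformed bracket `{·,·}₀ + ε {·,·}₁` on `C^∞(M)[ε]`, extended `ε`-bilinearly. -/
def Deformation.bracket [IsManifold 𝓘(ℂ, Fin n → ℂ) ω M] (d : Deformation n M)
    (f f' : (SmoothFun n M)[ε]) : (SmoothFun n M)[ε] :=
  TrivSqZeroExt.inl (d.g.bracket f.fst f'.fst) +
    TrivSqZeroExt.inr (d.g.bracket f.fst f'.snd + d.g.bracket f.snd f'.fst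
      + d.h.bracket f.fst f'.fst)

/-! ### Formal functions on the neighbourhood of the zero section of the cotangent bundle

The algebra `C^∞(T^*M, Z)` consists of the smooth sections of the bundle of formal power series
on the cotangent spaces (the infinite jets along the zero section `Z`). -/

variable (n M) in
/-- Families of formal power series on the cotangent spaces of `M`, with pointwise operations. -/
abbrev FormalFun : Type _ := M → FiberSeries n

/-- A formal function written in the chart `c`: if `w` are the preferred coordinates at `x`, with
fibre coordinates `ω`, and `z` the coordinates of `c`, with fibre coordinates `ζ`, then
`ω_j = (∂zᵏ/∂wʲ) ζ_k`, and conjugately for `ω̄_j`. -/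
def FormalFun.coord (Φ : FormalFun n M) (c : OpenPartialHomeomorph M (Fin n → ℂ))
    (y : Fin n → ℂ) : FiberSeries n :=
  MvPowerSeries.subst (Sum.elim
    (fun j => ∑ k, jacobian c (c.symm y) k j •
      (MvPowerSeries.X (Sum.inl k) : FiberSeries n))
    (fun j => ∑ k, conj (jacobian c (c.symm y) k j) •
      (MvPowerSeries.X (Sum.inr k) : FiberSeries n))) (Φ (c.symm y))

/-- Membership in `C^∞(T^*M, Z)`: in every chart of the atlas, all coefficients are smooth. -/
def FormalFun.IsSmooth (Φ : FormalFun n M) : Prop :=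
  ∀ c ∈ atlas (Fin n → ℂ) M, ∀ m : Fin n ⊕ Fin n →₀ ℕ,
    ContDiffOn ℝ ∞ (fun y => MvPowerSeries.coeff m (FormalFun.coord Φ c y)) c.target

/-- A function on `M` as a formal function, constant along the fibres. -/
def FormalFun.ofFun (f : M → ℂ) : FormalFun n M := fun x => MvPowerSeries.C (f x)

/-- The restriction `E` to the zero section. -/
def FormalFun.E (Φ : FormalFun n M) : M → ℂ := fun x => MvPowerSeries.constantCoeff (Φ x)

/-- The canonical Poisson bracket of the cotangent bundle. Its value at `x` depends only on the
germs of the arguments at `x`. -/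
def FormalFun.bracket (Φ Ψ : FormalFun n M) : FormalFun n M := fun x =>
  localBracket (FormalFun.coord Φ (chartAt (Fin n → ℂ) x))
    (FormalFun.coord Ψ (chartAt (Fin n → ℂ) x)) (chartAt (Fin n → ℂ) x x)

/-- The canonical Poisson bracket extended `ε`-bilinearly. -/
def FormalFun.bracketEps (F G : (FormalFun n M)[ε]) : (FormalFun n M)[ε] :=
  TrivSqZeroExt.inl (FormalFun.bracket F.fst G.fst) +
    TrivSqZeroExt.inr (FormalFun.bracket F.fst G.snd + FormalFun.bracket F.snd G.fst)

/-- The sum `∑_k u_k / k!` for a sequence such that `u_k` has no terms of degree less than `k` in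
the fibre variables; so only the indices `k ≤ deg m` contribute to the coefficient of the
monomial `m`. -/
def FormalFun.expSum (u : ℕ → FormalFun n M) : FormalFun n M := fun x m =>
  ∑ k ∈ Finset.range (m.degree + 1), ((k.factorial : ℂ))⁻¹ * MvPowerSeries.coeff m (u k x)

/-- `e^{H_K} Q`, where `H_K = {K, ·}` and `K` has no terms of degree less than two in the fibre
variables. -/
def FormalFun.expH (K Q : FormalFun n M) : FormalFun n M :=
  FormalFun.expSum fun k => (FormalFun.bracket K)^[k] Q

/-- `e^{H_F} Q`, where `H_F = {F, ·}` and `F = K + ε J` has no terms of degree less than two in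
the fibre variables. -/
def FormalFun.expHEps (F Q : (FormalFun n M)[ε]) : (FormalFun n M)[ε] :=
  TrivSqZeroExt.inl (FormalFun.expSum fun k => ((FormalFun.bracketEps F)^[k] Q).fst) +
    TrivSqZeroExt.inr (FormalFun.expSum fun k => ((FormalFun.bracketEps F)^[k] Q).snd)

/-- The expansion in the fibre variables starts at least with the quadratic term. -/
def FormalFun.StartsQuadratic (Φ : FormalFun n M) : Prop :=
  ∀ x, ∀ m : Fin n ⊕ Fin n →₀ ℕ, m.degree < 2 → MvPowerSeries.coeff m (Φ x) = 0

/-- Only terms of even degree in the fibre variables occur. -/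
def FormalFun.IsEven (Φ : FormalFun n M) : Prop :=
  ∀ x, ∀ m : Fin n ⊕ Fin n →₀ ℕ, Odd m.degree → MvPowerSeries.coeff m (Φ x) = 0

/-- The homogeneous component of degree two of `Φ` is `g^{lk} ζ_k ζ̄_l`. -/
def FormalFun.QuadraticPartEq (Φ : FormalFun n M) (g : Tensor n M) : Prop :=
  ∀ x, MvPowerSeries.homogeneousComponent 2 (Φ x) =
    ∑ l, ∑ k, g.val x l k •
      (MvPowerSeries.X (Sum.inl k) * MvPowerSeries.X (Sum.inr l) : FiberSeries n)

/-- Two elements of `C^∞(T^*M, Z)[ε]` agree over `V`. -/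
def FormalFun.EqOnEps (F G : (FormalFun n M)[ε]) (V : Set M) : Prop :=
  Set.EqOn F.fst G.fst V ∧ Set.EqOn F.snd G.snd V

/-! ### Local holomorphic functions

A local function on an open set `V` is given by a function on `M` of which only the values on
`V` matter. -/

variable (n) in
/-- `a` is holomorphic on `V`. -/
def HolOn (a : M → ℂ) (V : Set M) : Prop :=
  MDifferentiableOn 𝓘(ℂ, Fin n → ℂ) 𝓘(ℂ, ℂ) a V

variable (n) in
/-- `b` is antiholomorphic on `V`. -/
def AntiholOn (b : M → ℂ) (V : Set M) : Prop := HolOn n (fun x => conj (b x)) V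

variable (n M) in
/-- The set `𝒦`. -/
def KSet : Set (FormalFun n M) :=
  {K | FormalFun.IsSmooth K ∧ FormalFun.StartsQuadratic K ∧
    (∀ V : Set M, IsOpen V → ∀ a a' : M → ℂ, HolOn n a V → HolOn n a' V →
      Set.EqOn (FormalFun.bracket (FormalFun.expH K (FormalFun.ofFun a)) (FormalFun.ofFun a'))
        0 V) ∧
    (∀ V : Set M, IsOpen V → ∀ b b' : M → ℂ, AntiholOn n b V → AntiholOn n b' V →
      Set.EqOn (FormalFun.bracket (FormalFun.expH K (FormalFun.ofFun b)) (FormalFun.ofFun b'))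
        0 V)}

variable (n M) in
/-- The set `𝒦[ε]`. -/
def KEpsSet : Set (FormalFun n M)[ε] :=
  {F | (FormalFun.IsSmooth F.fst ∧ FormalFun.IsSmooth F.snd) ∧
    (FormalFun.StartsQuadratic F.fst ∧ FormalFun.StartsQuadratic F.snd) ∧
    (∀ V : Set M, IsOpen V → ∀ a a' : M → ℂ, HolOn n a V → HolOn n a' V →
      FormalFun.EqOnEps (FormalFun.bracketEps
        (FormalFun.expHEps F (TrivSqZeroExt.inl (FormalFun.ofFun a)))
        (TrivSqZeroExt.inl (FormalFun.ofFun a'))) 0 V) ∧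
    (∀ V : Set M, IsOpen V → ∀ b b' : M → ℂ, AntiholOn n b V → AntiholOn n b' V →
      FormalFun.EqOnEps (FormalFun.bracketEps
        (FormalFun.expHEps F (TrivSqZeroExt.inl (FormalFun.ofFun b)))
        (TrivSqZeroExt.inl (FormalFun.ofFun b'))) 0 V)}

/-! ### Formal symplectic groupoids on the formal neighbourhood `(T^*M, Z)`

A formal symplectic groupoid is determined by its source and target mappings, subject to the
axioms below. -/

section Groupoid

variable [IsManifold 𝓘(ℂ, Fin n → ℂ) ω M]

/-- The source and target mappings of a formal symplectic groupoid over `(M, g)`. -/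
structure Groupoid (g : Tensor n M) where
  /-- The source mapping. -/
  S : SmoothFun n M →ₐ[ℂ] FormalFun n M
  /-- The target mapping. -/
  T : SmoothFun n M →ₐ[ℂ] FormalFun n M
  smooth_S : ∀ f, FormalFun.IsSmooth (S f)
  smooth_T : ∀ f, FormalFun.IsSmooth (T f)
  unit_S : ∀ f, FormalFun.E (S f) = f
  unit_T : ∀ f, FormalFun.E (T f) = f
  poisson_S : ∀ f f', S (g.bracket f f') = FormalFun.bracket (S f) (S f')
  poisson_T : ∀ f f', T (g.bracket f f') = -FormalFun.bracket (T f) (T f')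
  commute : ∀ f f', FormalFun.bracket (S f) (T f') = 0

/-- Separation of variables: `S a = a` and `T b = b` for local holomorphic functions `a` and
local antiholomorphic functions `b`. -/
def Groupoid.SeparatesVariables {g : Tensor n M} (G : Groupoid g) : Prop :=
  (∀ V : Set M, IsOpen V → ∀ a : SmoothFun n M, HolOn n (a : M → ℂ) V →
    Set.EqOn (G.S a) (FormalFun.ofFun a) V) ∧
  (∀ V : Set M, IsOpen V → ∀ b : SmoothFun n M, AntiholOn n (b : M → ℂ) V →
    Set.EqOn (G.T b) (FormalFun.ofFun b) V)

/-- The formulas `S(ab) = a (e^{H_K} b)` and `T(ab) = (e^{H_K} a) b` for local holomorphic `a`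
and local antiholomorphic `b`; `f` is any global smooth function equal to `ab` on `V`. -/
def Groupoid.GivenBy {g : Tensor n M} (G : Groupoid g) (K : FormalFun n M) : Prop :=
  ∀ V : Set M, IsOpen V → ∀ a b : M → ℂ, HolOn n a V → AntiholOn n b V →
    ∀ f : SmoothFun n M, Set.EqOn (f : M → ℂ) (a * b) V →
      Set.EqOn (G.S f) (FormalFun.ofFun a * FormalFun.expH K (FormalFun.ofFun b)) V ∧
      Set.EqOn (G.T f) (FormalFun.expH K (FormalFun.ofFun a) * FormalFun.ofFun b) V

/-- The source and target mappings of a deformation formal symplectic groupoid over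
`(M, g + ε h)`: `ε`-linear algebra morphisms `C^∞(M)[ε] → C^∞(T^*M, Z)[ε]`. -/
structure DefGroupoid (d : Deformation n M) where
  /-- The source mapping. -/
  S : (SmoothFun n M)[ε] →ₐ[ℂ] (FormalFun n M)[ε]
  /-- The target mapping. -/
  T : (SmoothFun n M)[ε] →ₐ[ℂ] (FormalFun n M)[ε]
  eps_S : S DualNumber.eps = DualNumber.eps
  eps_T : T DualNumber.eps = DualNumber.eps
  smooth_S : ∀ f, FormalFun.IsSmooth (S f).fst ∧ FormalFun.IsSmooth (S f).snd
  smooth_T : ∀ f, FormalFun.IsSmooth (T f).fst ∧ FormalFun.IsSmooth (T f).snd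
  unit_S : ∀ f, FormalFun.E (S f).fst = f.fst ∧ FormalFun.E (S f).snd = f.snd
  unit_T : ∀ f, FormalFun.E (T f).fst = f.fst ∧ FormalFun.E (T f).snd = f.snd
  poisson_S : ∀ f f', S (d.bracket f f') = FormalFun.bracketEps (S f) (S f')
  poisson_T : ∀ f f', T (d.bracket f f') = -FormalFun.bracketEps (T f) (T f')
  commute : ∀ f f', FormalFun.bracketEps (S f) (T f') = 0

/-- Separation of variables: `S a = a` and `T b = b` for local holomorphic functions `a` and
local antiholomorphic functions `b`. -/
def DefGroupoid.SeparatesVariables {d : Deformation n M} (G : DefGroupoid d) : Prop :=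
  (∀ V : Set M, IsOpen V → ∀ a : SmoothFun n M, HolOn n (a : M → ℂ) V →
    FormalFun.EqOnEps (G.S (TrivSqZeroExt.inl a))
      (TrivSqZeroExt.inl (FormalFun.ofFun a)) V) ∧
  (∀ V : Set M, IsOpen V → ∀ b : SmoothFun n M, AntiholOn n (b : M → ℂ) V →
    FormalFun.EqOnEps (G.T (TrivSqZeroExt.inl b))
      (TrivSqZeroExt.inl (FormalFun.ofFun b)) V)

/-- The formulas `S(ab) = a (e^{H_F} b)` and `T(ab) = (e^{H_F} a) b` for local holomorphic `a`
and local antiholomorphic `b`; `f` is any global smooth function equal to `ab` on `V`. -/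
def DefGroupoid.GivenBy {d : Deformation n M} (G : DefGroupoid d) (F : (FormalFun n M)[ε]) :
    Prop :=
  ∀ V : Set M, IsOpen V → ∀ a b : M → ℂ, HolOn n a V → AntiholOn n b V →
    ∀ f : SmoothFun n M, Set.EqOn (f : M → ℂ) (a * b) V →
      FormalFun.EqOnEps (G.S (TrivSqZeroExt.inl f))
        (TrivSqZeroExt.inl (FormalFun.ofFun a) *
          FormalFun.expHEps F (TrivSqZeroExt.inl (FormalFun.ofFun b))) V ∧
      FormalFun.EqOnEps (G.T (TrivSqZeroExt.inl f))
        (FormalFun.expHEps F (TrivSqZeroExt.inl (FormalFun.ofFun a)) *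
          TrivSqZeroExt.inl (FormalFun.ofFun b)) V

end Groupoid

end Manifold

end KahlerPoisson

end

open KahlerPoisson

/-! The argument is algebraic and local. In a chart, formal functions are power series in the fibre
variables `ξ_i` over the algebra `A` of smooth functions. All that is used of `A` is recorded in
`Coords`: commuting derivations `∂_i` and dual elements `x_i`; a map `typ` to `Bool` marks the
holomorphic indices. As `A` is an arbitrary commutative ℂ-algebra, the deformed theory is the
undeformed one over the dual numbers `A[ε]`: the equations on `g + ε h` are the single Jacobi
equation over `A[ε]`, split into its two components (`isKP_locTensor_iff`).

Membership in `𝒦` becomes `IsK`: `e^{H_F} x_i` does not depend on `ξ_j` when `i` and `j` have the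
same type. If two such `F` first differ in degree `N ≥ 3`, the leading part `D` of the difference
satisfies `∂_i ∂_j D = 0` for `i`, `j` of equal type. Among three variables of two types two have
equal type, so `D = 0` (`IsK.sub_mem_fil`). Hence `F` is determined by its quadratic part. Evenness
follows: `F(-ξ)` is again in `𝒦` and has the same quadratic part. The terms linear in `ξ` of
`{e^{H_F} x_i, e^{H_F} x_k} = 0` give the Jacobi identity for the quadratic part (`IsK.jacobi`).

Conversely, the Jacobi identity for `g` says that the vector fields `v_i = g^{ij} ∂_j`, `i` running
over one type, commute. Put `S u = exp(∑ ξ_i v_i) u` over the holomorphic `i`, and define `T`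
likewise over the antiholomorphic ones (`src`). Then `∂S(u)/∂ξ_i = S(v_i u)`. The identities to be
shown for `S` and `T` have defects that vanish on the zero section and whose fibre derivatives are
combinations of defects, so the defects vanish (`eq_zero_of_pderiv_mem_span`). Thus `S` is Poisson,
`T` is anti-Poisson and they commute (`IsKP.br_src`, `IsKP.br_src_src`). The functions `T z^k` and
`S z̄^l` therefore Poisson commute and restrict to the coordinates on the zero section. A Poincaré
lemma, applied degree by degree, yields `K` with `e^{H_K}` carrying the coordinates to them
(`exists_flow_eq`); this `K` is in `𝒦` and has quadratic part `g`.

Uniqueness makes the local objects agree under restriction and change of charts, since changes of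
fibre coordinates preserve the canonical bracket (`Compatible.trans_br`); so they glue. The formulas
for `S(ab)` and `T(ab)` come from multiplicativity, `S a = a`, `T b = b`, and `IsK.flow_C_eq_src`. A
groupoid with separation of variables is unique because `{S u, z^k} = S{u, z^k}` and `{S u, z̄^l} =
0` prescribe all fibre derivatives of `S`, and similarly for `T`. The undeformed statements are
obtained by setting `ε = 0` and by regarding `K` as an element of `𝒦[ε]`. -/

noncomputable section

namespace KahlerPoisson

open MvPowerSeries

/-! ### The filtration of power series by order -/

section Filtration

variable {σ A : Type*} [CommRing A]

/-- The power series with given coefficients. -/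
def mkSeries (f : (σ →₀ ℕ) → A) : MvPowerSeries σ A := f

@[simp]
theorem coeff_mkSeries (f : (σ →₀ ℕ) → A) (m : σ →₀ ℕ) : coeff m (mkSeries f) = f m := rfl

variable (σ A) in
/-- The ideal of power series without terms of degree less than `N`. -/
def fil (N : ℕ) : Ideal (MvPowerSeries σ A) where
  carrier := {P | ∀ m : σ →₀ ℕ, m.degree < N → coeff m P = 0}
  add_mem' := fun {P Q} hP hQ m hm => by rw [map_add, hP m hm, hQ m hm, add_zero]
  zero_mem' := fun m _ => by simp
  smul_mem' := fun Q P hP m hm => by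
    classical
    rw [smul_eq_mul, coeff_mul]
    refine Finset.sum_eq_zero fun p hp => ?_
    have h : p.2.degree ≤ m.degree := by
      rw [← Finset.HasAntidiagonal.mem_antidiagonal.1 hp, map_add]; omega
    rw [hP p.2 (by omega), mul_zero]

theorem mem_fil {N : ℕ} {P : MvPowerSeries σ A} :
    P ∈ fil σ A N ↔ ∀ m : σ →₀ ℕ, m.degree < N → coeff m P = 0 := Iff.rfl

theorem fil_anti {N N' : ℕ} (h : N' ≤ N) : fil σ A N ≤ fil σ A N' :=
  fun _ hP m hm => hP m (by omega)

theorem mem_fil_of_le {N N' : ℕ} {P : MvPowerSeries σ A} (hP : P ∈ fil σ A N) (h : N' ≤ N) :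
    P ∈ fil σ A N' := fil_anti h hP

@[simp]
theorem fil_zero : fil σ A 0 = ⊤ := by
  ext P; simp [mem_fil]

theorem mul_mem_fil {a b : ℕ} {P Q : MvPowerSeries σ A} (hP : P ∈ fil σ A a)
    (hQ : Q ∈ fil σ A b) : P * Q ∈ fil σ A (a + b) := by
  classical
  intro m hm
  rw [coeff_mul]
  refine Finset.sum_eq_zero fun p hp => ?_
  have h : p.1.degree + p.2.degree = m.degree := by
    rw [← Finset.HasAntidiagonal.mem_antidiagonal.1 hp, map_add]
  by_cases h1 : p.1.degree < a
  · rw [hP p.1 h1, zero_mul]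
  · rw [hQ p.2 (by omega), mul_zero]

theorem eq_zero_of_forall_mem_fil {P : MvPowerSeries σ A} (h : ∀ N, P ∈ fil σ A N) : P = 0 := by
  ext m
  exact h (m.degree + 1) m (by omega)

theorem eq_of_forall_sub_mem_fil {P Q : MvPowerSeries σ A} (h : ∀ N, P - Q ∈ fil σ A N) :
    P = Q := sub_eq_zero.1 (eq_zero_of_forall_mem_fil h)

theorem mem_fil_one {P : MvPowerSeries σ A} : P ∈ fil σ A 1 ↔ constantCoeff P = 0 := by
  constructor
  · intro h; simpa using h 0 (by simp)
  · intro h m hm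
    have : m = 0 := by rw [← Finsupp.degree_eq_zero_iff]; omega
    rw [this]; simpa using h

theorem X_mem_fil (i : σ) : (X i : MvPowerSeries σ A) ∈ fil σ A 1 := by
  rw [mem_fil_one]; simp

theorem coeff_eq_of_sub_mem_fil {N : ℕ} {P Q : MvPowerSeries σ A} (h : P - Q ∈ fil σ A N)
    {m : σ →₀ ℕ} (hm : m.degree < N) : coeff m P = coeff m Q := by
  rw [← sub_eq_zero, ← map_sub]; exact h m hm

theorem smul_mem_fil [Algebra ℂ A] {N : ℕ} {P : MvPowerSeries σ A} (hP : P ∈ fil σ A N) (r : ℂ) :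
    r • P ∈ fil σ A N := fun m hm => by
  change r • coeff m P = 0
  rw [hP m hm, smul_zero]

theorem pderiv_mem_fil {N : ℕ} {P : MvPowerSeries σ A} (hP : P ∈ fil σ A (N + 1)) (i : σ) :
    pderiv A i P ∈ fil σ A N := fun m hm => by
  rw [coeff_pderiv, hP _ (by simp [map_add]; omega), zero_mul]

theorem pderiv_mem_fil_pred {N : ℕ} {P : MvPowerSeries σ A} (hP : P ∈ fil σ A N) (i : σ) :
    pderiv A i P ∈ fil σ A (N - 1) := by
  rcases N with _ | N
  · simp
  · exact pderiv_mem_fil hP i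

theorem exists_eq_add_single {m : σ →₀ ℕ} (hm : m ≠ 0) :
    ∃ i m', m = m' + Finsupp.single i 1 := by
  classical
  obtain ⟨i, hi⟩ := Finsupp.ne_iff.1 hm
  refine ⟨i, m - Finsupp.single i 1, (tsub_add_cancel_of_le ?_).symm⟩
  intro j
  by_cases h : j = i
  · subst h; simpa [Nat.one_le_iff_ne_zero] using hi
  · simp [Finsupp.single_eq_of_ne h]

/-- A power series of positive order lies in the ideal generated by the variables. -/
theorem exists_eq_sum_X_mul [Fintype σ] {N : ℕ} {P : MvPowerSeries σ A}
    (hP : P ∈ fil σ A (N + 1)) :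
    ∃ Q : σ → MvPowerSeries σ A, (∀ i, Q i ∈ fil σ A N) ∧ P = ∑ i, X i * Q i := by
  classical
  -- A choice of one variable dividing each nontrivial monomial; it distributes the monomials of `P`
  -- among the quotients `Q i`.
  have hex : ∀ m : σ →₀ ℕ, ∃ f : Option σ, ∀ i, m = 0 ∨ (f = some i → m i ≠ 0) ∧ f ≠ none := by
    intro m
    by_cases hm : m = 0
    · exact ⟨none, fun i => Or.inl hm⟩
    · obtain ⟨i, hi⟩ := Finsupp.ne_iff.1 hm
      exact ⟨some i, fun j => Or.inr ⟨fun h => by rw [← Option.some.inj h]; exact hi, by simp⟩⟩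
  choose f hf using hex
  refine ⟨fun i => mkSeries fun m => if f (m + Finsupp.single i 1) = some i then
    coeff (m + Finsupp.single i 1) P else 0, fun i m hm => ?_, ?_⟩
  · rw [coeff_mkSeries]
    split_ifs
    · exact hP _ (by simp [map_add]; omega)
    · rfl
  · ext m
    rw [map_sum]
    have hX : ∀ i (Q : MvPowerSeries σ A), coeff m (X i * Q) =
        if Finsupp.single i 1 ≤ m then coeff (m - Finsupp.single i 1) Q else 0 := by
      intro i Q
      rw [X, coeff_monomial_mul]; simp
    simp only [hX, coeff_mkSeries]
    by_cases hm : m = 0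
    · subst hm
      rw [hP 0 (by simp)]
      refine (Finset.sum_eq_zero fun i _ => ?_).symm
      rw [if_neg]
      intro h; simpa using h i
    · obtain ⟨i, hi⟩ : ∃ i, f m = some i := by
        obtain ⟨i, -⟩ := Finsupp.ne_iff.1 hm
        exact Option.ne_none_iff_exists'.1 (((hf m i).resolve_left hm).2)
      have hle : Finsupp.single i 1 ≤ m := by
        intro j
        by_cases h : j = i
        · subst h
          simpa [Nat.one_le_iff_ne_zero] using ((hf m j).resolve_left hm).1 hi
        · simp [Finsupp.single_eq_of_ne h]
      rw [Finset.sum_eq_single i]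
      · rw [if_pos hle, tsub_add_cancel_of_le hle, if_pos hi]
      · intro j _ hj
        split_ifs with hlj
        · rename_i h'
          rw [tsub_add_cancel_of_le hlj, hi] at h'
          exact absurd (Option.some.inj h').symm hj
        · rfl
        · rfl
      · simp

variable [Algebra ℂ A]

/-- The coefficient ring need not be a domain, but positive integers are invertible in a ℂ-algebra.
-/
theorem natCast_mul_cancel {a : A} (k : ℕ) (h : a * ((k : A) + 1) = 0) : a = 0 := by
  have hk : ((k : ℂ) + 1) ≠ 0 := by exact_mod_cast Nat.succ_ne_zero k
  have h1 : ((k : ℂ) + 1) • a = 0 := by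
    rw [Algebra.smul_def, map_add, map_natCast, map_one, mul_comm]; exact h
  exact (smul_eq_zero_iff_right hk).1 h1

/-- Formal integration: up to a nonzero integer factor, every coefficient of positive degree is a
coefficient of some partial derivative. -/
theorem mem_fil_succ_of_pderiv {N : ℕ} {P : MvPowerSeries σ A} (h0 : constantCoeff P = 0)
    (h : ∀ i, pderiv A i P ∈ fil σ A N) : P ∈ fil σ A (N + 1) := by
  intro m hm
  by_cases hm0 : m = 0
  · rw [hm0]; simpa using h0
  · obtain ⟨i, m', rfl⟩ := exists_eq_add_single hm0
    have := h i m' (by simp [map_add] at hm; omega)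
    rw [coeff_pderiv] at this
    exact natCast_mul_cancel _ this

/-- A family of power series with vanishing constant terms whose span is closed under the partial
derivatives vanishes. -/
theorem eq_zero_of_pderiv_mem_span {ι : Type*} (W : ι → MvPowerSeries σ A)
    (h0 : ∀ a, constantCoeff (W a) = 0)
    (h : ∀ a i, pderiv A i (W a) ∈ Ideal.span (Set.range W)) (a : ι) : W a = 0 := by
  -- The whole family gains one order at a time: if all members lie in the ideal `fil N`, so do
  -- their derivatives, and then the members lie in `fil (N + 1)`.
  have key : ∀ N a, W a ∈ fil σ A N := by
    intro N
    induction N with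
    | zero => simp
    | succ N ih =>
      intro a
      refine mem_fil_succ_of_pderiv (h0 a) fun i => ?_
      refine (Ideal.span_le.2 ?_) (h a i)
      rintro _ ⟨b, rfl⟩
      exact ih b
  exact eq_zero_of_forall_mem_fil fun N => key N a

end Filtration

/-! ### Exponentials of operators raising the order -/

section Exponential

variable {σ A : Type*} [CommRing A] [Algebra ℂ A]

/-- The operator `H` raises the order of power series. -/
def Raises (H : MvPowerSeries σ A →ₗ[ℂ] MvPowerSeries σ A) : Prop :=
  ∀ N P, P ∈ fil σ A N → H P ∈ fil σ A (N + 1)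

/-- The exponential series `∑_k H^k Q / k!`. -/
def expSeries (H : MvPowerSeries σ A →ₗ[ℂ] MvPowerSeries σ A) (Q : MvPowerSeries σ A) :
    MvPowerSeries σ A := fun m =>
  ∑ k ∈ Finset.range (m.degree + 1), ((k.factorial : ℂ))⁻¹ • coeff m ((H ^ k) Q)

/-- The term `H^k Q / k!` of the exponential series. -/
def expTerm (H : MvPowerSeries σ A →ₗ[ℂ] MvPowerSeries σ A) (k : ℕ) (Q : MvPowerSeries σ A) :
    MvPowerSeries σ A := ((k.factorial : ℂ))⁻¹ • (H ^ k) Q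

theorem coeff_smul_complex (m : σ →₀ ℕ) (r : ℂ) (P : MvPowerSeries σ A) :
    coeff m (r • P) = r • coeff m P := rfl

variable {H : MvPowerSeries σ A →ₗ[ℂ] MvPowerSeries σ A}

theorem coeff_expSeries (H : MvPowerSeries σ A →ₗ[ℂ] MvPowerSeries σ A) (Q : MvPowerSeries σ A)
    (m : σ →₀ ℕ) :
    coeff m (expSeries H Q) = ∑ k ∈ Finset.range (m.degree + 1), coeff m (expTerm H k Q) := rfl

theorem Raises.pow_mem (hH : Raises H) {N : ℕ} {Q : MvPowerSeries σ A} (hQ : Q ∈ fil σ A N)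
    (k : ℕ) : (H ^ k) Q ∈ fil σ A (N + k) := by
  induction k with
  | zero => simpa using hQ
  | succ k ih => rw [pow_succ']; exact hH _ _ ih

theorem Raises.expTerm_mem (hH : Raises H) {N : ℕ} {Q : MvPowerSeries σ A} (hQ : Q ∈ fil σ A N)
    (k : ℕ) : expTerm H k Q ∈ fil σ A (N + k) := smul_mem_fil (hH.pow_mem hQ k) _

theorem Raises.expTerm_mem' (hH : Raises H) (Q : MvPowerSeries σ A) (k : ℕ) :
    expTerm H k Q ∈ fil σ A k := by
  simpa using hH.expTerm_mem (N := 0) (Q := Q) (by simp) k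

theorem Raises.neg (hH : Raises H) : Raises (-H) := fun N P hP => by
  simpa using (fil σ A (N + 1)).neg_mem (hH N P hP)

theorem expTerm_zero (Q : MvPowerSeries σ A) : expTerm H 0 Q = Q := by simp [expTerm]

theorem expTerm_one (Q : MvPowerSeries σ A) : expTerm H 1 Q = H Q := by simp [expTerm]

/-- The exponential agrees with its partial sums up to terms of high order. -/
theorem Raises.expSeries_sub_mem (hH : Raises H) {b : ℕ} {Q : MvPowerSeries σ A}
    (hQ : Q ∈ fil σ A b) (N : ℕ) :
    expSeries H Q - ∑ k ∈ Finset.range N, expTerm H k Q ∈ fil σ A (b + N) := by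
  intro m hm
  rw [map_sub, coeff_expSeries, map_sum, sub_eq_zero]
  have hz : ∀ k, m.degree < b + k → coeff m (expTerm H k Q) = 0 := fun k hk =>
    hH.expTerm_mem hQ k m hk
  rcases le_total N (m.degree + 1) with h | h
  · refine (Finset.sum_subset (Finset.range_subset_range.2 h) fun k _ hk => hz k ?_).symm
    simp at hk; omega
  · refine Finset.sum_subset (Finset.range_subset_range.2 h) fun k _ hk => hz k ?_
    simp at hk; omega

theorem Raises.expSeries_mem (hH : Raises H) {b : ℕ} {Q : MvPowerSeries σ A}
    (hQ : Q ∈ fil σ A b) : expSeries H Q ∈ fil σ A b := by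
  simpa using hH.expSeries_sub_mem hQ 0

theorem Raises.expSeries_sub_self_mem (hH : Raises H) {b : ℕ} {Q : MvPowerSeries σ A}
    (hQ : Q ∈ fil σ A b) : expSeries H Q - Q ∈ fil σ A (b + 1) := by
  simpa [expTerm_zero] using hH.expSeries_sub_mem hQ 1

theorem expSeries_add (P Q : MvPowerSeries σ A) :
    expSeries H (P + Q) = expSeries H P + expSeries H Q := by
  ext m
  simp [coeff_expSeries, expTerm, Finset.sum_add_distrib]

theorem expSeries_smul (r : ℂ) (Q : MvPowerSeries σ A) :
    expSeries H (r • Q) = r • expSeries H Q := by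
  ext m
  simp only [coeff_expSeries, expTerm, coeff_smul_complex, Finset.smul_sum, map_smul]
  exact Finset.sum_congr rfl fun k _ => smul_comm _ _ _

/-- The exponential as a linear operator. -/
def expLin (H : MvPowerSeries σ A →ₗ[ℂ] MvPowerSeries σ A) :
    MvPowerSeries σ A →ₗ[ℂ] MvPowerSeries σ A where
  toFun := expSeries H
  map_add' := expSeries_add
  map_smul' := expSeries_smul

theorem expSeries_neg' (Q : MvPowerSeries σ A) : expSeries H (-Q) = -expSeries H Q :=
  map_neg (expLin H) Q

theorem expSeries_sub (P Q : MvPowerSeries σ A) :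
    expSeries H (P - Q) = expSeries H P - expSeries H Q := map_sub (expLin H) P Q

theorem expSeries_zero : expSeries H 0 = 0 := map_zero (expLin H)

theorem expSeries_sum {ι : Type*} (s : Finset ι) (Q : ι → MvPowerSeries σ A) :
    expSeries H (∑ i ∈ s, Q i) = ∑ i ∈ s, expSeries H (Q i) := map_sum (expLin H) Q s

theorem choose_eq_div (i j : ℕ) :
    ((i + j).choose i : ℂ) = (i + j).factorial / (i.factorial * j.factorial) := by
  have h := Nat.choose_mul_factorial_mul_factorial (Nat.le_add_right i j)
  rw [Nat.add_sub_cancel_left] at h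
  have h1 : (i.factorial : ℂ) ≠ 0 := by exact_mod_cast i.factorial_ne_zero
  have h2 : (j.factorial : ℂ) ≠ 0 := by exact_mod_cast j.factorial_ne_zero
  rw [eq_div_iff (mul_ne_zero h1 h2), ← mul_assoc]
  exact_mod_cast h

/-- Leibniz formula for the powers of a derivation; division by `k!` turns binomial coefficients
into divided powers of the two factors. -/
theorem expTerm_bilin (B : MvPowerSeries σ A →ₗ[ℂ] MvPowerSeries σ A →ₗ[ℂ] MvPowerSeries σ A)
    (hB : ∀ P Q, H (B P Q) = B (H P) Q + B P (H Q)) (k : ℕ) (P Q : MvPowerSeries σ A) :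
    expTerm H k (B P Q) =
      ∑ p ∈ Finset.HasAntidiagonal.antidiagonal k, B (expTerm H p.1 P) (expTerm H p.2 Q) := by
  have hpow : ∀ k, (H ^ k) (B P Q) = ∑ p ∈ Finset.HasAntidiagonal.antidiagonal k,
      (k.choose p.1 : ℂ) • B ((H ^ p.1) P) ((H ^ p.2) Q) := by
    intro k
    induction k with
    | zero => simp
    | succ k ih =>
      rw [pow_succ', Module.End.mul_apply, ih, map_sum]
      have hs : ∀ (k : ℕ) R, H ((H ^ k) R) = (H ^ (k + 1)) R := fun k R => by
        rw [pow_succ', Module.End.mul_apply]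
      simp only [map_smul, hB, smul_add, hs]
      rw [Finset.sum_add_distrib, Finset.Nat.sum_antidiagonal_succ]
      have h1 := Finset.Nat.sum_antidiagonal_succ (n := k)
        (f := fun p => ((k.choose p.1 : ℕ) : ℂ) • B ((H ^ p.1) P) ((H ^ p.2) Q))
      have h2 := Finset.Nat.sum_antidiagonal_succ' (n := k)
        (f := fun p => ((k.choose p.1 : ℕ) : ℂ) • B ((H ^ p.1) P) ((H ^ p.2) Q))
      simp only [Nat.choose_succ_self, Nat.cast_zero, zero_smul, zero_add] at h1 h2
      rw [← h2, h1]
      simp only [Nat.choose_succ_succ, Nat.cast_add, add_smul, Finset.sum_add_distrib]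
      simp
      abel
  rw [expTerm, hpow, Finset.smul_sum]
  refine Finset.sum_congr rfl fun p hp => ?_
  have hk := Finset.HasAntidiagonal.mem_antidiagonal.1 hp
  rw [expTerm, expTerm, map_smul, map_smul, LinearMap.smul_apply, smul_smul, smul_smul]
  congr 1
  rw [← hk, choose_eq_div]
  have h1 : (p.1.factorial : ℂ) ≠ 0 := by exact_mod_cast p.1.factorial_ne_zero
  have h2 : (p.2.factorial : ℂ) ≠ 0 := by exact_mod_cast p.2.factorial_ne_zero
  have h3 : ((p.1 + p.2).factorial : ℂ) ≠ 0 := by exact_mod_cast (p.1 + p.2).factorial_ne_zero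
  field_simp

/-- If `H` is a derivation of a bilinear operation `B`, then its exponential is an endomorphism
of `B`. -/
theorem Raises.expSeries_bilin (hH : Raises H)
    (B : MvPowerSeries σ A →ₗ[ℂ] MvPowerSeries σ A →ₗ[ℂ] MvPowerSeries σ A)
    (hB : ∀ P Q, H (B P Q) = B (H P) Q + B P (H Q))
    (hfil : ∀ a b P Q, P ∈ fil σ A a → Q ∈ fil σ A b → B P Q ∈ fil σ A (a + b - 1))
    (P Q : MvPowerSeries σ A) :
    expSeries H (B P Q) = B (expSeries H P) (expSeries H Q) := by
  refine eq_of_forall_sub_mem_fil fun N => ?_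
  -- One term more than the target order, because `B` is allowed to lose one order, as the bracket
  -- does.
  have hP := hH.expSeries_sub_mem (b := 0) (Q := P) (by simp) (N + 1)
  have hQ := hH.expSeries_sub_mem (b := 0) (Q := Q) (by simp) (N + 1)
  have hPQ := hH.expSeries_sub_mem (b := 0) (Q := B P Q) (by simp) (N + 1)
  rw [zero_add] at hP hQ hPQ
  set p := ∑ k ∈ Finset.range (N + 1), expTerm H k P with hp
  set q := ∑ k ∈ Finset.range (N + 1), expTerm H k Q with hq
  have h1 : B (expSeries H P) (expSeries H Q) - B p q ∈ fil σ A N := by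
    have e : B (expSeries H P) (expSeries H Q) - B p q =
        B (expSeries H P - p) (expSeries H Q) + B p (expSeries H Q - q) := by
      simp
    rw [e]
    exact (fil σ A N).add_mem
      (mem_fil_of_le (hfil (N + 1) 0 _ _ hP (by simp)) (by omega))
      (mem_fil_of_le (hfil 0 (N + 1) _ _ (by simp) hQ) (by omega))
  -- The product of the truncated sums contains every term with `i + j ≤ N`; each of the others has
  -- order at least `i + j - 1 ≥ N`.
  have h2 : B p q - ∑ k ∈ Finset.range (N + 1), expTerm H k (B P Q) ∈ fil σ A N := by
    have e : B p q = ∑ x ∈ Finset.range (N + 1) ×ˢ Finset.range (N + 1),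
        B (expTerm H x.1 P) (expTerm H x.2 Q) := by
      rw [Finset.sum_product, hp, map_sum B, LinearMap.sum_apply]
      exact Finset.sum_congr rfl fun i _ => by rw [hq, map_sum]
    have e' : ∑ k ∈ Finset.range (N + 1), expTerm H k (B P Q) =
        ∑ x ∈ (Finset.range (N + 1) ×ˢ Finset.range (N + 1)).filter (fun x => x.1 + x.2 < N + 1),
          B (expTerm H x.1 P) (expTerm H x.2 Q) := by
      simp only [expTerm_bilin B hB]
      rw [Finset.sum_sigma']
      refine Finset.sum_bij' (fun x _ => x.2) (fun x _ => ⟨x.1 + x.2, x⟩) ?_ ?_ ?_ ?_ ?_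
      · rintro ⟨k, i, j⟩ h; simp at h ⊢; omega
      · rintro ⟨i, j⟩ h; simp at h ⊢; omega
      · rintro ⟨k, i, j⟩ h; simp at h ⊢; exact h.2
      · rintro ⟨i, j⟩ h; simp
      · rintro ⟨k, i, j⟩ h; rfl
    rw [e, e', ← Finset.sum_filter_add_sum_filter_not _ (fun x => x.1 + x.2 < N + 1),
      add_sub_cancel_left]
    refine (fil σ A N).sum_mem fun x hx => ?_
    simp at hx
    exact mem_fil_of_le (hfil _ _ _ _ (hH.expTerm_mem' P x.1) (hH.expTerm_mem' Q x.2))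
      (by omega)
  have h3 := mem_fil_of_le hPQ (Nat.le_succ N)
  have := (fil σ A N).sub_mem h3 ((fil σ A N).add_mem h1 h2)
  convert this using 1
  abel

/-- In the product of the two exponentials the coefficient of `H ^ k` is `(1 - 1)^k / k!`, which
vanishes for positive `k`. The rest is bookkeeping of truncations. -/
theorem Raises.expSeries_neg_expSeries (hH : Raises H) (Q : MvPowerSeries σ A) :
    expSeries (-H) (expSeries H Q) = Q := by
  refine eq_of_forall_sub_mem_fil fun N => ?_
  have h1 := hH.expSeries_sub_mem (b := 0) (Q := Q) (by simp) (N + 1)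
  rw [zero_add] at h1
  set q := ∑ k ∈ Finset.range (N + 1), expTerm H k Q with hq
  have h2 := hH.neg.expSeries_mem h1
  have h3 := hH.neg.expSeries_sub_mem (b := 0) (Q := q) (by simp) (N + 1)
  rw [expSeries_sub] at h2
  rw [zero_add] at h3
  have hterm : ∀ i j, expTerm (-H) i (expTerm H j Q) =
      ((-1 : ℂ) ^ i * ((i.factorial : ℂ)⁻¹ * (j.factorial : ℂ)⁻¹)) • (H ^ (i + j)) Q := by
    intro i j
    rw [expTerm, expTerm, map_smul, smul_smul, pow_add, Module.End.mul_apply]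
    have : ((-H) ^ i) = ((-1 : ℂ) ^ i) • H ^ i := by
      rw [← smul_pow]; simp
    rw [this, LinearMap.smul_apply, smul_smul]
    congr 1; ring
  have h4 : ∑ k ∈ Finset.range (N + 1), expTerm (-H) k q - Q ∈ fil σ A N := by
    have e : ∑ k ∈ Finset.range (N + 1), expTerm (-H) k q =
        ∑ x ∈ Finset.range (N + 1) ×ˢ Finset.range (N + 1), expTerm (-H) x.1 (expTerm H x.2 Q) := by
      rw [Finset.sum_product]
      refine Finset.sum_congr rfl fun i _ => ?_
      rw [hq]; simp only [expTerm, map_sum, Finset.smul_sum]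
    have e' : ∑ x ∈ (Finset.range (N + 1) ×ˢ Finset.range (N + 1)).filter
          (fun x => x.1 + x.2 < N + 1), expTerm (-H) x.1 (expTerm H x.2 Q) = Q := by
      trans ∑ k ∈ Finset.range (N + 1), ∑ x ∈ Finset.HasAntidiagonal.antidiagonal k,
          expTerm (-H) x.1 (expTerm H x.2 Q)
      · rw [Finset.sum_sigma']
        symm
        refine Finset.sum_bij' (fun x _ => x.2) (fun x _ => ⟨x.1 + x.2, x⟩) ?_ ?_ ?_ ?_ ?_
        · rintro ⟨k, i, j⟩ h; simp at h ⊢; omega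
        · rintro ⟨i, j⟩ h; simp at h ⊢; omega
        · rintro ⟨k, i, j⟩ h; simp at h ⊢; exact h.2
        · rintro ⟨i, j⟩ h; simp
        · rintro ⟨k, i, j⟩ h; rfl
      · rw [Finset.sum_range_succ', Finset.sum_eq_zero]
        · simp [expTerm_zero]
        · intro k _
          have : ∀ x ∈ Finset.HasAntidiagonal.antidiagonal (k + 1),
              expTerm (-H) x.1 (expTerm H x.2 Q) =
              ((-1 : ℂ) ^ x.1 * ((x.1.factorial : ℂ)⁻¹ * (x.2.factorial : ℂ)⁻¹)) •
                (H ^ (k + 1)) Q := by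
            intro x hx
            rw [hterm, Finset.HasAntidiagonal.mem_antidiagonal.1 hx]
          rw [Finset.sum_congr rfl this, ← Finset.sum_smul]
          have hz : ∑ x ∈ Finset.HasAntidiagonal.antidiagonal (k + 1),
              ((-1 : ℂ) ^ x.1 * ((x.1.factorial : ℂ)⁻¹ * (x.2.factorial : ℂ)⁻¹)) = 0 := by
            have hc := (Commute.all (-1 : ℂ) 1).add_pow' (k + 1)
            rw [neg_add_cancel, zero_pow (Nat.succ_ne_zero k)] at hc
            have hf : ((k + 1).factorial : ℂ) ≠ 0 := by
              exact_mod_cast (k + 1).factorial_ne_zero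
            apply mul_left_cancel₀ hf
            rw [mul_zero, Finset.mul_sum, hc]
            refine Finset.sum_congr rfl fun x hx => ?_
            have hx' := Finset.HasAntidiagonal.mem_antidiagonal.1 hx
            rw [← hx', nsmul_eq_mul, choose_eq_div]
            have h1 : (x.1.factorial : ℂ) ≠ 0 := by exact_mod_cast x.1.factorial_ne_zero
            have h2 : (x.2.factorial : ℂ) ≠ 0 := by exact_mod_cast x.2.factorial_ne_zero
            field_simp
            simp
          rw [hz, zero_smul]
    rw [e, ← Finset.sum_filter_add_sum_filter_not _ (fun x => x.1 + x.2 < N + 1), e',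
      add_sub_cancel_left]
    refine (fil σ A N).sum_mem fun x hx => ?_
    simp at hx
    rw [hterm]
    exact smul_mem_fil (mem_fil_of_le (hH.pow_mem (N := 0) (by simp) _) (by omega)) _
  have h5 := (fil σ A N).add_mem (mem_fil_of_le h2 (Nat.le_succ N))
    ((fil σ A N).add_mem (mem_fil_of_le h3 (Nat.le_succ N)) h4)
  convert h5 using 1
  abel

theorem Raises.expSeries_expSeries_neg (hH : Raises H) (Q : MvPowerSeries σ A) :
    expSeries H (expSeries (-H) Q) = Q := by
  simpa using hH.neg.expSeries_neg_expSeries Q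

/-- Exponentials are natural for additive maps preserving the order. -/
theorem expSeries_natural {τ A' : Type*} [CommRing A'] [Algebra ℂ A']
    {H' : MvPowerSeries τ A' →ₗ[ℂ] MvPowerSeries τ A'} (hH : Raises H) (hH' : Raises H')
    (θ : MvPowerSeries σ A →ₗ[ℂ] MvPowerSeries τ A')
    (hθ : ∀ N P, P ∈ fil σ A N → θ P ∈ fil τ A' N) (h : ∀ P, θ (H P) = H' (θ P))
    (Q : MvPowerSeries σ A) : θ (expSeries H Q) = expSeries H' (θ Q) := by
  have hk : ∀ k, θ (expTerm H k Q) = expTerm H' k (θ Q) := by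
    intro k
    rw [expTerm, expTerm, map_smul]
    congr 1
    induction k with
    | zero => simp
    | succ k ih => rw [pow_succ', pow_succ', Module.End.mul_apply, Module.End.mul_apply, h, ih]
  refine eq_of_forall_sub_mem_fil fun N => ?_
  have h1 := hθ _ _ (hH.expSeries_sub_mem (b := 0) (Q := Q) (by simp) N)
  have h2 := hH'.expSeries_sub_mem (b := 0) (Q := θ Q) (by simp) N
  rw [zero_add] at h1 h2
  rw [map_sub, map_sum] at h1
  simp only [hk] at h1
  convert (fil τ A' N).sub_mem h1 h2 using 1
  abel

end Exponential

end KahlerPoisson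

end

set_option linter.unusedSectionVars false

noncomputable section

namespace KahlerPoisson

open MvPowerSeries

/-! ### The canonical Poisson bracket on power series in the fibre variables -/

section Bracket

variable {σ A : Type*} [CommRing A] [Algebra ℂ A]

/-- A derivation of the coefficients, applied coefficientwise to power series. -/
def coeffDer (D : Derivation ℂ A A) :
    Derivation ℂ (MvPowerSeries σ A) (MvPowerSeries σ A) :=
  Derivation.mk'
    { toFun := fun P => mkSeries fun m => D (coeff m P)
      map_add' := fun P Q => by ext m; simp
      map_smul' := fun r P => by
        ext m
        rw [RingHom.id_apply, coeff_smul_complex, coeff_mkSeries, coeff_mkSeries,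
          coeff_smul_complex, D.map_smul] }
    (fun P Q => by
      classical
      ext m
      change D (coeff m (P * Q)) = coeff m (P * mkSeries (fun m => D (coeff m Q))
        + Q * mkSeries (fun m => D (coeff m P)))
      rw [mul_comm Q, map_add, coeff_mul, coeff_mul, coeff_mul, map_sum,
        ← Finset.sum_add_distrib]
      refine Finset.sum_congr rfl fun p _ => ?_
      rw [Derivation.leibniz, smul_eq_mul, smul_eq_mul]
      simp only [coeff_mkSeries]
      ring)

@[simp]
theorem coeff_coeffDer (D : Derivation ℂ A A) (P : MvPowerSeries σ A) (m : σ →₀ ℕ) :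
    coeff m (coeffDer D P) = D (coeff m P) := rfl

@[simp]
theorem coeffDer_C (D : Derivation ℂ A A) (a : A) :
    coeffDer D (C a : MvPowerSeries σ A) = C (D a) := by
  classical
  ext m
  rw [coeff_coeffDer, coeff_C, coeff_C]
  split_ifs <;> simp

@[simp]
theorem coeffDer_X (D : Derivation ℂ A A) (i : σ) :
    coeffDer D (X i : MvPowerSeries σ A) = 0 := by
  classical
  ext m
  rw [coeff_coeffDer, coeff_X]
  split_ifs <;> simp

theorem coeffDer_mem_fil (D : Derivation ℂ A A) {N : ℕ} {P : MvPowerSeries σ A}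
    (hP : P ∈ fil σ A N) : coeffDer D P ∈ fil σ A N := fun m hm => by
  rw [coeff_coeffDer, hP m hm, map_zero]

theorem constantCoeff_coeffDer (D : Derivation ℂ A A) (P : MvPowerSeries σ A) :
    constantCoeff (coeffDer D P) = D (constantCoeff P) := coeff_coeffDer D P 0

/-- The partial derivative with respect to a fibre variable, as a `ℂ`-derivation. -/
def dxi (i : σ) : Derivation ℂ (MvPowerSeries σ A) (MvPowerSeries σ A) :=
  (pderiv A i).restrictScalars ℂ

theorem dxi_apply (i : σ) (P : MvPowerSeries σ A) : dxi i P = pderiv A i P := rfl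

theorem coeff_dxi (i : σ) (P : MvPowerSeries σ A) (m : σ →₀ ℕ) :
    coeff m (dxi i P) = coeff (m + Finsupp.single i 1) P * (m i + 1) := coeff_pderiv _ _

@[simp]
theorem dxi_C (i : σ) (a : A) : dxi i (C a : MvPowerSeries σ A) = 0 := pderiv_C

theorem dxi_X [DecidableEq σ] (i j : σ) :
    dxi i (X j : MvPowerSeries σ A) = if i = j then 1 else 0 := by
  rw [dxi_apply]
  split_ifs with h
  · subst h; exact pderiv_X_self
  · exact pderiv_X_of_ne (Ne.symm h)

theorem dxi_mem_fil {N : ℕ} {P : MvPowerSeries σ A} (hP : P ∈ fil σ A (N + 1)) (i : σ) :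
    dxi i P ∈ fil σ A N := pderiv_mem_fil hP i

theorem dxi_comm (i j : σ) (P : MvPowerSeries σ A) : dxi i (dxi j P) = dxi j (dxi i P) := by
  classical
  ext m
  simp only [coeff_dxi, add_right_comm m (Finsupp.single i 1)]
  by_cases h : i = j
  · subst h; rfl
  · simp [Finsupp.single_eq_of_ne h, Finsupp.single_eq_of_ne (Ne.symm h)]
    ring

theorem coeffDer_dxi (D : Derivation ℂ A A) (i : σ) (P : MvPowerSeries σ A) :
    coeffDer D (dxi i P) = dxi i (coeffDer D P) := by
  ext m
  rw [coeff_coeffDer, coeff_dxi, coeff_dxi, coeff_coeffDer]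
  have : D ((m i : A) + 1) = 0 := by
    rw [map_add, Derivation.map_natCast, Derivation.map_one_eq_zero, add_zero]
  rw [Derivation.leibniz, this, smul_zero, zero_add, smul_eq_mul, mul_comm]

theorem coeffDer_comm {D D' : Derivation ℂ A A} (h : ∀ f, D (D' f) = D' (D f))
    (P : MvPowerSeries σ A) : coeffDer D (coeffDer D' P) = coeffDer D' (coeffDer D P) := by
  ext m; simp [h]

variable (σ A) in
/-- Coordinates on an algebra: elements together with commuting dual derivations. -/
structure Coords [DecidableEq σ] where
  /-- The coordinate derivations. -/
  d : σ → Derivation ℂ A A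
  /-- The coordinates. -/
  x : σ → A
  comm : ∀ i j f, d i (d j f) = d j (d i f)
  d_x : ∀ i j, d i (x j) = if i = j then 1 else 0

variable [DecidableEq σ] [Fintype σ] (c : Coords σ A)

namespace Coords

/-- The coordinate derivation `∂ᵢ` applied to the coefficients of a power series. -/
def dx (i : σ) : Derivation ℂ (MvPowerSeries σ A) (MvPowerSeries σ A) := coeffDer (c.d i)

/-- The Hamiltonian vector field `{P, ·}` of the canonical bracket. -/
def ham (P : MvPowerSeries σ A) : Derivation ℂ (MvPowerSeries σ A) (MvPowerSeries σ A) :=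
  ∑ i, (dxi i P • c.dx i - c.dx i P • dxi i)

/-- The canonical bracket. -/
def br (P Q : MvPowerSeries σ A) : MvPowerSeries σ A := c.ham P Q

theorem br_def (P Q : MvPowerSeries σ A) :
    c.br P Q = ∑ i, (dxi i P * c.dx i Q - c.dx i P * dxi i Q) := by
  have h := map_sum (Derivation.coeFnAddMonoidHom (R := ℂ) (A := MvPowerSeries σ A)
    (M := MvPowerSeries σ A)) (fun i => dxi i P • c.dx i - c.dx i P • dxi i) Finset.univ
  exact (congrFun h Q).trans (Finset.sum_apply _ _ _)

theorem br_swap (P Q : MvPowerSeries σ A) : c.br P Q = -c.br Q P := by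
  rw [br_def, br_def, ← Finset.sum_neg_distrib]
  exact Finset.sum_congr rfl fun i _ => by ring

theorem br_add_right (P Q R : MvPowerSeries σ A) : c.br P (Q + R) = c.br P Q + c.br P R :=
  map_add _ _ _

theorem br_sub_right (P Q R : MvPowerSeries σ A) : c.br P (Q - R) = c.br P Q - c.br P R :=
  map_sub _ _ _

theorem br_neg_right (P Q : MvPowerSeries σ A) : c.br P (-Q) = -c.br P Q := map_neg _ _

theorem br_smul_right (r : ℂ) (P Q : MvPowerSeries σ A) : c.br P (r • Q) = r • c.br P Q :=
  (c.ham P).map_smul r Q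

theorem br_zero_right (P : MvPowerSeries σ A) : c.br P 0 = 0 := map_zero _

theorem br_add_left (P Q R : MvPowerSeries σ A) : c.br (P + Q) R = c.br P R + c.br Q R := by
  rw [br_swap, br_add_right, c.br_swap P, c.br_swap Q]; abel

theorem br_sub_left (P Q R : MvPowerSeries σ A) : c.br (P - Q) R = c.br P R - c.br Q R := by
  rw [br_swap, br_sub_right, c.br_swap P, c.br_swap Q]; abel

theorem br_neg_left (P Q : MvPowerSeries σ A) : c.br (-P) Q = -c.br P Q := by
  rw [br_swap, br_neg_right, c.br_swap P]

theorem br_smul_left (r : ℂ) (P Q : MvPowerSeries σ A) : c.br (r • P) Q = r • c.br P Q := by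
  rw [br_swap, br_smul_right, c.br_swap P, smul_neg]

theorem br_mul_right (P Q R : MvPowerSeries σ A) :
    c.br P (Q * R) = c.br P Q * R + Q * c.br P R := by
  rw [br, Derivation.leibniz, smul_eq_mul, smul_eq_mul, br, br]; ring

/-- The canonical bracket as a bilinear map. -/
def brLin : MvPowerSeries σ A →ₗ[ℂ] MvPowerSeries σ A →ₗ[ℂ] MvPowerSeries σ A :=
  LinearMap.mk₂ ℂ c.br c.br_add_left c.br_smul_left c.br_add_right c.br_smul_right

theorem dx_dxi (i j : σ) (P : MvPowerSeries σ A) : c.dx i (dxi j P) = dxi j (c.dx i P) :=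
  coeffDer_dxi _ _ _

theorem dx_comm (i j : σ) (P : MvPowerSeries σ A) : c.dx i (c.dx j P) = c.dx j (c.dx i P) :=
  coeffDer_comm (c.comm i j) P

@[simp]
theorem dx_C (i : σ) (a : A) : c.dx i (C a) = C (c.d i a) := coeffDer_C _ _

@[simp]
theorem dx_X (i j : σ) : c.dx i (X j) = 0 := coeffDer_X _ _

/-- The defect is a double sum over pairs of indices. Since all the derivations involved commute,
its summand is antisymmetric in the pair; so twice the sum is zero. -/
theorem br_jacobi (P Q R : MvPowerSeries σ A) :
    c.br P (c.br Q R) = c.br (c.br P Q) R + c.br Q (c.br P R) := by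
  set T : σ → σ → MvPowerSeries σ A := fun i j =>
    (dxi i P * c.dx i (dxi j Q * c.dx j R - c.dx j Q * dxi j R)
      - c.dx i P * dxi i (dxi j Q * c.dx j R - c.dx j Q * dxi j R))
    - (dxi i (dxi j P * c.dx j Q - c.dx j P * dxi j Q) * c.dx i R
      - c.dx i (dxi j P * c.dx j Q - c.dx j P * dxi j Q) * dxi i R)
    - (dxi i Q * c.dx i (dxi j P * c.dx j R - c.dx j P * dxi j R)
      - c.dx i Q * dxi i (dxi j P * c.dx j R - c.dx j P * dxi j R)) with hT
  have hsum : c.br P (c.br Q R) - c.br (c.br P Q) R - c.br Q (c.br P R) = ∑ i, ∑ j, T i j := by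
    simp only [br_def, map_sum, Finset.mul_sum, Finset.sum_mul, ← Finset.sum_sub_distrib, hT]
  have hanti : ∀ i j, T i j + T j i = 0 := by
    intro i j
    have h1 : ∀ P : MvPowerSeries σ A, dxi j (dxi i P) = dxi i (dxi j P) := dxi_comm j i
    have h2 : ∀ P : MvPowerSeries σ A, c.dx j (c.dx i P) = c.dx i (c.dx j P) := c.dx_comm j i
    simp only [hT, map_sub, Derivation.leibniz, smul_eq_mul, c.dx_dxi, h1, h2]
    ring
  have hz : ∑ i, ∑ j, T i j = 0 := by
    have h : (2 : ℂ) • ∑ i, ∑ j, T i j = 0 := by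
      rw [two_smul]
      nth_rewrite 2 [Finset.sum_comm]
      simp only [← Finset.sum_add_distrib, hanti, Finset.sum_const_zero]
    exact (smul_eq_zero_iff_right two_ne_zero).1 h
  rw [hz] at hsum
  linear_combination hsum

/-! Brackets with functions -/

theorem br_C_right (P : MvPowerSeries σ A) (a : A) :
    c.br P (C a) = ∑ i, dxi i P * C (c.d i a) := by
  simp [br_def]

theorem br_C_left (P : MvPowerSeries σ A) (a : A) :
    c.br (C a) P = -∑ i, C (c.d i a) * dxi i P := by
  rw [br_swap, br_C_right]
  simp only [mul_comm]

/-- This identity is the dictionary between the bracket conditions defining `𝒦` and the groupoids,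
and conditions on fibre derivatives. -/
theorem br_x (P : MvPowerSeries σ A) (j : σ) : c.br P (C (c.x j)) = dxi j P := by
  rw [br_C_right, Finset.sum_eq_single j]
  · simp [c.d_x]
  · intro i _ hi; simp [c.d_x, hi]
  · simp

theorem dxi_br (i : σ) (P Q : MvPowerSeries σ A) :
    dxi i (c.br P Q) = c.br (dxi i P) Q + c.br P (dxi i Q) := by
  simp only [br_def, map_sum, ← Finset.sum_add_distrib]
  refine Finset.sum_congr rfl fun j _ => ?_
  simp only [map_sub, Derivation.leibniz, smul_eq_mul, c.dx_dxi, dxi_comm i j]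
  ring

/-- In each term one factor is differentiated along the fibre, at the cost of one order. With
truncated subtraction the bound is also true for `a = b = 0`. -/
theorem br_mem_fil {a b : ℕ} {P Q : MvPowerSeries σ A} (hP : P ∈ fil σ A a)
    (hQ : Q ∈ fil σ A b) : c.br P Q ∈ fil σ A (a + b - 1) := by
  rw [br_def]
  refine Submodule.sum_mem _ fun i _ => Submodule.sub_mem _ ?_ ?_
  · exact mem_fil_of_le (mul_mem_fil (pderiv_mem_fil_pred hP i) (coeffDer_mem_fil _ hQ))
      (by omega)
  · exact mem_fil_of_le (mul_mem_fil (coeffDer_mem_fil _ hP) (pderiv_mem_fil_pred hQ i))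
      (by omega)

/-- The operator `{F, ·}` as a linear map. -/
def hamLin (F : MvPowerSeries σ A) : MvPowerSeries σ A →ₗ[ℂ] MvPowerSeries σ A := c.brLin F

@[simp]
theorem hamLin_apply (F P : MvPowerSeries σ A) : c.hamLin F P = c.br F P := rfl

theorem hamLin_neg (F : MvPowerSeries σ A) : c.hamLin (-F) = -c.hamLin F := map_neg c.brLin F

theorem raises_hamLin {F : MvPowerSeries σ A} (hF : F ∈ fil σ A 2) : Raises (c.hamLin F) :=
  fun N P hP => mem_fil_of_le (c.br_mem_fil hF hP) (by omega)

/-- `e^{H_F} Q`. -/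
def flow (F Q : MvPowerSeries σ A) : MvPowerSeries σ A := expSeries (c.hamLin F) Q

variable {c} {F : MvPowerSeries σ A}

theorem flow_mul (hF : F ∈ fil σ A 2) (P Q : MvPowerSeries σ A) :
    c.flow F (P * Q) = c.flow F P * c.flow F Q :=
  (c.raises_hamLin hF).expSeries_bilin (LinearMap.mul ℂ _)
    (fun P Q => c.br_mul_right F P Q)
    (fun _ _ _ _ hP hQ => mem_fil_of_le (mul_mem_fil hP hQ) (by omega)) P Q

/-- By the Jacobi identity `H_F` is a derivation of the bracket, so its exponential respects the
bracket; for the product in `flow_mul` the Leibniz rule plays this role. -/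
theorem flow_br (hF : F ∈ fil σ A 2) (P Q : MvPowerSeries σ A) :
    c.flow F (c.br P Q) = c.br (c.flow F P) (c.flow F Q) :=
  (c.raises_hamLin hF).expSeries_bilin c.brLin (fun P Q => c.br_jacobi F P Q)
    (fun _ _ _ _ hP hQ => c.br_mem_fil hP hQ) P Q

theorem flow_neg_flow (hF : F ∈ fil σ A 2) (Q : MvPowerSeries σ A) :
    c.flow (-F) (c.flow F Q) = Q := by
  rw [flow, hamLin_neg]; exact (c.raises_hamLin hF).expSeries_neg_expSeries Q

theorem flow_flow_neg (hF : F ∈ fil σ A 2) (Q : MvPowerSeries σ A) :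
    c.flow F (c.flow (-F) Q) = Q := by
  rw [flow, flow, hamLin_neg]; exact (c.raises_hamLin hF).expSeries_expSeries_neg Q

theorem flow_zero (F : MvPowerSeries σ A) : c.flow F 0 = 0 := expSeries_zero

theorem flow_neg (F Q : MvPowerSeries σ A) : c.flow F (-Q) = -c.flow F Q := expSeries_neg' Q

theorem flow_sub (F P Q : MvPowerSeries σ A) : c.flow F (P - Q) = c.flow F P - c.flow F Q :=
  expSeries_sub P Q

theorem flow_sum {ι : Type*} (s : Finset ι) (F : MvPowerSeries σ A) (Q : ι → MvPowerSeries σ A) :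
    c.flow F (∑ i ∈ s, Q i) = ∑ i ∈ s, c.flow F (Q i) := expSeries_sum s Q

theorem flow_sub_self_mem (hF : F ∈ fil σ A 2) {b : ℕ} {Q : MvPowerSeries σ A}
    (hQ : Q ∈ fil σ A b) : c.flow F Q - Q ∈ fil σ A (b + 1) :=
  (c.raises_hamLin hF).expSeries_sub_self_mem hQ

theorem flow_mem (hF : F ∈ fil σ A 2) {b : ℕ} {Q : MvPowerSeries σ A}
    (hQ : Q ∈ fil σ A b) : c.flow F Q ∈ fil σ A b :=
  (c.raises_hamLin hF).expSeries_mem hQ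

theorem constantCoeff_flow (hF : F ∈ fil σ A 2) (Q : MvPowerSeries σ A) :
    constantCoeff (c.flow F Q) = constantCoeff Q := by
  have := mem_fil_one.1 (flow_sub_self_mem (c := c) hF (b := 0) (Q := Q) (by simp))
  rwa [map_sub, sub_eq_zero] at this

/-- `e^{H_F} a = a + {F, a}` up to terms of degree at least two. -/
theorem flow_C_sub_mem (hF : F ∈ fil σ A 2) (a : A) :
    c.flow F (C a) - C a - c.br F (C a) ∈ fil σ A 2 := by
  have := (c.raises_hamLin hF).expSeries_sub_mem (b := 0) (Q := C a) (by simp) 2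
  rwa [Finset.sum_range_succ, Finset.sum_range_one, expTerm_zero, expTerm_one, zero_add,
    ← sub_sub] at this

/-- The first order variation of `e^{H_F} a` in `F`. -/
theorem flow_variation {F' : MvPowerSeries σ A} (hF : F ∈ fil σ A 2) (hF' : F' ∈ fil σ A 2)
    {N : ℕ} (hN : 2 ≤ N) (h : F' - F ∈ fil σ A N) (a : A) :
    c.flow F' (C a) - c.flow F (C a) - c.br (F' - F) (C a) ∈ fil σ A N := by
  have hH := c.raises_hamLin hF
  have hH' := c.raises_hamLin hF'
  -- The powers of the two operators differ at order `N - 1` at first, and each further application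
  -- adds an order. So below order `N` only the linear term of the exponential sees the change of
  -- `F`.
  have hpow : ∀ k, (c.hamLin F' ^ (k + 1)) (C a) - (c.hamLin F ^ (k + 1)) (C a) ∈
      fil σ A (N + k - 1) := by
    intro k
    induction k with
    | zero =>
      have := c.br_mem_fil h (b := 0) (Q := C a) (by simp)
      simpa [c.br_sub_left] using this
    | succ k ih =>
      have e : (c.hamLin F' ^ (k + 1 + 1)) (C a) - (c.hamLin F ^ (k + 1 + 1)) (C a) =
          c.br F' ((c.hamLin F' ^ (k + 1)) (C a) - (c.hamLin F ^ (k + 1)) (C a))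
            + c.br (F' - F) ((c.hamLin F ^ (k + 1)) (C a)) := by
        rw [pow_succ' _ (k + 1), pow_succ' _ (k + 1), Module.End.mul_apply, Module.End.mul_apply,
          hamLin_apply, hamLin_apply, c.br_sub_left, c.br_sub_right]
        abel
      rw [e]
      refine (fil σ A _).add_mem (mem_fil_of_le (c.br_mem_fil hF' ih) (by omega)) ?_
      exact mem_fil_of_le (c.br_mem_fil h (hH.pow_mem (N := 0) (Q := C a) (by simp) _))
        (by omega)
  have h1 := hH.expSeries_sub_mem (b := 0) (Q := C a) (by simp) (N + 2)
  have h2 := hH'.expSeries_sub_mem (b := 0) (Q := C a) (by simp) (N + 2)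
  have h3 : ∑ k ∈ Finset.range (N + 2), expTerm (c.hamLin F') k (C a)
      - ∑ k ∈ Finset.range (N + 2), expTerm (c.hamLin F) k (C a) - c.br (F' - F) (C a) ∈
        fil σ A N := by
    rw [← Finset.sum_sub_distrib, Finset.sum_range_succ', Finset.sum_range_succ']
    simp only [expTerm_zero, sub_self, add_zero, zero_add, expTerm_one, hamLin_apply]
    rw [← c.br_sub_left, add_sub_cancel_right]
    refine (fil σ A N).sum_mem fun k _ => ?_
    rw [expTerm, expTerm, ← smul_sub]
    exact smul_mem_fil (mem_fil_of_le (hpow (k + 1)) (by omega)) _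
  have h4 := (fil σ A N).add_mem ((fil σ A N).sub_mem (mem_fil_of_le h2 (by omega))
    (mem_fil_of_le h1 (by omega))) h3
  rw [flow, flow]
  convert h4 using 1
  abel

end Coords

end Bracket

end KahlerPoisson

end

noncomputable section

namespace KahlerPoisson

open MvPowerSeries

/-! ### The local form of the set `𝒦` -/

section LocalK

variable {σ A : Type*} [CommRing A] [Algebra ℂ A]

/-- The second derivatives of a power series at the origin. -/
def hess (F : MvPowerSeries σ A) (i j : σ) : A := constantCoeff (dxi i (dxi j F))

theorem hess_symm (F : MvPowerSeries σ A) (i j : σ) : hess F i j = hess F j i := by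
  rw [hess, dxi_comm, hess]

theorem constantCoeff_dxi_eq_zero {F : MvPowerSeries σ A} (hF : F ∈ fil σ A 2) (i : σ) :
    constantCoeff (dxi i F) = 0 := mem_fil_one.1 (dxi_mem_fil hF i)

theorem sub_mem_fil_three {F F' : MvPowerSeries σ A} (hF : F ∈ fil σ A 2) (hF' : F' ∈ fil σ A 2)
    (h : hess F = hess F') : F - F' ∈ fil σ A 3 := by
  refine mem_fil_succ_of_pderiv ?_ fun i => mem_fil_succ_of_pderiv ?_ fun j => mem_fil_one.2 ?_
  · rw [map_sub, mem_fil_one.1 (mem_fil_of_le hF one_le_two),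
      mem_fil_one.1 (mem_fil_of_le hF' one_le_two), sub_zero]
  · rw [← dxi_apply, map_sub, map_sub, constantCoeff_dxi_eq_zero hF,
      constantCoeff_dxi_eq_zero hF', sub_zero]
  · rw [← dxi_apply, ← dxi_apply, map_sub, map_sub, map_sub, sub_eq_zero]
    exact congrFun (congrFun h j) i

/-- The substitution `ξ ↦ -ξ`. -/
def flip : MvPowerSeries σ A →ₗ[ℂ] MvPowerSeries σ A where
  toFun P := mkSeries fun m => (-1 : ℂ) ^ m.degree • coeff m P
  map_add' P Q := by ext m; simp
  map_smul' r P := by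
    ext m
    rw [coeff_mkSeries, RingHom.id_apply, coeff_smul_complex, coeff_smul_complex, coeff_mkSeries,
      smul_comm]

theorem coeff_flip (P : MvPowerSeries σ A) (m : σ →₀ ℕ) :
    coeff m (flip P) = (-1 : ℂ) ^ m.degree • coeff m P := rfl

theorem flip_mul (P Q : MvPowerSeries σ A) : flip (P * Q) = flip P * flip Q := by
  classical
  ext m
  rw [coeff_flip, coeff_mul, coeff_mul, Finset.smul_sum]
  refine Finset.sum_congr rfl fun p hp => ?_
  rw [coeff_flip, coeff_flip, ← Finset.HasAntidiagonal.mem_antidiagonal.1 hp, map_add, pow_add,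
    smul_mul_smul_comm]

theorem flip_C (a : A) : flip (C a : MvPowerSeries σ A) = C a := by
  classical
  ext m
  rw [coeff_flip, coeff_C]
  split_ifs with h
  · simp [h]
  · simp

theorem flip_mem_fil {N : ℕ} {P : MvPowerSeries σ A} (hP : P ∈ fil σ A N) :
    flip P ∈ fil σ A N := fun m hm => by rw [coeff_flip, hP m hm, smul_zero]

theorem dxi_flip (i : σ) (P : MvPowerSeries σ A) : dxi i (flip P) = -flip (dxi i P) := by
  ext m
  rw [coeff_dxi, map_neg, coeff_flip, coeff_flip, coeff_dxi, map_add, Finsupp.degree_single,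
    pow_succ, smul_mul_assoc]
  simp

theorem coeffDer_flip (D : Derivation ℂ A A) (P : MvPowerSeries σ A) :
    coeffDer D (flip P) = flip (coeffDer D P) := by
  ext m
  rw [coeff_coeffDer, coeff_flip, coeff_flip, coeff_coeffDer, D.map_smul]

variable [DecidableEq σ] [Fintype σ] {c : Coords σ A} {typ : σ → Bool} {F F' : MvPowerSeries σ A}

namespace Coords

theorem br_flip (P Q : MvPowerSeries σ A) : c.br (flip P) (flip Q) = -flip (c.br P Q) := by
  rw [br_def, br_def, map_sum, ← Finset.sum_neg_distrib]
  refine Finset.sum_congr rfl fun i _ => ?_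
  rw [dxi_flip, dxi_flip, dx, coeffDer_flip, coeffDer_flip, map_sub, flip_mul, flip_mul]
  ring

/-- The substitution `ξ ↦ -ξ` reverses the sign of the bracket (`br_flip`), hence carries the
operator `{F, ·}` to `{-flip F, ·}`. -/
theorem flow_flip (hF : F ∈ fil σ A 2) (Q : MvPowerSeries σ A) :
    flip (c.flow F Q) = c.flow (-flip F) (flip Q) := by
  refine expSeries_natural (c.raises_hamLin hF)
    (c.raises_hamLin ((fil σ A 2).neg_mem (flip_mem_fil hF))) flip
    (fun N P hP => flip_mem_fil hP) (fun P => ?_) Q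
  rw [hamLin_apply, hamLin_apply, br_neg_left, br_flip, neg_neg]

/-- The chain rule for the functions `e^{H_F} a`. -/
theorem dxi_flow_C (hF : F ∈ fil σ A 2) (j : σ) (a : A) :
    dxi j (c.flow F (C a)) = ∑ i, c.flow F (C (c.d i a)) * dxi j (c.flow F (C (c.x i))) := by
  -- Writing `x_j = e^{H_F} e^{-H_F} x_j` conjugates the fibre derivative into a bracket taken
  -- before the flow, and the bracket with `C a` involves only the derivatives `∂_i a`.
  have h1 : ∀ P : MvPowerSeries σ A, dxi j (c.flow F P) =
      c.flow F (c.br P (c.flow (-F) (C (c.x j)))) := fun P => by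
    rw [flow_br hF, flow_flow_neg hF, br_x]
  rw [h1, br_C_left, flow_neg, flow_sum, ← Finset.sum_neg_distrib]
  refine Finset.sum_congr rfl fun i _ => ?_
  rw [flow_mul hF, h1, ← c.br_x _ i, ← mul_neg, c.br_swap (C (c.x i)), flow_neg]

variable (c typ) in
/-- The local form of the conditions defining the set `𝒦`. -/
def IsK (F : MvPowerSeries σ A) : Prop :=
  F ∈ fil σ A 2 ∧ ∀ i j, typ i = typ j → dxi j (c.flow F (C (c.x i))) = 0

/-- By the chain rule `dxi_flow_C`, the condition on coordinates passes to all functions of the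
coordinates of one type. -/
theorem IsK.dxi_flow_C_eq_zero (h : c.IsK typ F) {t : Bool} {a : A}
    (ha : ∀ i, typ i ≠ t → c.d i a = 0) {j : σ} (hj : typ j = t) :
    dxi j (c.flow F (C a)) = 0 := by
  rw [dxi_flow_C h.1]
  refine Finset.sum_eq_zero fun i _ => ?_
  by_cases hi : typ i = t
  · rw [h.2 i j (hi.trans hj.symm), mul_zero]
  · rw [ha i hi, map_zero, flow_zero, zero_mul]

/-- For equal types, `{e^{-H} x_i, x_j}` is the image under `e^{-H}` of `{x_i, e^{H} x_j}`, which
vanishes. -/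
theorem IsK.neg (h : c.IsK typ F) : c.IsK typ (-F) := by
  refine ⟨(fil σ A 2).neg_mem h.1, fun i j hij => ?_⟩
  have e := flow_br (c := c) ((fil σ A 2).neg_mem h.1) (C (c.x i)) (c.flow F (C (c.x j)))
  rw [flow_neg_flow h.1, br_x] at e
  rw [← e, br_swap, br_x, h.2 j i hij.symm, neg_zero, flow_zero]

/-- Two sign changes combined: `-F` is admissible, and `flow_flip` for `-F` expresses the flow of
`flip F` through that of `-F`. -/
theorem IsK.flip (h : c.IsK typ F) : c.IsK typ (flip F) := by
  have hn := h.neg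
  refine ⟨flip_mem_fil h.1, fun i j hij => ?_⟩
  have e := flow_flip (c := c) hn.1 (C (c.x i))
  rw [map_neg, neg_neg, flip_C] at e
  rw [← e, dxi_flip, hn.2 i j hij, map_zero, neg_zero]

/-- Induction on the order of `F' - F`. To leading order the flows of `x_i` differ by the derivative
of `F' - F` along `ξ_i`, so second derivatives of the leading part along two variables of equal type
vanish. A monomial of degree at least three always contains such a pair. In degree two it need not,
and this is why the quadratic part stays free. -/
theorem IsK.sub_mem_fil (h : c.IsK typ F) (h' : c.IsK typ F') (h3 : F' - F ∈ fil σ A 3) (N : ℕ) :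
    F' - F ∈ fil σ A (N + 3) := by
  induction N with
  | zero => simpa using h3
  | succ N ih =>
    intro m hm
    by_cases hm' : m.degree < N + 3
    · exact ih m hm'
    have hdeg : m.degree = N + 3 := by omega
    have hd : ∀ i j, typ i = typ j → dxi j (dxi i (F' - F)) ∈ fil σ A (N + 2) := by
      intro i j hij
      have := dxi_mem_fil (flow_variation (c := c) h.1 h'.1 (by omega) ih (c.x i)) j
      rw [map_sub, map_sub, h.2 i j hij, h'.2 i j hij, sub_zero, zero_sub, br_x] at this
      simpa using (fil σ A _).neg_mem this
    have key : ∀ i j m', typ i = typ j → m = m' + Finsupp.single j 1 + Finsupp.single i 1 →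
        coeff m (F' - F) = 0 := by
      intro i j m' hij hmm
      have hd' : m'.degree < N + 2 := by
        rw [hmm, map_add, map_add, Finsupp.degree_single, Finsupp.degree_single] at hdeg; omega
      have := hd i j hij m' hd'
      rw [coeff_dxi, coeff_dxi, ← hmm] at this
      exact natCast_mul_cancel _ (natCast_mul_cancel _ this)
    have hne : ∀ m' : σ →₀ ℕ, 0 < m'.degree → m' ≠ 0 := by
      rintro m' h rfl; simp at h
    obtain ⟨i, m₁, h₁⟩ := exists_eq_add_single (hne m (by omega))
    have d₁ : m₁.degree = N + 2 := by
      rw [h₁, map_add, Finsupp.degree_single] at hdeg; omega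
    obtain ⟨j, m₂, h₂⟩ := exists_eq_add_single (hne m₁ (by omega))
    have d₂ : m₂.degree = N + 1 := by
      rw [h₂, map_add, Finsupp.degree_single] at d₁; omega
    obtain ⟨k, m₃, h₃⟩ := exists_eq_add_single (hne m₂ (by omega))
    subst h₃ h₂ h₁
    by_cases hij : typ i = typ j
    · exact key i j _ hij rfl
    by_cases hik : typ i = typ k
    · exact key i k (m₃ + Finsupp.single j 1) hik (by abel)
    have hjk : typ j = typ k := by
      revert hij hik; cases typ i <;> cases typ j <;> cases typ k <;> simp
    exact key j k (m₃ + Finsupp.single i 1) hjk (by abel)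

/-- An element of `𝒦` is determined by its quadratic part. -/
theorem IsK.eq_of_hess_eq (h : c.IsK typ F) (h' : c.IsK typ F') (hh : hess F = hess F') :
    F = F' := by
  refine (eq_of_forall_sub_mem_fil fun N => ?_).symm
  exact mem_fil_of_le (h.sub_mem_fil h' (sub_mem_fil_three h'.1 h.1 hh.symm) N) (by omega)

/-- The elements of `𝒦` are even in the fibre variables. -/
theorem IsK.even (h : c.IsK typ F) {m : σ →₀ ℕ} (hm : Odd m.degree) : coeff m F = 0 := by
  have hh : hess F = hess (KahlerPoisson.flip F) := by
    ext i j
    rw [hess, hess, dxi_flip, map_neg, dxi_flip, neg_neg, ← coeff_zero_eq_constantCoeff_apply,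
      ← coeff_zero_eq_constantCoeff_apply, coeff_flip]
    simp
  have e := congrArg (coeff m) (h.eq_of_hess_eq h.flip hh)
  rw [coeff_flip, hm.neg_one_pow, neg_one_smul] at e
  have h2 : (2 : ℂ) • coeff m F = 0 := by rw [two_smul]; nth_rewrite 2 [e]; abel
  exact (smul_eq_zero_iff_right two_ne_zero).1 h2

/-- To first order in the fibre variables only the term `{F, x_i}` of the exponential contributes,
and it is a first derivative of `F`. -/
theorem constantCoeff_dxi_flow (hF : F ∈ fil σ A 2) (i j : σ) :
    constantCoeff (dxi j (c.flow F (C (c.x i)))) = hess F j i := by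
  have := mem_fil_one.1 (dxi_mem_fil (flow_C_sub_mem (c := c) hF (c.x i)) j)
  simp only [br_x, map_sub, dxi_C, sub_zero, sub_eq_zero] at this
  exact this

theorem IsK.hess_eq_zero (h : c.IsK typ F) {i j : σ} (hij : typ i = typ j) : hess F i j = 0 := by
  rw [← constantCoeff_dxi_flow (c := c) h.1 j i, h.2 j i hij.symm, map_zero]

/-- The quadratic part of an element of `𝒦` satisfies the Jacobi identity. -/
theorem IsK.jacobi (h : c.IsK typ F) {i k : σ} (hik : typ i = typ k) (q : σ) :
    ∑ j, hess F i j * c.d j (hess F k q) = ∑ j, hess F k j * c.d j (hess F i q) := by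
  -- Coordinates Poisson commute and the flow preserves the bracket. The part of this identity
  -- linear in the fibre variables is the Jacobi identity for the Hessian.
  have h0 : c.br (c.flow F (C (c.x i))) (c.flow F (C (c.x k))) = 0 := by
    rw [← flow_br h.1, br_x, dxi_C, flow_zero]
  have hE : ∀ i j, constantCoeff (c.dx j (c.flow F (C (c.x i)))) = if j = i then 1 else 0 := by
    intro i j
    rw [dx, constantCoeff_coeffDer, constantCoeff_flow h.1, constantCoeff_C, c.d_x]
  have hEq : ∀ i j, constantCoeff (dxi q (c.dx j (c.flow F (C (c.x i))))) =
      c.d j (hess F i q) := by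
    intro i j
    rw [← dx_dxi, dx, constantCoeff_coeffDer, constantCoeff_dxi_flow h.1, hess_symm]
  -- Second fibre derivatives of the flowed coordinates would spoil the identity, but they occur
  -- with a Kronecker delta forcing the types to agree, and then they vanish.
  have hz : ∀ i k, typ i = typ k →
      constantCoeff (dxi q (dxi k (c.flow F (C (c.x i))))) = 0 := by
    intro i k hik
    rw [h.2 i k hik, map_zero, map_zero]
  have h1 := congrArg (fun P => constantCoeff (dxi q P)) h0
  simp only [br_def, map_sum, map_sub, Derivation.leibniz, smul_eq_mul, map_add, map_mul, hE, hEq,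
    constantCoeff_dxi_flow h.1, map_zero] at h1
  have h2 : ∀ i k, typ i = typ k → ∑ j, (if j = k then (1 : A) else 0) *
      constantCoeff (dxi q (dxi j (c.flow F (C (c.x i))))) = 0 := by
    intro i k hik
    refine Finset.sum_eq_zero fun j _ => ?_
    split_ifs with hj
    · rw [hj, hz i k hik, mul_zero]
    · rw [zero_mul]
  have h3 := h2 i k hik
  have h4 := h2 k i hik.symm
  simp only [Finset.sum_sub_distrib, Finset.sum_add_distrib] at h1
  rw [h3, h4] at h1
  have e : ∀ i k, ∑ j, hess F i j * c.d j (hess F k q) =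
      ∑ j, hess F j i * c.d j (hess F k q) := fun i k =>
    Finset.sum_congr rfl fun j _ => by rw [hess_symm F i j]
  rw [e, e]
  linear_combination h1

end Coords

end LocalK

end KahlerPoisson

end

noncomputable section

namespace KahlerPoisson

open MvPowerSeries

/-! ### The source and target mappings in coordinates -/

section LocalGroupoid

variable {σ A : Type*} [CommRing A] [Algebra ℂ A] [DecidableEq σ] [Fintype σ]

namespace Coords

variable (c : Coords σ A) (typ : σ → Bool)

/-- The local form of the Jacobi identity for a tensor pairing indices of opposite type. -/
structure IsKP (g : σ → σ → A) : Prop where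
  symm : ∀ i j, g i j = g j i
  eq_zero : ∀ i j, typ i = typ j → g i j = 0
  jacobi : ∀ i k, typ i = typ k → ∀ q,
    ∑ j, g i j * c.d j (g k q) = ∑ j, g k j * c.d j (g i q)

theorem IsK.isKP {F : MvPowerSeries σ A} (h : c.IsK typ F) : c.IsKP typ (hess F) :=
  ⟨hess_symm F, fun _ _ => h.hess_eq_zero, fun _ _ hik => h.jacobi hik⟩

variable (g : σ → σ → A) (t : Bool)

/-- The derivation `gⁱʲ ∂ⱼ` if `i` is of type `t`, and zero otherwise. -/
def vf (i : σ) : Derivation ℂ A A := if typ i = t then ∑ j, g i j • c.d j else 0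

theorem vf_eq_zero {i : σ} (hi : typ i ≠ t) (u : A) : c.vf typ g t i u = 0 := by
  rw [vf, if_neg hi]; rfl

theorem vf_apply {i : σ} (hi : typ i = t) (u : A) : c.vf typ g t i u = ∑ j, g i j * c.d j u := by
  rw [vf, if_pos hi]
  have h := map_sum (Derivation.coeFnAddMonoidHom (R := ℂ) (A := A) (M := A))
    (fun j => g i j • c.d j) Finset.univ
  exact (congrFun h u).trans (Finset.sum_apply _ _ _)

/-- The operator `∑ ξᵢ vfᵢ`. -/
def eulerOp : Derivation ℂ (MvPowerSeries σ A) (MvPowerSeries σ A) :=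
  ∑ i, (X i : MvPowerSeries σ A) • coeffDer (c.vf typ g t i)

theorem eulerOp_apply (P : MvPowerSeries σ A) :
    c.eulerOp typ g t P = ∑ i, X i * coeffDer (c.vf typ g t i) P := by
  have h := map_sum (Derivation.coeFnAddMonoidHom (R := ℂ) (A := MvPowerSeries σ A)
    (M := MvPowerSeries σ A)) (fun i => (X i : MvPowerSeries σ A) • coeffDer (c.vf typ g t i))
    Finset.univ
  exact (congrFun h P).trans (Finset.sum_apply _ _ _)

/-- The operator `eulerOp` as a linear map. -/
def eulerLin : MvPowerSeries σ A →ₗ[ℂ] MvPowerSeries σ A := (c.eulerOp typ g t).toLinearMap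

@[simp]
theorem eulerLin_apply (P : MvPowerSeries σ A) :
    c.eulerLin typ g t P = c.eulerOp typ g t P := rfl

theorem raises_eulerLin : Raises (c.eulerLin typ g t) := fun N P hP => by
  rw [eulerLin_apply, eulerOp_apply]
  refine Submodule.sum_mem _ fun i _ => ?_
  rw [add_comm]
  exact mul_mem_fil (X_mem_fil i) (coeffDer_mem_fil _ hP)

/-- The source mapping (for `t = true`) and the target mapping (for `t = false`). -/
def src (u : A) : MvPowerSeries σ A := expSeries (c.eulerLin typ g t) (C u)

/-- The bracket on functions induced by a tensor, up to the sign given by the type `t`. -/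
def pb (u v : A) : A := ∑ k, (c.vf typ g t k u * c.d k v - c.d k u * c.vf typ g t k v)

theorem src_add (u v : A) : c.src typ g t (u + v) = c.src typ g t u + c.src typ g t v := by
  rw [src, map_add, expSeries_add, src, src]

theorem src_zero : c.src typ g t 0 = 0 := by rw [src, map_zero, expSeries_zero]

theorem src_mul (u v : A) : c.src typ g t (u * v) = c.src typ g t u * c.src typ g t v := by
  rw [src, map_mul]
  exact (c.raises_eulerLin typ g t).expSeries_bilin (LinearMap.mul ℂ _)
    (fun P Q => by
      change c.eulerOp typ g t (P * Q) = c.eulerOp typ g t P * Q + P * c.eulerOp typ g t Q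
      rw [Derivation.leibniz, smul_eq_mul, smul_eq_mul]; ring)
    (fun _ _ _ _ hP hQ => mem_fil_of_le (mul_mem_fil hP hQ) (by omega)) _ _

theorem src_sum {ι : Type*} (s : Finset ι) (u : ι → A) :
    c.src typ g t (∑ i ∈ s, u i) = ∑ i ∈ s, c.src typ g t (u i) := by
  rw [src, map_sum, expSeries_sum]; rfl

theorem constantCoeff_src (u : A) : constantCoeff (c.src typ g t u) = u := by
  have := mem_fil_one.1 ((c.raises_eulerLin typ g t).expSeries_sub_self_mem (b := 0) (Q := C u)
    (by simp))
  rwa [map_sub, sub_eq_zero, constantCoeff_C] at this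

variable {c typ g}

/-- The coefficients of the commutator of `g^{ij} ∂_j` and `g^{kj} ∂_j` are the two sides of the
Jacobi equation subtracted. Commutation is what lets `∑ ξ_i vf_i` be exponentiated like a linear
form with scalar coefficients. -/
theorem IsKP.vf_comm (hg : c.IsKP typ g) (i k : σ) (u : A) :
    c.vf typ g t i (c.vf typ g t k u) = c.vf typ g t k (c.vf typ g t i u) := by
  by_cases hi : typ i = t
  swap
  · simp [vf_eq_zero c typ g t hi]
  by_cases hk : typ k = t
  swap
  · simp [vf_eq_zero c typ g t hk]
  have e : ∀ i k, ∑ j, g i j * c.d j (∑ q, g k q * c.d q u) =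
      ∑ q, (∑ j, g i j * c.d j (g k q)) * c.d q u
        + ∑ j, ∑ q, g i j * (g k q * c.d j (c.d q u)) := by
    intro i k
    simp only [map_sum, Derivation.leibniz, smul_eq_mul, Finset.mul_sum, mul_add,
      Finset.sum_add_distrib, Finset.sum_mul]
    rw [add_comm]
    congr 1
    rw [Finset.sum_comm]
    refine Finset.sum_congr rfl fun q _ => Finset.sum_congr rfl fun j _ => by ring
  rw [vf_apply c typ g t hi, vf_apply c typ g t hk, vf_apply c typ g t hi, vf_apply c typ g t hk,
    e, e]
  congr 1
  · exact Finset.sum_congr rfl fun q _ => by rw [hg.jacobi i k (hi.trans hk.symm)]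
  · rw [Finset.sum_comm]
    refine Finset.sum_congr rfl fun q _ => Finset.sum_congr rfl fun j _ => ?_
    rw [c.comm j q]; ring

/-- The derivatives of the source and target mappings along the fibres. -/
theorem IsKP.dxi_src (hg : c.IsKP typ g) (i : σ) (u : A) :
    dxi i (c.src typ g t u) = c.src typ g t (c.vf typ g t i u) := by
  set L := c.eulerLin typ g t with hL
  have hR : Raises L := c.raises_eulerLin typ g t
  -- The commutator of `∂/∂ξ_i` with the operator `L` is `vf_i`, and by `h2` this commutes with `L`.
  -- So differentiating the exponential just brings down `vf_i`.
  have h1 : ∀ P, dxi i (L P) = L (dxi i P) + coeffDer (c.vf typ g t i) P := by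
    intro P
    rw [hL, eulerLin_apply, eulerLin_apply, eulerOp_apply, eulerOp_apply, map_sum]
    simp only [Derivation.leibniz, smul_eq_mul, dxi_X, mul_ite, mul_one, mul_zero,
      Finset.sum_add_distrib, coeffDer_dxi]
    simp
  have h2 : ∀ P, coeffDer (c.vf typ g t i) (L P) = L (coeffDer (c.vf typ g t i) P) := by
    intro P
    rw [hL, eulerLin_apply, eulerLin_apply, eulerOp_apply, eulerOp_apply, map_sum]
    refine Finset.sum_congr rfl fun k _ => ?_
    rw [Derivation.leibniz, coeffDer_X, smul_zero, add_zero, smul_eq_mul,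
      coeffDer_comm (hg.vf_comm t i k)]
  have h3 : ∀ (k : ℕ) P, dxi i ((L ^ (k + 1)) P) =
      (L ^ (k + 1)) (dxi i P) + ((k : ℂ) + 1) • (L ^ k) (coeffDer (c.vf typ g t i) P) := by
    intro k
    induction k with
    | zero => intro P; simp [h1]
    | succ k ih =>
      intro P
      rw [pow_succ, Module.End.mul_apply, ih, h1, h2, map_add, ← Module.End.mul_apply,
        ← pow_succ, ← Module.End.mul_apply (L ^ k), ← pow_succ, add_assoc]
      congr 1
      push_cast
      module
  have h4 : ∀ k, dxi i (expTerm L (k + 1) (C u)) = expTerm L k (C (c.vf typ g t i u)) := by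
    intro k
    rw [expTerm, expTerm, Derivation.map_smul, h3, dxi_C, map_zero, zero_add, coeffDer_C,
      smul_smul]
    congr 1
    rw [Nat.factorial_succ]
    have h5 : ((k : ℂ) + 1) ≠ 0 := by exact_mod_cast Nat.succ_ne_zero k
    push_cast
    rw [mul_inv, mul_comm, ← mul_assoc, mul_inv_cancel₀ h5, one_mul]
  refine eq_of_forall_sub_mem_fil fun N => ?_
  have h5 := dxi_mem_fil (i := i) (by
    simpa using hR.expSeries_sub_mem (b := 0) (Q := C u) (by simp) (N + 1))
  have h6 := hR.expSeries_sub_mem (b := 0) (Q := C (c.vf typ g t i u)) (by simp) N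
  rw [map_sub, map_sum, Finset.sum_range_succ', expTerm_zero, dxi_C, add_zero] at h5
  simp only [h4] at h5
  rw [zero_add] at h6
  rw [src, src]
  convert (fil σ A N).sub_mem h5 h6 using 1
  abel

/-- As `g` pairs opposite types, the fields `vf_i` of type `t` differentiate only in directions of
the other type. They kill `a`, so the fibre derivatives of its image vanish. -/
theorem IsKP.src_eq_C (hg : c.IsKP typ g) {a : A} (ha : ∀ i, typ i ≠ t → c.d i a = 0) :
    c.src typ g t a = C a := by
  have hz : ∀ i, c.vf typ g t i a = 0 := by
    intro i
    by_cases hi : typ i = t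
    · rw [vf_apply c typ g t hi]
      refine Finset.sum_eq_zero fun j _ => ?_
      by_cases hj : typ j = t
      · rw [hg.eq_zero i j (hi.trans hj.symm), zero_mul]
      · rw [ha j hj, mul_zero]
    · exact vf_eq_zero c typ g t hi a
  have := eq_zero_of_pderiv_mem_span (fun _ : Unit => c.src typ g t a - C a)
    (fun _ => by rw [map_sub, constantCoeff_src, constantCoeff_C, sub_self])
    (fun _ i => by
      rw [← dxi_apply, map_sub, hg.dxi_src, dxi_C, hz, src_zero, sub_zero]
      exact Ideal.zero_mem _) ()
  exact sub_eq_zero.1 this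

/-- The system `∂S/∂ξ_i = S ∘ vf_i` has one formal solution with given values on the zero section.
The index set `ι` allows `S` to be given on another algebra or on part of `A`, provided the `vf_i`
lift to maps `s i` of `ι`. -/
theorem IsKP.src_unique (hg : c.IsKP typ g) {ι : Type*} (f : ι → A) (S : ι → MvPowerSeries σ A)
    (h0 : ∀ a, constantCoeff (S a) = f a) (s : σ → ι → ι)
    (h : ∀ i a, dxi i (S a) = S (s i a)) (hs : ∀ i a, f (s i a) = c.vf typ g t i (f a)) (a : ι) :
    S a = c.src typ g t (f a) := by
  refine sub_eq_zero.1 (eq_zero_of_pderiv_mem_span (fun a => S a - c.src typ g t (f a))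
    (fun a => by rw [map_sub, h0, constantCoeff_src, sub_self]) (fun a i => ?_) a)
  rw [← dxi_apply, map_sub, h, hg.dxi_src, ← hs]
  exact Ideal.subset_span ⟨s i a, rfl⟩

/-- For `p` of type `t` the field `vf_p` is Hamiltonian, generated by the coordinate `x_p`, so it
should preserve the bracket. Its commutators with the `∂_k` produce terms in `∂_k g^{pl}`; by the
Jacobi identity these are symmetric in `u` and `v` and cancel. -/
theorem IsKP.vf_pb (hg : c.IsKP typ g) (p : σ) (u v : A) :
    c.vf typ g t p (c.pb typ g t u v) =
      c.pb typ g t (c.vf typ g t p u) v + c.pb typ g t u (c.vf typ g t p v) := by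
  by_cases hp : typ p = t
  swap
  · simp [vf_eq_zero c typ g t hp, pb]
  have hcomm : ∀ k w, c.vf typ g t p (c.d k w) =
      c.d k (c.vf typ g t p w) - ∑ l, c.d k (g p l) * c.d l w := by
    intro k w
    rw [vf_apply c typ g t hp, vf_apply c typ g t hp, map_sum, ← Finset.sum_sub_distrib]
    refine Finset.sum_congr rfl fun l _ => ?_
    rw [Derivation.leibniz, smul_eq_mul, smul_eq_mul, c.comm k l]; ring
  have key : ∀ u v, ∑ k, c.vf typ g t k u * ∑ l, c.d k (g p l) * c.d l v =
      ∑ q, ∑ l, (if typ q = t ∨ typ l = t then 0 else ∑ k, g q k * c.d k (g l p)) *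
        (c.d q u * c.d l v) := by
    intro u v
    have e1 : ∀ k, c.vf typ g t k u = ∑ q, (if typ q = t then 0 else g q k) * c.d q u := by
      intro k
      by_cases hk : typ k = t
      · rw [vf_apply c typ g t hk]
        refine Finset.sum_congr rfl fun q _ => ?_
        split_ifs with hq
        · rw [hg.eq_zero k q (hk.trans hq.symm)]
        · rw [hg.symm]
      · rw [vf_eq_zero c typ g t hk]
        symm
        refine Finset.sum_eq_zero fun q _ => ?_
        split_ifs with hq
        · rw [zero_mul]
        · rw [hg.eq_zero q k (by revert hq hk; cases typ q <;> cases typ k <;> cases t <;> simp),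
            zero_mul]
    simp only [e1, Finset.sum_mul_sum]
    rw [Finset.sum_comm]
    refine Finset.sum_congr rfl fun q _ => ?_
    rw [Finset.sum_comm]
    refine Finset.sum_congr rfl fun l _ => ?_
    by_cases hq : typ q = t
    · simp [hq]
    by_cases hl : typ l = t
    · rw [hg.eq_zero p l (hp.trans hl.symm)]; simp [hl]
    rw [if_neg (by simp [hq, hl]), Finset.sum_mul]
    refine Finset.sum_congr rfl fun k _ => ?_
    rw [if_neg hq, hg.symm p l]; ring
  have hsymm : ∑ k, c.vf typ g t k u * ∑ l, c.d k (g p l) * c.d l v =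
      ∑ k, c.vf typ g t k v * ∑ l, c.d k (g p l) * c.d l u := by
    rw [key, key, Finset.sum_comm]
    refine Finset.sum_congr rfl fun q _ => Finset.sum_congr rfl fun l _ => ?_
    by_cases hq : typ q = t
    · simp [hq]
    by_cases hl : typ l = t
    · simp [hl]
    rw [if_neg (by simp [hq, hl]), if_neg (by simp [hq, hl]),
      hg.jacobi l q (by revert hq hl; cases typ q <;> cases typ l <;> cases t <;> simp) p]
    ring
  have e : c.vf typ g t p (c.pb typ g t u v) =
      c.pb typ g t (c.vf typ g t p u) v + c.pb typ g t u (c.vf typ g t p v)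
      - (∑ k, c.vf typ g t k u * ∑ l, c.d k (g p l) * c.d l v
        - ∑ k, c.vf typ g t k v * ∑ l, c.d k (g p l) * c.d l u) := by
    rw [pb, pb, pb, map_sum, ← Finset.sum_add_distrib, ← Finset.sum_sub_distrib,
      ← Finset.sum_sub_distrib]
    refine Finset.sum_congr rfl fun k _ => ?_
    simp only [map_sub, Derivation.leibniz, smul_eq_mul, hcomm, hg.vf_comm t p k]
    ring
  rw [e, hsymm, sub_self, sub_zero]

theorem IsKP.constantCoeff_br_src (hg : c.IsKP typ g) (t' : Bool) (u v : A) :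
    constantCoeff (c.br (c.src typ g t u) (c.src typ g t' v)) =
      ∑ k, (c.vf typ g t k u * c.d k v - c.d k u * c.vf typ g t' k v) := by
  rw [br_def, map_sum]
  refine Finset.sum_congr rfl fun k _ => ?_
  rw [map_sub, map_mul, map_mul, hg.dxi_src, hg.dxi_src, dx, constantCoeff_coeffDer,
    constantCoeff_coeffDer]
  simp only [constantCoeff_src]

/-- The source mapping is a Poisson morphism. -/
theorem IsKP.br_src (hg : c.IsKP typ g) (u v : A) :
    c.br (c.src typ g t u) (c.src typ g t v) = c.src typ g t (c.pb typ g t u v) := by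
  -- A fibre derivative of the defect for `(u, v)` is the sum of the defects for `(vf_i u, v)` and
  -- `(u, vf_i v)`. The family is stable, so only the zero section has to be checked.
  refine sub_eq_zero.1 (eq_zero_of_pderiv_mem_span (fun w : A × A =>
    c.br (c.src typ g t w.1) (c.src typ g t w.2) - c.src typ g t (c.pb typ g t w.1 w.2))
    (fun w => ?_) (fun w i => ?_) (u, v))
  · rw [map_sub, hg.constantCoeff_br_src, constantCoeff_src, pb, sub_self]
  · have e : pderiv A i (c.br (c.src typ g t w.1) (c.src typ g t w.2)
        - c.src typ g t (c.pb typ g t w.1 w.2)) =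
        (c.br (c.src typ g t (c.vf typ g t i w.1)) (c.src typ g t w.2)
          - c.src typ g t (c.pb typ g t (c.vf typ g t i w.1) w.2))
        + (c.br (c.src typ g t w.1) (c.src typ g t (c.vf typ g t i w.2))
          - c.src typ g t (c.pb typ g t w.1 (c.vf typ g t i w.2))) := by
      rw [← dxi_apply, map_sub, dxi_br, hg.dxi_src, hg.dxi_src, hg.dxi_src, hg.vf_pb, src_add]
      abel
    rw [e]
    exact Ideal.add_mem _ (Ideal.subset_span ⟨(c.vf typ g t i w.1, w.2), rfl⟩)
      (Ideal.subset_span ⟨(w.1, c.vf typ g t i w.2), rfl⟩)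

/-- The source and target mappings commute. -/
theorem IsKP.br_src_src (hg : c.IsKP typ g) (u v : A) :
    c.br (c.src typ g t u) (c.src typ g (!t) v) = 0 := by
  refine eq_zero_of_pderiv_mem_span (fun w : A × A =>
    c.br (c.src typ g t w.1) (c.src typ g (!t) w.2)) (fun w => ?_) (fun w i => ?_) (u, v)
  · rw [hg.constantCoeff_br_src, Finset.sum_sub_distrib, sub_eq_zero]
    -- On the zero section both sums pair the derivatives of `w.1` of type `!t` with those of `w.2`
    -- of type `t` through `g`; the case distinctions bring them to a common form.
    have e1 : ∀ k, c.vf typ g t k w.1 = ∑ j, (if typ k = t then g k j else 0) * c.d j w.1 := by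
      intro k
      split_ifs with hk
      · exact vf_apply c typ g t hk _
      · rw [vf_eq_zero c typ g t hk]; simp
    have e2 : ∀ k, c.vf typ g (!t) k w.2 = ∑ j, (if typ j = t then g j k else 0) * c.d j w.2 := by
      intro k
      by_cases hk : typ k = !t
      · rw [vf_apply c typ g _ hk]
        refine Finset.sum_congr rfl fun j _ => ?_
        split_ifs with hj
        · rw [hg.symm]
        · rw [hg.eq_zero k j (by revert hk hj; cases typ k <;> cases typ j <;> cases t <;> simp)]
      · rw [vf_eq_zero c typ g _ hk]
        symm
        refine Finset.sum_eq_zero fun j _ => ?_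
        split_ifs with hj
        · rw [hg.eq_zero j k (by revert hk hj; cases typ k <;> cases typ j <;> cases t <;> simp),
            zero_mul]
        · rw [zero_mul]
    simp only [e1, e2, Finset.sum_mul, Finset.mul_sum]
    rw [Finset.sum_comm]
    refine Finset.sum_congr rfl fun q _ => Finset.sum_congr rfl fun l _ => by ring
  · rw [← dxi_apply, dxi_br, hg.dxi_src, hg.dxi_src]
    exact Ideal.add_mem _ (Ideal.subset_span ⟨(c.vf typ g t i w.1, w.2), rfl⟩)
      (Ideal.subset_span ⟨(w.1, c.vf typ g (!t) i w.2), rfl⟩)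

end Coords

end LocalGroupoid

end KahlerPoisson

end

noncomputable section

namespace KahlerPoisson

open MvPowerSeries

/-! ### Existence of Hamiltonians -/

section Existence

variable {σ A : Type*} [CommRing A] [Algebra ℂ A] [DecidableEq σ] [Fintype σ]

theorem coeff_X_mul_eq (i : σ) (m : σ →₀ ℕ) (Q : MvPowerSeries σ A) : coeff m (X i * Q) =
    if Finsupp.single i 1 ≤ m then coeff (m - Finsupp.single i 1) Q else 0 := by
  rw [X, coeff_monomial_mul]; simp

/-- Euler's identity. -/
theorem coeff_sum_X_mul_dxi (m : σ →₀ ℕ) (Q : MvPowerSeries σ A) :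
    coeff m (∑ i, X i * dxi i Q) = (m.degree : ℂ) • coeff m Q := by
  have h : ∀ i, coeff m (X i * dxi i Q) = (m i : ℂ) • coeff m Q := by
    intro i
    rw [coeff_X_mul_eq]
    split_ifs with hi
    · rw [coeff_dxi, tsub_add_cancel_of_le hi, Algebra.smul_def, map_natCast, mul_comm]
      have h1 : 1 ≤ m i := by simpa using hi i
      have : (m - Finsupp.single i 1 : σ →₀ ℕ) i + 1 = m i := by simp; omega
      rw [← this]; push_cast; rfl
    · have : m i = 0 := by
        by_contra h0
        refine hi fun j => ?_
        by_cases hj : j = i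
        · subst hj; simpa [Nat.one_le_iff_ne_zero] using h0
        · simp [Finsupp.single_eq_of_ne hj]
      rw [this]; simp
  rw [map_sum, Finset.sum_congr rfl fun i _ => h i, ← Finset.sum_smul, Finsupp.degree_eq_sum]
  push_cast; rfl

/-- The potential of a family of power series. -/
def potential (R : σ → MvPowerSeries σ A) : MvPowerSeries σ A :=
  -- Radial homotopy: division by the degree inverts Euler's operator. In degree zero the inverse
  -- takes the value `0`, harmlessly, since the sum has no constant term.
  mkSeries fun m => ((m.degree : ℂ))⁻¹ • coeff m (∑ i, X i * R i)

theorem potential_mem_fil {N : ℕ} {R : σ → MvPowerSeries σ A} (hR : ∀ i, R i ∈ fil σ A N) :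
    potential R ∈ fil σ A (N + 1) := fun m hm => by
  have : ∑ i, X i * R i ∈ fil σ A (N + 1) := Submodule.sum_mem _ fun i _ => by
    rw [add_comm]; exact mul_mem_fil (X_mem_fil i) (hR i)
  rw [potential, coeff_mkSeries, this m hm, smul_zero]

/-- The Poincaré lemma to leading order. -/
theorem dxi_potential_sub_mem {N : ℕ} {R : σ → MvPowerSeries σ A} (hR : ∀ i, R i ∈ fil σ A N)
    (h : ∀ i j, dxi j (R i) - dxi i (R j) ∈ fil σ A N) (j : σ) :
    dxi j (potential R) - R j ∈ fil σ A (N + 1) := by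
  intro m hm
  by_cases hm' : m.degree < N
  · rw [map_sub, hR j m hm', dxi_mem_fil (potential_mem_fil hR) j m hm', sub_zero]
  have hdeg : m.degree = N := by omega
  have h1 : coeff m (dxi j (potential R)) =
      ((N : ℂ) + 1)⁻¹ • coeff m (dxi j (∑ i, X i * R i)) := by
    rw [coeff_dxi, coeff_dxi, potential, coeff_mkSeries, smul_mul_assoc, map_add,
      Finsupp.degree_single, hdeg]
    push_cast; rfl
  -- Moving `∂_j` past the contraction with the variables leaves `R j`, Euler's operator applied to
  -- `R j`, and the closedness defect, which is of higher order.
  have h2 : dxi j (∑ i, X i * R i) =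
      R j + ∑ i, X i * (dxi j (R i) - dxi i (R j)) + ∑ i, X i * dxi i (R j) := by
    simp only [map_sum, Derivation.leibniz, smul_eq_mul, dxi_X, Finset.sum_add_distrib, mul_ite,
      mul_one, mul_zero, mul_sub, Finset.sum_sub_distrib]
    simp
    abel
  have h3 : ∑ i, X i * (dxi j (R i) - dxi i (R j)) ∈ fil σ A (N + 1) :=
    Submodule.sum_mem _ fun i _ => by rw [add_comm]; exact mul_mem_fil (X_mem_fil i) (h i j)
  have h4 : ((N : ℂ) + 1) ≠ 0 := by exact_mod_cast Nat.succ_ne_zero N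
  rw [map_sub, h1, h2, map_add, map_add, coeff_sum_X_mul_dxi, h3 m hm, hdeg, add_zero,
    sub_eq_zero, inv_smul_eq_iff₀ h4, add_smul, one_smul, add_comm]

namespace Coords

variable {c : Coords σ A}

/-- Pulled back by the approximate flow, the `X i` become `x_i + R_i` with `R_i` of order `N + 1`.
They still commute, so `R` is closed up to `{R_i, R_j}`, of order `2N + 1 ≥ N + 1`. Adding a
potential of `R` to `K` corrects the next degree. -/
theorem exists_flow_step {X : σ → MvPowerSeries σ A} (hX : ∀ i j, c.br (X i) (X j) = 0) {N : ℕ}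
    {K : MvPowerSeries σ A} (hK : K ∈ fil σ A 2)
    (hN : ∀ i, c.flow K (C (c.x i)) - X i ∈ fil σ A (N + 1)) :
    ∃ K' ∈ fil σ A 2, (∀ i, c.flow K' (C (c.x i)) - X i ∈ fil σ A (N + 2)) ∧
      K' - K ∈ fil σ A (N + 2) := by
  have hnK := (fil σ A 2).neg_mem hK
  set R : σ → MvPowerSeries σ A := fun i => c.flow (-K) (X i) - C (c.x i) with hRdef
  have hR : ∀ i, R i ∈ fil σ A (N + 1) := by
    intro i
    have := flow_mem (c := c) hnK (hN i)
    rw [flow_sub, flow_neg_flow hK] at this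
    simpa [hRdef] using (fil σ A (N + 1)).neg_mem this
  have hclosed : ∀ i j, dxi j (R i) - dxi i (R j) ∈ fil σ A (N + 1) := by
    intro i j
    have hY : ∀ i, c.flow (-K) (X i) = C (c.x i) + R i := fun i => by simp [hRdef]
    have h0 : c.br (C (c.x i) + R i) (C (c.x j) + R j) = 0 := by
      rw [← hY, ← hY, ← flow_br hnK, hX, flow_zero]
    rw [br_add_left, br_add_right, br_add_right, br_x, br_x, dxi_C, br_swap, br_x, zero_add] at h0
    have h1 : dxi j (R i) - dxi i (R j) = -c.br (R i) (R j) := by linear_combination h0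
    rw [h1]
    exact (fil σ A _).neg_mem (mem_fil_of_le (c.br_mem_fil (hR i) (hR j)) (by omega))
  have hP := potential_mem_fil hR
  have hK' : K + potential R ∈ fil σ A 2 :=
    (fil σ A 2).add_mem hK (mem_fil_of_le hP (by omega))
  refine ⟨K + potential R, hK', fun i => ?_, by simpa using hP⟩
  have h1 := flow_variation (c := c) hK hK' (N := N + 2) (by omega) (by simpa using hP) (c.x i)
  rw [add_sub_cancel_left, br_x] at h1
  have h2 := dxi_potential_sub_mem hR hclosed i
  have h3 := flow_sub_self_mem (c := c) hK (hR i)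
  have h4 : c.flow K (R i) = X i - c.flow K (C (c.x i)) := by
    rw [hRdef, flow_sub, flow_flow_neg hK]
  rw [h4] at h3
  convert (fil σ A (N + 2)).sub_mem ((fil σ A (N + 2)).add_mem h1 h2) h3 using 1
  abel

/-- Commuting deformations of the coordinates are given by a Hamiltonian flow. -/
theorem exists_flow_eq {X : σ → MvPowerSeries σ A} (hX : ∀ i j, c.br (X i) (X j) = 0)
    (h0 : ∀ i, constantCoeff (X i) = c.x i) :
    ∃ K ∈ fil σ A 2, ∀ i, c.flow K (C (c.x i)) = X i := by
  have hbase : (0 : MvPowerSeries σ A) ∈ fil σ A 2 ∧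
      ∀ i, c.flow 0 (C (c.x i)) - X i ∈ fil σ A (0 + 1) := by
    refine ⟨Submodule.zero_mem _, fun i => mem_fil_one.2 ?_⟩
    rw [map_sub, constantCoeff_flow (Submodule.zero_mem _), h0, constantCoeff_C, sub_self]
  let seq : (N : ℕ) → {K : MvPowerSeries σ A // K ∈ fil σ A 2 ∧
      ∀ i, c.flow K (C (c.x i)) - X i ∈ fil σ A (N + 1)} := fun N =>
    Nat.rec ⟨0, hbase⟩ (fun N K => ⟨(exists_flow_step hX K.2.1 K.2.2).choose,
      (exists_flow_step hX K.2.1 K.2.2).choose_spec.1,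
      (exists_flow_step hX K.2.1 K.2.2).choose_spec.2.1⟩) N
  have hstep : ∀ N, (seq (N + 1)).1 - (seq N).1 ∈ fil σ A (N + 2) := fun N =>
    (exists_flow_step hX (seq N).2.1 (seq N).2.2).choose_spec.2.2
  have hle : ∀ N k, (seq (N + k)).1 - (seq N).1 ∈ fil σ A (N + 2) := by
    intro N k
    induction k with
    | zero => simp
    | succ k ih =>
      have := (fil σ A (N + 2)).add_mem (mem_fil_of_le (hstep (N + k)) (by omega)) ih
      rwa [sub_add_sub_cancel] at this
  -- The coefficients of degree at most `N + 1` no longer change from stage `N` on, so each is read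
  -- off at the stage equal to its degree.
  set K : MvPowerSeries σ A := mkSeries fun m => coeff m (seq m.degree).1 with hKdef
  have hlim : ∀ N, K - (seq N).1 ∈ fil σ A (N + 2) := by
    intro N m hm
    rw [map_sub, hKdef, coeff_mkSeries, ← map_sub]
    rcases le_total m.degree N with h | h
    · obtain ⟨k, hk⟩ := Nat.exists_eq_add_of_le h
      have := hle m.degree k m (by omega)
      rw [← hk, map_sub, sub_eq_zero] at this
      rw [map_sub, this, sub_self]
    · obtain ⟨k, hk⟩ := Nat.exists_eq_add_of_le h
      have := hle N k m (by omega)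
      rwa [← hk] at this
  have hK : K ∈ fil σ A 2 := by
    have := (fil σ A 2).add_mem (hlim 0) (seq 0).2.1
    rwa [sub_add_cancel] at this
  refine ⟨K, hK, fun i => eq_of_forall_sub_mem_fil fun N => ?_⟩
  have h1 := flow_variation (c := c) (seq N).2.1 hK (N := N + 2) (by omega) (hlim N) (c.x i)
  have h2 : c.br (K - (seq N).1) (C (c.x i)) ∈ fil σ A (N + 1) := by
    rw [br_x]; exact dxi_mem_fil (hlim N) i
  have h3 := (seq N).2.2 i
  have h4 := (fil σ A (N + 1)).add_mem ((fil σ A (N + 1)).add_mem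
    (mem_fil_of_le h1 (by omega)) h2) h3
  refine mem_fil_of_le (N := N + 1) ?_ (by omega)
  convert h4 using 1
  abel

variable {typ : σ → Bool} {g : σ → σ → A}

/-- The flowed coordinates are prescribed: a coordinate of one type is sent to its image under the
mapping `src` of the opposite type, which depends only on fibre variables of the opposite type.
These images commute: within a type because the coordinates have zero bracket, across types because
source and target commute. So a Hamiltonian exists. -/
theorem IsKP.exists_isK' (hg : c.IsKP typ g) :
    ∃ K, c.IsK typ K ∧ hess K = g ∧
      ∀ i, c.flow K (C (c.x i)) = c.src typ g (!(typ i)) (c.x i) := by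
  have hcomm : ∀ i j,
      c.br (c.src typ g (!(typ i)) (c.x i)) (c.src typ g (!(typ j)) (c.x j)) = 0 := by
    intro i j
    by_cases hij : typ i = typ j
    · simp only [hij]
      rw [hg.br_src]
      have : c.pb typ g (!(typ j)) (c.x i) (c.x j) = 0 := by
        refine Finset.sum_eq_zero fun k _ => ?_
        by_cases hk : typ k = !(typ j)
        · have h1 : k ≠ j := by rintro rfl; revert hk; cases typ k <;> simp
          have h2 : k ≠ i := by rintro rfl; rw [hij] at hk; revert hk; cases typ j <;> simp
          simp [c.d_x, h1, h2]
        · simp [vf_eq_zero _ _ _ _ hk]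
      rw [this, src_zero]
    · have : typ i = !(typ j) := by revert hij; cases typ i <;> cases typ j <;> simp
      have h2 := hg.br_src_src (!(typ i)) (c.x i) (c.x j)
      rw [show (!!(typ i)) = !(typ j) by rw [this]; simp] at h2
      exact h2
  obtain ⟨K, hK, hflow⟩ := exists_flow_eq (c := c) hcomm fun i => constantCoeff_src ..
  have hz : ∀ i j, dxi j (c.flow K (C (c.x i))) =
      c.src typ g (!(typ i)) (if typ i = typ j then 0 else g j i) := by
    intro i j
    rw [hflow, hg.dxi_src]
    split_ifs with hij
    · rw [vf_eq_zero _ _ _ _ (by rw [hij]; simp)]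
    · rw [vf_apply _ _ _ _ (by revert hij; cases typ i <;> cases typ j <;> simp),
        Finset.sum_eq_single i]
      · simp [c.d_x]
      · intro k _ hk; simp [c.d_x, hk]
      · simp
  refine ⟨K, ⟨hK, fun i j hij => by rw [hz, if_pos hij, src_zero]⟩, ?_, hflow⟩
  ext i j
  rw [← constantCoeff_dxi_flow (c := c) hK, hz, constantCoeff_src]
  split_ifs with hij
  · rw [hg.eq_zero i j hij.symm]
  · rfl

theorem IsKP.exists_isK (hg : c.IsKP typ g) : ∃ K, c.IsK typ K ∧ hess K = g :=
  let ⟨K, h, h', _⟩ := hg.exists_isK'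
  ⟨K, h, h'⟩

/-- The source and target mappings in terms of Hamiltonian flows. -/
theorem IsK.flow_C_eq_src {K : MvPowerSeries σ A} (hK : c.IsK typ K) {t : Bool} {b : A}
    (hb : ∀ i, typ i = t → c.d i b = 0) : c.flow K (C b) = c.src typ (hess K) t b := by
  have hg : c.IsKP typ (hess K) := hK.isKP
  set g := hess K with hgdef
  obtain ⟨K', hK', hh, hflow⟩ := hg.exists_isK'
  -- By uniqueness `K` is the Hamiltonian constructed from its own Hessian, so its flow on
  -- coordinates is known.
  have hKK : K' = K := hK'.eq_of_hess_eq hK hh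
  rw [hKK] at hflow
  -- This class of functions is stable under the `∂_i`, and on it both mappings obey the same chain
  -- rule with the same derivatives of the flowed coordinates.
  let ι := {b : A // ∀ i, typ i = t → c.d i b = 0}
  refine sub_eq_zero.1 (eq_zero_of_pderiv_mem_span
    (fun b : ι => c.flow K (C b.1) - c.src typ g t b.1)
    (fun b => ?_) (fun b k => ?_) ⟨b, hb⟩)
  · rw [map_sub, constantCoeff_flow hK.1, constantCoeff_C, constantCoeff_src, sub_self]
  · have hmem : ∀ i, ∀ j, typ j = t → c.d j (c.d i b.1) = 0 := fun i j hj => by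
      rw [c.comm, b.2 j hj, map_zero]
    have h1 : c.vf typ g t k b.1 = ∑ i, c.d i b.1 * c.vf typ g t k (c.x i) := by
      by_cases hk : typ k = t
      · rw [vf_apply _ _ _ _ hk]
        refine Finset.sum_congr rfl fun i _ => ?_
        rw [vf_apply _ _ _ _ hk, Finset.sum_eq_single i, c.d_x, if_pos rfl]
        · ring
        · intro j _ hj; simp [c.d_x, hj]
        · simp
      · simp [vf_eq_zero _ _ _ _ hk]
    have e : pderiv A k (c.flow K (C b.1) - c.src typ g t b.1) =
        ∑ i, dxi k (c.flow K (C (c.x i))) *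
          (c.flow K (C (c.d i b.1)) - c.src typ g t (c.d i b.1)) := by
      rw [← dxi_apply, map_sub, dxi_flow_C hK.1, hg.dxi_src, h1, src_sum,
        ← Finset.sum_sub_distrib]
      refine Finset.sum_congr rfl fun i _ => ?_
      by_cases hi : typ i = t
      · rw [b.2 i hi]; simp [flow_zero, src_zero]
      · have ht : (!(typ i)) = t := by revert hi; cases typ i <;> cases t <;> simp
        rw [src_mul, ← hg.dxi_src, hflow i, ht]; ring
    rw [e]
    exact Submodule.sum_mem _ fun i _ =>
      Ideal.mul_mem_left _ _ (Ideal.subset_span ⟨⟨c.d i b.1, hmem i⟩, rfl⟩)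

end Coords

end Existence

/-! ### Changes of coordinates -/

section ChangeOfCoords

variable {σ A : Type*} [CommRing A] [Algebra ℂ A] [DecidableEq σ] [Fintype σ]

/-- The linear forms `∑ₖ J k j ξₖ`. -/
def linForm (J : σ → σ → A) (j : σ) : MvPowerSeries σ A := ∑ k, C (J k j) * X k

theorem linForm_mem_fil (J : σ → σ → A) (j : σ) : linForm J j ∈ fil σ A 1 :=
  Submodule.sum_mem _ fun k _ => Ideal.mul_mem_left _ _ (X_mem_fil k)

theorem hasSubst_linForm (J : σ → σ → A) : HasSubst (linForm J) :=
  hasSubst_of_constantCoeff_zero fun j => mem_fil_one.1 (linForm_mem_fil J j)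

/-- The linear substitution of the fibre variables with matrix `J`. -/
def linSubst (J : σ → σ → A) : MvPowerSeries σ A →ₐ[A] MvPowerSeries σ A :=
  substAlgHom (hasSubst_linForm J)

theorem linSubst_apply (J : σ → σ → A) (P : MvPowerSeries σ A) :
    linSubst J P = subst (linForm J) P := by rw [linSubst, coe_substAlgHom]

theorem linSubst_C (J : σ → σ → A) (a : A) : linSubst J (C a) = C a := (linSubst J).commutes a

theorem linSubst_X (J : σ → σ → A) (i : σ) : linSubst J (X i) = linForm J i :=
  substAlgHom_X _ _

/-- Variables are split off one at a time, and each goes to a linear form; no formula for the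
coefficients of a substitution is needed. -/
theorem linSubst_mem_fil (J : σ → σ → A) {N : ℕ} {P : MvPowerSeries σ A} (hP : P ∈ fil σ A N) :
    linSubst J P ∈ fil σ A N := by
  induction N generalizing P with
  | zero => simp
  | succ N ih =>
    obtain ⟨Q, hQ, rfl⟩ := exists_eq_sum_X_mul hP
    rw [map_sum]
    refine Submodule.sum_mem _ fun i _ => ?_
    rw [map_mul, linSubst_X, add_comm]
    exact mul_mem_fil (linForm_mem_fil J i) (ih (hQ i))

theorem constantCoeff_linSubst (J : σ → σ → A) (P : MvPowerSeries σ A) :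
    constantCoeff (linSubst J P) = constantCoeff P := by
  have h : P - C (constantCoeff P) ∈ fil σ A 1 := mem_fil_one.2 (by simp)
  have := mem_fil_one.1 (linSubst_mem_fil J h)
  rwa [map_sub, linSubst_C, map_sub, constantCoeff_C, sub_eq_zero] at this

/-- A derivation along a linear substitution vanishes if it vanishes on coefficients and
variables. -/
theorem eq_zero_of_leibniz_linSubst (J : σ → σ → A)
    (δ : MvPowerSeries σ A →+ MvPowerSeries σ A)
    (hmul : ∀ P Q, δ (P * Q) = linSubst J P * δ Q + linSubst J Q * δ P)
    (hC : ∀ a, δ (C a) = 0) (hX : ∀ i, δ (X i) = 0) (P : MvPowerSeries σ A) : δ P = 0 := by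
  have key : ∀ N P, δ P ∈ fil σ A N := by
    intro N
    induction N with
    | zero => simp
    | succ N ih =>
      intro P
      have h : P - C (constantCoeff P) ∈ fil σ A (0 + 1) := mem_fil_one.2 (by simp)
      obtain ⟨Q, -, hQ⟩ := exists_eq_sum_X_mul h
      have e : δ P = ∑ i, linForm J i * δ (Q i) := by
        rw [← sub_add_cancel P (C (constantCoeff P)), hQ, map_add, hC, add_zero, map_sum]
        refine Finset.sum_congr rfl fun i _ => ?_
        rw [hmul, hX, mul_zero, add_zero, linSubst_X]
      rw [e]
      refine Submodule.sum_mem _ fun i _ => ?_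
      rw [add_comm]
      exact mul_mem_fil (linForm_mem_fil J i) (ih _)
  exact eq_zero_of_forall_mem_fil fun N => key N P

theorem dxi_linForm (J : σ → σ → A) (i j : σ) : dxi j (linForm J i) = C (J j i) := by
  rw [linForm, map_sum, Finset.sum_eq_single j]
  · rw [Derivation.leibniz, dxi_X, dxi_C]; simp
  · intro k _ hk
    rw [Derivation.leibniz, dxi_X, dxi_C]; simp [Ne.symm hk]
  · simp

/-- Both sides are derivations along the substitution, so they need only be compared on constants
and variables. -/
theorem dxi_linSubst (J : σ → σ → A) (j : σ) (P : MvPowerSeries σ A) :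
    dxi j (linSubst J P) = ∑ i, C (J j i) * linSubst J (dxi i P) := by
  refine sub_eq_zero.1 (eq_zero_of_leibniz_linSubst J
    { toFun := fun P => dxi j (linSubst J P) - ∑ i, C (J j i) * linSubst J (dxi i P)
      map_zero' := by simp
      map_add' := fun P Q => by
        simp only [map_add, mul_add, Finset.sum_add_distrib]; abel } ?_ ?_ ?_ P)
  · intro P Q
    simp only [AddMonoidHom.coe_mk, ZeroHom.coe_mk, map_mul, Derivation.leibniz, smul_eq_mul,
      map_add, mul_add, Finset.sum_add_distrib, mul_sub, Finset.mul_sum]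
    simp only [mul_left_comm (C _)]
    ring
  · intro a; simp [linSubst_C]
  · intro i
    simp only [AddMonoidHom.coe_mk, ZeroHom.coe_mk, linSubst_X, dxi_linForm, dxi_X]
    rw [Finset.sum_eq_single i]
    · simp
    · intro k _ hk; simp [hk]
    · simp

/-- The additional sum differentiates the matrix of the substitution; it is the inhomogeneous term
in a change of coordinates on the cotangent bundle. -/
theorem coeffDer_linSubst (D : Derivation ℂ A A) (J : σ → σ → A) (P : MvPowerSeries σ A) :
    coeffDer D (linSubst J P) = linSubst J (coeffDer D P)
      + ∑ i, coeffDer D (linForm J i) * linSubst J (dxi i P) := by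
  rw [← sub_eq_zero, ← sub_sub]
  refine (eq_zero_of_leibniz_linSubst J
    { toFun := fun P => coeffDer D (linSubst J P) - linSubst J (coeffDer D P)
        - ∑ i, coeffDer D (linForm J i) * linSubst J (dxi i P)
      map_zero' := by simp
      map_add' := fun P Q => by
        simp only [map_add, mul_add, Finset.sum_add_distrib]; abel } ?_ ?_ ?_ P)
  · intro P Q
    simp only [AddMonoidHom.coe_mk, ZeroHom.coe_mk, map_mul, Derivation.leibniz, smul_eq_mul,
      map_add, mul_add, Finset.sum_add_distrib, mul_sub, Finset.mul_sum]
    simp only [mul_left_comm (coeffDer D _)]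
    ring
  · intro a; simp [linSubst_C]
  · intro i
    simp only [AddMonoidHom.coe_mk, ZeroHom.coe_mk, linSubst_X, dxi_X, coeffDer_X, map_zero]
    rw [Finset.sum_eq_single i]
    · simp
    · intro k _ hk; simp [hk]
    · simp

namespace Coords

/-- The Jacobian matrix of the coordinates `c` with respect to the coordinates `c'`. -/
def jac (c c' : Coords σ A) (k j : σ) : A := c'.d j (c.x k)

/-- The coordinate derivations of `c'` are combinations of those of `c`. -/
def Compatible (c c' : Coords σ A) : Prop :=
  ∀ j f, c'.d j f = ∑ k, c.jac c' k j * c.d k f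

/-- Rewriting a power series in the fibre coordinates of `c'` in those of `c`. -/
def trans (c c' : Coords σ A) : MvPowerSeries σ A →ₐ[A] MvPowerSeries σ A := linSubst (c.jac c')

variable {c c' : Coords σ A}

theorem Compatible.dx_eq (h : Compatible c c') (j : σ) (P : MvPowerSeries σ A) :
    c'.dx j P = ∑ k, C (c.jac c' k j) * c.dx k P := by
  ext m
  rw [map_sum]
  simp only [coeff_C_mul, dx, coeff_coeffDer]
  exact h j _

/-- The change of fibre coordinates preserves the canonical bracket. -/
theorem Compatible.trans_br (h : Compatible c c') (P Q : MvPowerSeries σ A) :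
    c.trans c' (c'.br P Q) = c.br (c.trans c' P) (c.trans c' Q) := by
  have h1 : ∀ P Q, ∑ j, dxi j (c.trans c' P) * c.dx j (c.trans c' Q) =
      ∑ i, c.trans c' (dxi i P) * c.trans c' (c'.dx i Q) +
      ∑ i, ∑ k, c.trans c' (dxi i P) * (c'.dx i (linForm (c.jac c') k) * c.trans c' (dxi k Q)) := by
    intro P Q
    have e : ∑ j, dxi j (c.trans c' P) * c.dx j (c.trans c' Q) =
        ∑ i, c.trans c' (dxi i P) * c'.dx i (c.trans c' Q) := by
      simp only [trans, dxi_linSubst, Finset.sum_mul]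
      rw [Finset.sum_comm]
      refine Finset.sum_congr rfl fun i _ => ?_
      rw [h.dx_eq, Finset.mul_sum]
      refine Finset.sum_congr rfl fun k _ => ?_
      ring
    rw [e, ← Finset.sum_add_distrib]
    refine Finset.sum_congr rfl fun i _ => ?_
    rw [← Finset.mul_sum, ← mul_add, dx, trans, coeffDer_linSubst]
  -- Symmetry of the second derivatives of the coordinate change. It makes the inhomogeneous terms
  -- cancel in the bracket.
  have h2 : ∀ i k, c'.dx i (linForm (c.jac c') k) = c'.dx k (linForm (c.jac c') i) := by
    intro i k
    simp only [linForm, map_sum]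
    refine Finset.sum_congr rfl fun j _ => ?_
    rw [Derivation.leibniz, Derivation.leibniz, dx_X, dx_X, dx_C, dx_C, jac, jac, c'.comm i k]
    simp
  have h3 : ∑ j, c.dx j (c.trans c' P) * dxi j (c.trans c' Q) =
      ∑ j, dxi j (c.trans c' Q) * c.dx j (c.trans c' P) :=
    Finset.sum_congr rfl fun j _ => mul_comm _ _
  rw [br_def, br_def, map_sum, Finset.sum_sub_distrib (fun j => dxi j (c.trans c' P) * _), h3,
    h1, h1]
  have h4 : ∑ i, ∑ k, c.trans c' (dxi i Q) * (c'.dx i (linForm (c.jac c') k) *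
        c.trans c' (dxi k P)) =
      ∑ i, ∑ k, c.trans c' (dxi i P) * (c'.dx i (linForm (c.jac c') k) *
        c.trans c' (dxi k Q)) := by
    rw [Finset.sum_comm]
    refine Finset.sum_congr rfl fun i _ => Finset.sum_congr rfl fun k _ => ?_
    rw [h2]; ring
  rw [h4]
  simp only [map_sub, map_mul, Finset.sum_sub_distrib, mul_comm (c.trans c' (c'.dx _ P))]
  ring

end Coords

end ChangeOfCoords

end KahlerPoisson

end

noncomputable section

namespace KahlerPoisson

open MvPowerSeries

/-! ### Independence of the coordinates -/

section Transfer

variable {σ A : Type*} [CommRing A] [Algebra ℂ A] [DecidableEq σ] [Fintype σ]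

theorem linSubst_smul (J : σ → σ → A) (r : ℂ) (P : MvPowerSeries σ A) :
    linSubst J (r • P) = r • linSubst J P := by
  have h : ∀ P : MvPowerSeries σ A, r • P = C (algebraMap ℂ A r) * P := fun P => by
    ext m
    rw [coeff_smul_complex, coeff_C_mul, Algebra.smul_def]
  rw [h, map_mul, linSubst_C, ← h]

theorem hess_linSubst (J : σ → σ → A) (P : MvPowerSeries σ A) (i j : σ) :
    hess (linSubst J P) i j = ∑ k, ∑ l, J i k * J j l * hess P k l := by
  rw [hess, dxi_linSubst, map_sum, map_sum, Finset.sum_comm]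
  refine Finset.sum_congr rfl fun l _ => ?_
  rw [Derivation.leibniz, dxi_C, smul_zero, add_zero, smul_eq_mul, map_mul, constantCoeff_C,
    dxi_linSubst, map_sum, Finset.mul_sum]
  refine Finset.sum_congr rfl fun k _ => ?_
  rw [map_mul, constantCoeff_C, constantCoeff_linSubst, hess]
  ring

namespace Coords

variable {c c' : Coords σ A} {typ : σ → Bool} {F F' : MvPowerSeries σ A} {g g' : σ → σ → A}

variable (c c' typ) in
/-- Compatible coordinates such that the change of coordinates preserves types. -/
structure TypeCompatible : Prop where
  compatible : Compatible c c'
  jac_eq_zero : ∀ i j, typ i ≠ typ j → c.jac c' i j = 0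

theorem Compatible.trans_flow (h : Compatible c c') (hF : F' ∈ fil σ A 2)
    (Q : MvPowerSeries σ A) :
    c.trans c' (c'.flow F' Q) = c.flow (c.trans c' F') (c.trans c' Q) :=
  expSeries_natural (c'.raises_hamLin hF) (c.raises_hamLin (linSubst_mem_fil _ hF))
    { toFun := c.trans c'
      map_add' := map_add _
      map_smul' := linSubst_smul _ }
    (fun _ _ hP => linSubst_mem_fil _ hP) (fun P => h.trans_br F' P) Q

/-- The condition in the new coordinates is the vanishing of `{e^{H} x_i, x_j}` for the coordinates
of `c`. Since the change preserves types, these are functions of coordinates of `c'` of a single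
type, to which the old condition applies. -/
theorem IsK.trans (h : TypeCompatible c c' typ) (hF : c'.IsK typ F') :
    c.IsK typ (c.trans c' F') := by
  refine ⟨linSubst_mem_fil _ hF.1, fun i j hij => ?_⟩
  have h1 := h.compatible.trans_flow hF.1 (C (c.x i))
  have h2 : c.trans c' (C (c.x i)) = C (c.x i) := linSubst_C _ _
  have h3 : c.trans c' (C (c.x j)) = C (c.x j) := linSubst_C _ _
  rw [h2] at h1
  have hjac : ∀ i k, typ k ≠ typ i → c'.d k (c.x i) = 0 := fun i k hk =>
    h.jac_eq_zero i k (Ne.symm hk)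
  rw [← h1, ← c.br_x, ← h3, ← h.compatible.trans_br, br_C_right]
  have h4 : ∑ k, dxi k (c'.flow F' (C (c.x i))) * C (c'.d k (c.x j)) = 0 := by
    refine Finset.sum_eq_zero fun k _ => ?_
    by_cases hk : typ k = typ j
    · rw [hF.dxi_flow_C_eq_zero (hjac i) (hk.trans hij.symm), zero_mul]
    · rw [hjac j k hk, map_zero, mul_zero]
  rw [h4, map_zero]

/-- Uniqueness replaces a transformation rule for the higher terms: matching quadratic parts suffice
for local Hamiltonians to agree. -/
theorem IsK.trans_eq (h : TypeCompatible c c' typ) (hF : c.IsK typ F) (hF' : c'.IsK typ F')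
    (hh : ∀ i j, hess F i j = ∑ k, ∑ l, c.jac c' i k * c.jac c' j l * hess F' k l) :
    c.trans c' F' = F := by
  refine (hF'.trans h).eq_of_hess_eq hF ?_
  ext i j
  rw [hh, Coords.trans, hess_linSubst]

/-- The transported mapping solves the system characterising `src` in the other coordinates. The
Jacobian entries that occur are functions of the coordinates of type `t` alone, and `src` leaves
those unchanged. -/
theorem IsKP.trans_src (h : TypeCompatible c c' typ) (hg : c.IsKP typ g) (hg' : c'.IsKP typ g')
    (hh : ∀ i j, g i j = ∑ k, ∑ l, c.jac c' i k * c.jac c' j l * g' k l) (t : Bool) (u : A) :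
    c.trans c' (c'.src typ g' t u) = c.src typ g t u := by
  refine hg.src_unique t id (fun u => c.trans c' (c'.src typ g' t u)) (fun u => ?_)
    (fun i u => c.vf typ g t i u) (fun i u => ?_) (fun _ _ => rfl) u
  · rw [Coords.trans, constantCoeff_linSubst, constantCoeff_src]; rfl
  have hvf : c.vf typ g t i u = ∑ k, (if typ i = t then c.jac c' i k else 0) *
      c'.vf typ g' t k u := by
    split_ifs with hi
    · rw [vf_apply _ _ _ _ hi]
      have e : ∀ k, c.jac c' i k * c'.vf typ g' t k u =
          ∑ j, (∑ l, c.jac c' i k * c.jac c' j l * g' k l) * c.d j u := by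
        intro k
        by_cases hk : typ k = t
        · rw [vf_apply _ _ _ _ hk]
          simp only [h.compatible _ u, Finset.mul_sum, Finset.sum_mul]
          rw [Finset.sum_comm]
          refine Finset.sum_congr rfl fun j _ => Finset.sum_congr rfl fun l _ => by ring
        · rw [h.jac_eq_zero i k (by rw [hi]; exact Ne.symm hk)]; simp
      simp only [e, hh]
      rw [Finset.sum_comm]
      refine Finset.sum_congr rfl fun j _ => ?_
      rw [Finset.sum_mul]
    · rw [vf_eq_zero _ _ _ _ hi]; simp
  rw [Coords.trans, dxi_linSubst, hvf, src_sum, map_sum]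
  refine Finset.sum_congr rfl fun k _ => ?_
  rw [hg'.dxi_src, src_mul, map_mul]
  by_cases hk : typ k = t
  swap
  · rw [vf_eq_zero _ _ _ _ hk, src_zero, map_zero, mul_zero, mul_zero]
  congr 1
  split_ifs with hi
  · rw [hg'.src_eq_C, linSubst_C]
    intro j hj
    rw [jac, c'.comm, show c'.d j (c.x i) = 0 from h.jac_eq_zero i j (by rw [hi]; exact Ne.symm hj),
      map_zero]
  · rw [src_zero, map_zero, h.jac_eq_zero i k (by rw [hk]; exact hi), map_zero]

end Coords

end Transfer

/-! ### Dual numbers -/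

section Dual

open TrivSqZeroExt

variable {σ A : Type*} [CommRing A] [Algebra ℂ A]

/-- The extension of a derivation to dual numbers. -/
def dualDer (D : Derivation ℂ A A) : Derivation ℂ A[ε] A[ε] :=
  Derivation.mk'
    { toFun := fun a => inl (D a.fst) + inr (D a.snd)
      map_add' := fun a b => by ext <;> simp
      map_smul' := fun r a => by ext <;> simp [D.map_smul] }
    (fun a b => by
      ext
      · simp
      · simp [mul_comm]
        ring)

@[simp]
theorem fst_dualDer (D : Derivation ℂ A A) (a : A[ε]) : (dualDer D a).fst = D a.fst := by
  change (inl (D a.fst) + inr (D a.snd) : A[ε]).fst = _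
  simp

@[simp]
theorem snd_dualDer (D : Derivation ℂ A A) (a : A[ε]) : (dualDer D a).snd = D a.snd := by
  change (inl (D a.fst) + inr (D a.snd) : A[ε]).snd = _
  simp

theorem dualDer_inl (D : Derivation ℂ A A) (a : A) : dualDer D (inl a) = inl (D a) := by
  ext <;> simp

/-- The constant term in `ε` of a power series over the dual numbers. -/
def sfst : MvPowerSeries σ A[ε] →+* MvPowerSeries σ A :=
  MvPowerSeries.map (fstHom A A A).toRingHom

/-- The coefficient of `ε` of a power series over the dual numbers. -/
def ssnd : MvPowerSeries σ A[ε] →ₗ[ℂ] MvPowerSeries σ A where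
  toFun P := mkSeries fun m => (coeff m P).snd
  map_add' P Q := by ext m; simp
  map_smul' r P := by
    ext m
    rw [coeff_mkSeries, coeff_smul_complex, RingHom.id_apply, coeff_smul_complex, coeff_mkSeries,
      snd_smul]

@[simp]
theorem coeff_sfst (P : MvPowerSeries σ A[ε]) (m : σ →₀ ℕ) :
    coeff m (sfst P) = (coeff m P).fst := by
  rw [sfst, coeff_map]; rfl

@[simp]
theorem coeff_ssnd (P : MvPowerSeries σ A[ε]) (m : σ →₀ ℕ) :
    coeff m (ssnd P) = (coeff m P).snd := rfl

/-- The power series `P + ε Q`. -/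
def mkEps (P Q : MvPowerSeries σ A) : MvPowerSeries σ A[ε] :=
  mkSeries fun m => inl (coeff m P) + inr (coeff m Q)

@[simp]
theorem sfst_mkEps (P Q : MvPowerSeries σ A) : sfst (mkEps P Q) = P := by
  ext m; simp [mkEps]

@[simp]
theorem ssnd_mkEps (P Q : MvPowerSeries σ A) : ssnd (mkEps P Q) = Q := by
  ext m; simp [mkEps]

theorem eps_series_ext {P Q : MvPowerSeries σ A[ε]} (h1 : sfst P = sfst Q)
    (h2 : ssnd P = ssnd Q) : P = Q := by
  ext m
  · simpa using congrArg (coeff m) h1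
  · simpa using congrArg (coeff m) h2

theorem ssnd_mul (P Q : MvPowerSeries σ A[ε]) :
    ssnd (P * Q) = sfst P * ssnd Q + ssnd P * sfst Q := by
  classical
  ext m
  rw [coeff_ssnd, coeff_mul, map_add, coeff_mul, coeff_mul, ← Finset.sum_add_distrib, snd_sum]
  refine Finset.sum_congr rfl fun p _ => ?_
  simp [mul_comm]

theorem sfst_C (a : A[ε]) : sfst (C a : MvPowerSeries σ A[ε]) = C a.fst := by
  rw [sfst, map_C]; rfl

theorem ssnd_C (a : A[ε]) : ssnd (C a : MvPowerSeries σ A[ε]) = C a.snd := by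
  classical
  ext m
  rw [coeff_ssnd, coeff_C, coeff_C]
  split_ifs <;> simp

theorem sfst_dxi (i : σ) (P : MvPowerSeries σ A[ε]) : sfst (dxi i P) = dxi i (sfst P) := by
  ext m; simp [coeff_dxi]

theorem ssnd_dxi (i : σ) (P : MvPowerSeries σ A[ε]) : ssnd (dxi i P) = dxi i (ssnd P) := by
  ext m; simp [coeff_dxi, mul_comm]

theorem sfst_coeffDer (D : Derivation ℂ A A) (P : MvPowerSeries σ A[ε]) :
    sfst (coeffDer (dualDer D) P) = coeffDer D (sfst P) := by ext m; simp

theorem ssnd_coeffDer (D : Derivation ℂ A A) (P : MvPowerSeries σ A[ε]) :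
    ssnd (coeffDer (dualDer D) P) = coeffDer D (ssnd P) := by ext m; simp

theorem mem_fil_eps {N : ℕ} {P : MvPowerSeries σ A[ε]} :
    P ∈ fil σ A[ε] N ↔ sfst P ∈ fil σ A N ∧ ssnd P ∈ fil σ A N := by
  constructor
  · intro h
    exact ⟨fun m hm => by rw [coeff_sfst, h m hm, fst_zero],
      fun m hm => by rw [coeff_ssnd, h m hm, snd_zero]⟩
  · intro h m hm
    ext
    · simpa using h.1 m hm
    · simpa using h.2 m hm

theorem fst_hess (P : MvPowerSeries σ A[ε]) (i j : σ) : (hess P i j).fst = hess (sfst P) i j := by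
  rw [hess, hess, ← coeff_zero_eq_constantCoeff_apply, ← coeff_zero_eq_constantCoeff_apply,
    ← coeff_sfst, sfst_dxi, sfst_dxi]

theorem snd_hess (P : MvPowerSeries σ A[ε]) (i j : σ) : (hess P i j).snd = hess (ssnd P) i j := by
  rw [hess, hess, ← coeff_zero_eq_constantCoeff_apply, ← coeff_zero_eq_constantCoeff_apply,
    ← coeff_ssnd, ssnd_dxi, ssnd_dxi]

variable [DecidableEq σ] [Fintype σ]

namespace Coords

/-- The extension of coordinates to dual numbers. -/
def eps (c : Coords σ A) : Coords σ A[ε] where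
  d i := dualDer (c.d i)
  x i := inl (c.x i)
  comm i j f := by ext <;> simp [c.comm i j]
  d_x i j := by
    rw [dualDer_inl, c.d_x]
    split_ifs <;> simp

theorem eps_d (c : Coords σ A) (i : σ) (a : A[ε]) : c.eps.d i a = dualDer (c.d i) a := rfl

theorem eps_x (c : Coords σ A) (i : σ) : c.eps.x i = inl (c.x i) := rfl

theorem sfst_br (c : Coords σ A) (P Q : MvPowerSeries σ A[ε]) :
    sfst (c.eps.br P Q) = c.br (sfst P) (sfst Q) := by
  rw [br_def, br_def, map_sum]
  refine Finset.sum_congr rfl fun i _ => ?_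
  simp only [map_sub, map_mul, sfst_dxi, dx, eps, sfst_coeffDer]

theorem ssnd_br (c : Coords σ A) (P Q : MvPowerSeries σ A[ε]) :
    ssnd (c.eps.br P Q) = c.br (sfst P) (ssnd Q) + c.br (ssnd P) (sfst Q) := by
  rw [br_def, br_def, br_def, map_sum, ← Finset.sum_add_distrib]
  refine Finset.sum_congr rfl fun i _ => ?_
  simp only [map_sub, ssnd_mul, sfst_dxi, ssnd_dxi, dx, eps, sfst_coeffDer, ssnd_coeffDer]
  ring

theorem eps_jac (c c' : Coords σ A) (k j : σ) : c.eps.jac c'.eps k j = inl (c.jac c' k j) :=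
  dualDer_inl _ _

theorem TypeCompatible.eps {c c' : Coords σ A} {typ : σ → Bool} (h : TypeCompatible c c' typ) :
    TypeCompatible c.eps c'.eps typ := by
  refine ⟨fun j f => ?_, fun i j hij => by rw [eps_jac, h.jac_eq_zero i j hij, inl_zero]⟩
  ext
  · rw [eps_d, fst_dualDer, fst_sum, h.compatible j f.fst]
    simp [eps_jac, eps_d]
  · rw [eps_d, snd_dualDer, snd_sum, h.compatible j f.snd]
    simp [eps_jac, eps_d]

end Coords

theorem sfst_linSubst (J : σ → σ → A) (P : MvPowerSeries σ A[ε]) :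
    sfst (linSubst (fun k j => (inl (J k j) : A[ε])) P) = linSubst J (sfst P) := by
  rw [linSubst_apply, linSubst_apply, sfst, map_subst (hasSubst_linForm _)]
  congr 1
  ext1 i
  simp only [linForm, map_sum, map_mul, map_C, map_X]
  rfl

theorem linSubst_map_inl (J : σ → σ → A) (P : MvPowerSeries σ A) :
    linSubst (fun k j => (inl (J k j) : A[ε])) (MvPowerSeries.map (inlHom A A) P) =
      MvPowerSeries.map (inlHom A A) (linSubst J P) := by
  rw [linSubst_apply, linSubst_apply, map_subst (hasSubst_linForm _)]
  congr 1
  ext1 i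
  simp only [linForm, map_sum, map_mul, map_C, map_X]
  rfl

/-- The matrix has no `ε`-part, so the substitution is `ε`-linear and acts on the two components
separately. -/
theorem ssnd_linSubst (J : σ → σ → A) (P : MvPowerSeries σ A[ε]) :
    ssnd (linSubst (fun k j => (inl (J k j) : A[ε])) P) = linSubst J (ssnd P) := by
  have hP : P = MvPowerSeries.map (inlHom A A) (sfst P) +
      C (DualNumber.eps : A[ε]) * MvPowerSeries.map (inlHom A A) (ssnd P) := by
    ext m <;> simp [coeff_C_mul]
  have hs : ∀ Q : MvPowerSeries σ A, ssnd (MvPowerSeries.map (inlHom A A) Q) = 0 := fun Q => by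
    ext m; simp
  have hf : ∀ Q : MvPowerSeries σ A, sfst (MvPowerSeries.map (inlHom A A) Q) = Q := fun Q => by
    ext m; simp
  conv_lhs => rw [hP]
  rw [map_add, map_mul, linSubst_C, linSubst_map_inl, linSubst_map_inl, map_add, hs, ssnd_mul,
    hs, hf, ssnd_C]
  simp

end Dual

end KahlerPoisson

end

noncomputable section

namespace KahlerPoisson

/-! ### Smoothness of holomorphic functions of several variables -/

section Osgood

open Metric

variable {E : Type*} [NormedAddCommGroup E] [NormedSpace ℂ E]

theorem hasDerivAt_line {h : E → ℂ} {y v : E} (hd : DifferentiableAt ℂ h y) :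
    HasDerivAt (fun t : ℂ => h (y + t • v)) (fderiv ℂ h y v) 0 := by
  have h1 : HasDerivAt (fun t : ℂ => y + t • v) v 0 := by
    simpa using ((hasDerivAt_id (0 : ℂ)).smul_const v).const_add y
  have h2 : HasFDerivAt h (fderiv ℂ h y) (y + (0 : ℂ) • v) := by simpa using hd.hasFDerivAt
  exact h2.comp_hasDerivAt (0 : ℂ) h1

theorem differentiableOn_line {h : E → ℂ} {U : Set E} (hd : DifferentiableOn ℂ h U) (y v : E) :
    DifferentiableOn ℂ (fun t : ℂ => h (y + t • v)) {t | y + t • v ∈ U} :=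
  hd.comp (by fun_prop) fun _ ht => ht

/-- Cauchy's estimate for the derivative. -/
theorem norm_fderiv_le_of_bound {h : E → ℂ} {y₀ y : E} {R r B : ℝ}
    (hd : DifferentiableOn ℂ h (ball y₀ R)) (hB : ∀ z ∈ ball y₀ R, ‖h z‖ ≤ B) (hr : 0 < r)
    (hy : ‖y - y₀‖ + r < R) : ‖fderiv ℂ h y‖ ≤ B / r := by
  have hyR : y ∈ ball y₀ R := by rw [mem_ball_iff_norm]; linarith
  have hB0 : 0 ≤ B := (norm_nonneg _).trans (hB y hyR)
  refine ContinuousLinearMap.opNorm_le_bound _ (by positivity) fun v => ?_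
  by_cases hv : v = 0
  · simp [hv]
  have hv' : 0 < ‖v‖ := norm_pos_iff.2 hv
  have hρ : 0 < r / ‖v‖ := by positivity
  have hmem : ∀ t ∈ closedBall (0 : ℂ) (r / ‖v‖), y + t • v ∈ ball y₀ R := by
    intro t ht
    rw [mem_closedBall_zero_iff, le_div_iff₀ hv'] at ht
    rw [mem_ball_iff_norm]
    calc ‖y + t • v - y₀‖ = ‖(y - y₀) + t • v‖ := by congr 1; abel
      _ ≤ ‖y - y₀‖ + ‖t‖ * ‖v‖ := (norm_add_le _ _).trans (by rw [norm_smul])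
      _ < R := by linarith
  have hdc : DiffContOnCl ℂ (fun t : ℂ => h (y + t • v)) (ball 0 (r / ‖v‖)) :=
    ((differentiableOn_line hd y v).mono fun t ht => hmem t ht).diffContOnCl_ball subset_rfl
  have := Complex.norm_deriv_le_of_forall_mem_sphere_norm_le hρ hdc
    fun z hz => hB _ (hmem z (sphere_subset_closedBall hz))
  rw [(hasDerivAt_line (hd.differentiableAt (isOpen_ball.mem_nhds hyR))).deriv] at this
  refine this.trans (le_of_eq ?_)
  field_simp

/-- Local bounds for a holomorphic function and its derivative. -/
theorem exists_local_bound {f : E → ℂ} {U : Set E} (hU : IsOpen U) (hf : DifferentiableOn ℂ f U)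
    {y₀ : E} (hy : y₀ ∈ U) : ∃ r > 0, ∃ B, ball y₀ (3 * r) ⊆ U ∧
      ∀ y ∈ ball y₀ (3 * r), ‖fderiv ℂ f y‖ ≤ B := by
  have hc : ContinuousAt f y₀ := (hf.differentiableAt (hU.mem_nhds hy)).continuousAt
  have h1 : ∀ᶠ y in nhds y₀, ‖f y‖ < ‖f y₀‖ + 1 :=
    hc.norm.eventually_lt continuousAt_const (by simp)
  obtain ⟨R, hR, hb⟩ := Metric.eventually_nhds_iff_ball.1 (h1.and (hU.mem_nhds hy))
  refine ⟨R / 4, by positivity, (‖f y₀‖ + 1) / (R / 4), fun y h => ?_, fun y h => ?_⟩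
  · refine (hb y ?_).2
    exact ball_subset_ball (by linarith) h
  · refine norm_fderiv_le_of_bound (y₀ := y₀) (R := R) (fun z hz => ?_)
      (fun z hz => (hb z hz).1.le) (by positivity) ?_
    · exact (hf z (hb z hz).2).mono fun w hw => (hb w hw).2
    · rw [mem_ball_iff_norm] at h; linarith

/-- Cauchy's estimate is applied to the difference of translates `f (z + u) - f z`, which is
`O(‖u‖)` uniformly by the local bound on the derivative; hence so is its derivative at `y₀`. -/
theorem continuousOn_fderiv_of_differentiableOn {f : E → ℂ} {U : Set E} (hU : IsOpen U)
    (hf : DifferentiableOn ℂ f U) : ContinuousOn (fderiv ℂ f) U := by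
  intro y₀ hy
  obtain ⟨r, hr, B, hsub, hB⟩ := exists_local_bound hU hf hy
  refine ContinuousAt.continuousWithinAt ?_
  have hda : ∀ z ∈ ball y₀ (3 * r), DifferentiableAt ℂ f z := fun z hz =>
    hf.differentiableAt (hU.mem_nhds (hsub hz))
  have key : ∀ y ∈ ball y₀ r, ‖fderiv ℂ f y - fderiv ℂ f y₀‖ ≤ B * ‖y - y₀‖ / r := by
    intro y hyr
    rw [mem_ball_iff_norm] at hyr
    set u := y - y₀ with hu
    have hz3 : ∀ z ∈ ball y₀ (2 * r), z ∈ ball y₀ (3 * r) ∧ z + u ∈ ball y₀ (3 * r) := by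
      intro z hz
      rw [mem_ball_iff_norm] at hz
      constructor
      · rw [mem_ball_iff_norm]; linarith
      · rw [mem_ball_iff_norm]
        calc ‖z + u - y₀‖ = ‖(z - y₀) + u‖ := by congr 1; abel
          _ ≤ ‖z - y₀‖ + ‖u‖ := norm_add_le _ _
          _ < 3 * r := by linarith
    have hdu : ∀ z ∈ ball y₀ (2 * r), HasFDerivAt (fun z => f (z + u) - f z)
        (fderiv ℂ f (z + u) - fderiv ℂ f z) z := by
      intro z hz
      refine HasFDerivAt.sub ?_ (hda z (hz3 z hz).1).hasFDerivAt
      exact (hasFDerivAt_comp_add_right (f := f) u).2 (hda _ (hz3 z hz).2).hasFDerivAt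
    have hbd : ∀ z ∈ ball y₀ (2 * r), ‖f (z + u) - f z‖ ≤ B * ‖u‖ := by
      intro z hz
      have := (convex_ball y₀ (3 * r)).norm_image_sub_le_of_norm_fderiv_le (𝕜 := ℂ)
        (fun w hw => hda w hw) (fun w hw => hB w hw) (hz3 z hz).1 (hz3 z hz).2
      simpa using this
    have h := norm_fderiv_le_of_bound (y₀ := y₀) (y := y₀) (r := r)
      (fun z hz => (hdu z hz).differentiableAt.differentiableWithinAt) hbd hr (by simp; linarith)
    rw [(hdu y₀ (by simp [hr])).fderiv] at h
    simpa [hu] using h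
  rw [ContinuousAt, tendsto_iff_norm_sub_tendsto_zero]
  have hlim : Filter.Tendsto (fun y => B * ‖y - y₀‖ / r) (nhds y₀) (nhds 0) := by
    have : ContinuousAt (fun y => B * ‖y - y₀‖ / r) y₀ := by fun_prop
    simpa [ContinuousAt] using this
  refine squeeze_zero' (Filter.Eventually.of_forall fun _ => norm_nonneg _) ?_ hlim
  filter_upwards [ball_mem_nhds y₀ hr] with y hy using key y hy

/-- Cauchy's formula on a circle in the direction `v` writes the directional derivative as an
integral of values of `f`, which can be differentiated under the integral sign. Continuity of the
derivative provides measurability of the differentiated integrand. -/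
theorem differentiableOn_fderiv_apply {f : E → ℂ} {U : Set E} (hU : IsOpen U)
    (hf : DifferentiableOn ℂ f U) (v : E) : DifferentiableOn ℂ (fun y => fderiv ℂ f y v) U := by
  intro y₀ hy
  refine DifferentiableAt.differentiableWithinAt ?_
  obtain ⟨r, hr, B, hsub, hB⟩ := exists_local_bound hU hf hy
  have hcont := continuousOn_fderiv_of_differentiableOn hU hf
  -- The disc of this radius in the direction `v` moves points by less than `r`; the added `1`
  -- covers `v = 0`.
  set ρ : ℝ := r / (‖v‖ + 1) with hρdef
  have hρ : 0 < ρ := by positivity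
  have hρv : ρ * ‖v‖ < r := by
    rw [hρdef, div_mul_eq_mul_div, div_lt_iff₀ (by positivity)]; nlinarith
  have hmem : ∀ y ∈ ball y₀ r, ∀ t : ℂ, ‖t‖ ≤ ρ → y + t • v ∈ ball y₀ (3 * r) := by
    intro y hy t ht
    rw [mem_ball_iff_norm] at hy ⊢
    calc ‖y + t • v - y₀‖ = ‖(y - y₀) + t • v‖ := by congr 1; abel
      _ ≤ ‖y - y₀‖ + ‖t‖ * ‖v‖ := (norm_add_le _ _).trans (by rw [norm_smul])
      _ ≤ ‖y - y₀‖ + ρ * ‖v‖ := by gcongr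
      _ < 3 * r := by linarith
  have hcirc : ∀ θ : ℝ, ‖circleMap 0 ρ θ‖ ≤ ρ := fun θ => by
    rw [norm_circleMap_zero, abs_of_pos hρ]
  set k : ℝ → ℂ := fun θ => deriv (circleMap 0 ρ) θ * ((circleMap 0 ρ θ - 0) ^ 2)⁻¹ with hk
  have hkc : Continuous k := by
    have hne : ∀ θ, (circleMap 0 ρ θ - 0) ^ 2 ≠ 0 := fun θ => by
      rw [sub_zero]; exact pow_ne_zero 2 (by simpa using hρ.ne')
    have h1 : Continuous fun θ => deriv (circleMap 0 ρ) θ := by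
      simp only [deriv_circleMap]; fun_prop
    exact h1.mul (Continuous.inv₀ (by fun_prop) hne)
  have hformula : ∀ y ∈ ball y₀ r, fderiv ℂ f y v =
      (2 * Real.pi * Complex.I : ℂ)⁻¹ •
        ∫ θ in (0 : ℝ)..2 * Real.pi, k θ • f (y + circleMap 0 ρ θ • v) := by
    intro y hy
    have hyU : y ∈ U := hsub (by simpa using hmem y hy 0 (by simpa using hρ.le))
    have hopen : IsOpen {t : ℂ | y + t • v ∈ U} := hU.preimage (by fun_prop)
    have h := Complex.two_pi_I_inv_smul_circleIntegral_sub_sq_inv_smul_of_differentiable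
      hopen (c := 0) (w₀ := 0) (R := ρ)
      (fun t ht => hsub (hmem y hy t (by simpa using ht)))
      (differentiableOn_line hf y v) (mem_ball_self hρ)
    rw [(hasDerivAt_line (hf.differentiableAt (hU.mem_nhds hyU))).deriv] at h
    rw [← h, circleIntegral]
    simp only [hk, smul_smul]
  have hcontF : ∀ y ∈ ball y₀ r, Continuous fun θ : ℝ => k θ • f (y + circleMap 0 ρ θ • v) := by
    intro y hy
    refine hkc.smul ?_
    exact hf.continuousOn.comp_continuous (by fun_prop)
      fun θ => hsub (hmem y hy _ (hcirc θ))
  have hy₀ : y₀ ∈ ball y₀ r := mem_ball_self hr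
  have hcontF' : Continuous fun θ : ℝ => k θ • fderiv ℂ f (y₀ + circleMap 0 ρ θ • v) :=
    hkc.smul (hcont.comp_continuous (by fun_prop) fun θ => hsub (hmem y₀ hy₀ _ (hcirc θ)))
  have hint := intervalIntegral.hasFDerivAt_integral_of_dominated_of_fderiv_le
    (𝕜 := ℂ) (μ := MeasureTheory.volume) (a := 0) (b := 2 * Real.pi) (x₀ := y₀)
    (F := fun y θ => k θ • f (y + circleMap 0 ρ θ • v))
    (F' := fun y θ => k θ • fderiv ℂ f (y + circleMap 0 ρ θ • v))
    (bound := fun θ => ‖k θ‖ * B)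
    (ball_mem_nhds y₀ hr)
    (by
      filter_upwards [ball_mem_nhds y₀ hr] with y hy
      exact (hcontF y hy).aestronglyMeasurable)
    ((hcontF y₀ hy₀).intervalIntegrable _ _)
    hcontF'.aestronglyMeasurable
    (Filter.Eventually.of_forall fun θ _ y hy => by
      rw [norm_smul]
      gcongr
      exact hB _ (hmem y hy _ (hcirc θ)))
    ((hkc.norm.mul continuous_const).intervalIntegrable _ _)
    (Filter.Eventually.of_forall fun θ _ y hy => by
      refine HasFDerivAt.const_smul ?_ (k θ)
      have := (hf.differentiableAt (hU.mem_nhds (hsub (hmem y hy _ (hcirc θ))))).hasFDerivAt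
      exact (hasFDerivAt_comp_add_right (f := f) _).2 this)
  refine ((hint.const_smul (2 * Real.pi * Complex.I : ℂ)⁻¹).differentiableAt).congr_of_eventuallyEq
    ?_
  filter_upwards [ball_mem_nhds y₀ hr] with y hy using hformula y hy

/-- A holomorphic function of several variables is infinitely differentiable. -/
theorem contDiffOn_of_differentiableOn_complex [FiniteDimensional ℂ E] {f : E → ℂ} {U : Set E}
    (hU : IsOpen U) (hf : DifferentiableOn ℂ f U) : ContDiffOn ℂ ∞ f U := by
  rw [contDiffOn_infty]
  intro m
  induction m generalizing f with
  | zero => exact contDiffOn_zero.2 hf.continuousOn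
  | succ m ih =>
    push_cast
    rw [contDiffOn_succ_iff_fderiv_apply hU.uniqueDiffOn]
    refine ⟨hf, by simp, fun v => ?_⟩
    refine (ih (differentiableOn_fderiv_apply hU hf v)).congr fun y hy => ?_
    rw [fderivWithin_of_isOpen hU hy]

end Osgood

end KahlerPoisson

end

noncomputable section

namespace KahlerPoisson

/-! ### Wirtinger derivatives -/

section Wirtinger

variable {n : ℕ}

/-- The index of the coordinates `z¹, …, zⁿ, z̄¹, …, z̄ⁿ`. -/
abbrev Idx (n : ℕ) : Type := Fin n ⊕ Fin n

/-- The type of an index: `true` for holomorphic and `false` for antiholomorphic coordinates. -/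
abbrev holType (n : ℕ) : Idx n → Bool := Sum.isLeft

/-- The value of a real linear form on the complex vector field `∂/∂zᵏ` or `∂/∂z̄ˡ`. -/
def wirtinger (i : Idx n) : ((Fin n → ℂ) →L[ℝ] ℂ) →L[ℝ] ℂ :=
  Sum.elim
    (fun k => (2⁻¹ : ℂ) • (ContinuousLinearMap.apply ℝ ℂ (Pi.single k 1 : Fin n → ℂ)
      - Complex.I • ContinuousLinearMap.apply ℝ ℂ (Pi.single k Complex.I : Fin n → ℂ)))
    (fun k => (2⁻¹ : ℂ) • (ContinuousLinearMap.apply ℝ ℂ (Pi.single k 1 : Fin n → ℂ)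
      + Complex.I • ContinuousLinearMap.apply ℝ ℂ (Pi.single k Complex.I : Fin n → ℂ))) i

theorem wirtinger_inl (k : Fin n) (L : (Fin n → ℂ) →L[ℝ] ℂ) : wirtinger (Sum.inl k) L =
    (L (Pi.single k 1) - Complex.I * L (Pi.single k Complex.I)) / 2 := by
  simp [wirtinger, div_eq_inv_mul]

theorem wirtinger_inr (k : Fin n) (L : (Fin n → ℂ) →L[ℝ] ℂ) : wirtinger (Sum.inr k) L =
    (L (Pi.single k 1) + Complex.I * L (Pi.single k Complex.I)) / 2 := by
  simp [wirtinger, div_eq_inv_mul, mul_add]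

theorem wirtinger_smul (i : Idx n) (r : ℂ) (L : (Fin n → ℂ) →L[ℝ] ℂ) :
    wirtinger i (r • L) = r * wirtinger i L := by
  rcases i with k | k <;> simp only [wirtinger_inl, wirtinger_inr, _root_.smul_apply,
    smul_eq_mul] <;> ring

/-- The derivatives `∂f/∂zᵏ` and `∂f/∂z̄ˡ`. -/
def dW (i : Idx n) (f : (Fin n → ℂ) → ℂ) (y : Fin n → ℂ) : ℂ := wirtinger i (fderiv ℝ f y)

theorem dW_inl (k : Fin n) (f : (Fin n → ℂ) → ℂ) (y : Fin n → ℂ) :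
    dW (Sum.inl k) f y = dz k f y := wirtinger_inl _ _

theorem dW_inr (k : Fin n) (f : (Fin n → ℂ) → ℂ) (y : Fin n → ℂ) :
    dW (Sum.inr k) f y = dzbar k f y := wirtinger_inr _ _

theorem dW_congr {f f' : (Fin n → ℂ) → ℂ} {y : Fin n → ℂ} (h : f =ᶠ[nhds y] f') (i : Idx n) :
    dW i f y = dW i f' y := by rw [dW, dW, h.fderiv_eq]

theorem dW_add {f f' : (Fin n → ℂ) → ℂ} {y : Fin n → ℂ} (hf : DifferentiableAt ℝ f y)
    (hf' : DifferentiableAt ℝ f' y) (i : Idx n) :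
    dW i (fun y => f y + f' y) y = dW i f y + dW i f' y := by
  rw [dW, fderiv_fun_add hf hf', map_add, dW, dW]

theorem dW_mul {f f' : (Fin n → ℂ) → ℂ} {y : Fin n → ℂ} (hf : DifferentiableAt ℝ f y)
    (hf' : DifferentiableAt ℝ f' y) (i : Idx n) :
    dW i (fun y => f y * f' y) y = f y * dW i f' y + f' y * dW i f y := by
  rw [dW, fderiv_fun_mul hf hf', map_add, wirtinger_smul, wirtinger_smul, dW, dW]

theorem dW_const (r : ℂ) (i : Idx n) (y : Fin n → ℂ) : dW i (fun _ => r) y = 0 := by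
  rw [dW, fderiv_const_apply, map_zero]

theorem contDiffOn_dW {f : (Fin n → ℂ) → ℂ} {W : Set (Fin n → ℂ)} (hW : IsOpen W)
    (hf : ContDiffOn ℝ ∞ f W) (i : Idx n) : ContDiffOn ℝ ∞ (dW i f) W :=
  (wirtinger i).contDiff.comp_contDiffOn (hf.fderiv_of_isOpen hW (by simp))

theorem dW_comm {f : (Fin n → ℂ) → ℂ} {y : Fin n → ℂ} (hf : ContDiffAt ℝ ∞ f y) (i j : Idx n) :
    dW i (dW j f) y = dW j (dW i f) y := by
  have hd : DifferentiableAt ℝ (fderiv ℝ f) y :=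
    (hf.fderiv_right (m := ∞) (by simp)).differentiableAt (by simp)
  have hfd : ∀ j : Idx n, ∀ v, fderiv ℝ (dW j f) y v = wirtinger j (fderiv ℝ (fderiv ℝ f) y v) := by
    intro j v
    have : dW j f = wirtinger j ∘ fderiv ℝ f := rfl
    rw [this, fderiv_comp y (wirtinger j).differentiableAt hd, ContinuousLinearMap.fderiv]
    rfl
  have hs : ∀ v w, fderiv ℝ (fderiv ℝ f) y v w = fderiv ℝ (fderiv ℝ f) y w v :=
    fun v w => (hf.isSymmSndFDerivAt (by simpa using ENat.LEInfty.out)) v w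
  rw [dW, dW]
  rcases i with i | i <;> rcases j with j | j <;>
  · simp only [wirtinger_inl, wirtinger_inr, hfd]
    simp only [hs (Pi.single j _) (Pi.single i _)]
    ring

/-- The coordinate functions `zᵏ` and `z̄ˡ`. -/
def coordFun (i : Idx n) (y : Fin n → ℂ) : ℂ := Sum.elim y (fun k => conj (y k)) i

theorem contDiff_coordFun (i : Idx n) : ContDiff ℝ ∞ (coordFun i) := by
  rcases i with k | k
  · exact contDiff_apply ℝ ℂ k
  · exact Complex.conjCLE.contDiff.comp (contDiff_apply ℝ ℂ k)

/-- The differential of a holomorphic function vanishes on `∂/∂z̄ˡ`. -/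
theorem dW_of_differentiableAt {f : (Fin n → ℂ) → ℂ} {y : Fin n → ℂ}
    (hf : DifferentiableAt ℂ f y) (k : Fin n) :
    dW (Sum.inl k) f y = fderiv ℂ f y (Pi.single k 1) ∧ dW (Sum.inr k) f y = 0 := by
  have hI : (Pi.single k Complex.I : Fin n → ℂ) = Complex.I • Pi.single k (1 : ℂ) := by
    ext i; simp [Pi.single_apply]
  have hd : ∀ v, fderiv ℝ f y v = fderiv ℂ f y v := fun v => by
    rw [hf.fderiv_restrictScalars ℝ]; rfl
  rw [dW, dW, wirtinger_inl, wirtinger_inr, hd, hd, hI, map_smul, smul_eq_mul]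
  constructor
  · linear_combination (-fderiv ℂ f y (Pi.single k 1) / 2) * Complex.I_sq
  · linear_combination (fderiv ℂ f y (Pi.single k 1) / 2) * Complex.I_sq

theorem dW_of_differentiableAt_conj {f : (Fin n → ℂ) → ℂ} {y : Fin n → ℂ}
    (hf : DifferentiableAt ℂ f y) (k : Fin n) :
    dW (Sum.inr k) (fun y => conj (f y)) y = conj (fderiv ℂ f y (Pi.single k 1)) ∧
      dW (Sum.inl k) (fun y => conj (f y)) y = 0 := by
  have hd : ∀ v, fderiv ℝ (fun y => conj (f y)) y v = conj (fderiv ℝ f y v) := fun v => by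
    have : (fun y => conj (f y)) = Complex.conjCLE ∘ f := rfl
    rw [this, fderiv_comp y Complex.conjCLE.differentiableAt (hf.restrictScalars ℝ),
      ContinuousLinearEquiv.fderiv]
    rfl
  have h := dW_of_differentiableAt hf k
  rw [dW, dW, wirtinger_inl, wirtinger_inr] at h
  rw [dW, dW, wirtinger_inl, wirtinger_inr, hd, hd, ← h.1]
  refine ⟨?_, ?_⟩
  · simp [sub_eq_add_neg, map_ofNat]
  · have := congrArg conj h.2
    simpa [sub_eq_add_neg] using this

theorem dW_coordFun (i j : Idx n) (y : Fin n → ℂ) :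
    dW i (coordFun j) y = if i = j then 1 else 0 := by
  have hd : ∀ k : Fin n, DifferentiableAt ℂ (fun y : Fin n → ℂ => y k) y := fun k =>
    differentiableAt_apply k y
  have hf : ∀ k l : Fin n, fderiv ℂ (fun y : Fin n → ℂ => y k) y (Pi.single l 1) =
      if l = k then 1 else 0 := fun k l => by
    rw [show (fun y : Fin n → ℂ => y k) =
        (ContinuousLinearMap.proj k : (Fin n → ℂ) →L[ℂ] ℂ) from rfl,
      ContinuousLinearMap.fderiv]
    simp [Pi.single_apply, eq_comm]
  rcases j with k | k <;> rcases i with l | l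
  · exact ((dW_of_differentiableAt (hd k) l).1.trans (hf k l)).trans (by simp)
  · exact (dW_of_differentiableAt (hd k) l).2.trans (by simp)
  · exact (dW_of_differentiableAt_conj (hd k) l).2.trans (by simp)
  · refine ((dW_of_differentiableAt_conj (hd k) l).1.trans (congrArg conj (hf k l))).trans ?_
    simp [apply_ite (starRingEnd ℂ)]

/-- The components of the coordinate change `φ`. -/
theorem dW_coordFun_comp {φ : (Fin n → ℂ) → (Fin n → ℂ)} {w : Fin n → ℂ}
    (hφ : DifferentiableAt ℂ φ w) (k j : Fin n) :
    dW (Sum.inl j) (coordFun (Sum.inl k) ∘ φ) w = fderiv ℂ φ w (Pi.single j 1) k ∧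
    dW (Sum.inr j) (coordFun (Sum.inl k) ∘ φ) w = 0 ∧
    dW (Sum.inl j) (coordFun (Sum.inr k) ∘ φ) w = 0 ∧
    dW (Sum.inr j) (coordFun (Sum.inr k) ∘ φ) w = conj (fderiv ℂ φ w (Pi.single j 1) k) := by
  have hk : DifferentiableAt ℂ (fun w => φ w k) w := (differentiableAt_pi.1 hφ) k
  have hf : fderiv ℂ (fun w => φ w k) w (Pi.single j 1) = fderiv ℂ φ w (Pi.single j 1) k := by
    rw [fderiv_apply hφ]; rfl
  exact ⟨(dW_of_differentiableAt hk j).1.trans hf, (dW_of_differentiableAt hk j).2,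
    (dW_of_differentiableAt_conj hk j).2,
    (dW_of_differentiableAt_conj hk j).1.trans (congrArg conj hf)⟩

/-- The chain rule. -/
theorem dW_comp {F : (Fin n → ℂ) → ℂ} {φ : (Fin n → ℂ) → (Fin n → ℂ)} {w : Fin n → ℂ}
    (hF : DifferentiableAt ℝ F (φ w)) (hφ : DifferentiableAt ℂ φ w) (j : Idx n) :
    dW j (F ∘ φ) w = ∑ k, dW j (coordFun k ∘ φ) w * dW k F (φ w) := by
  rw [Fintype.sum_sum_type]
  rcases j with j | j
  · simp only [fun k => (dW_coordFun_comp hφ k j).1, fun k => (dW_coordFun_comp hφ k j).2.2.1,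
      zero_mul, Finset.sum_const_zero, add_zero, dW_inl]
    exact (dz_comp hF hφ j).1
  · simp only [fun k => (dW_coordFun_comp hφ k j).2.1, fun k => (dW_coordFun_comp hφ k j).2.2.2,
      zero_mul, Finset.sum_const_zero, zero_add, dW_inr]
    exact (dz_comp hF hφ j).2

end Wirtinger

end KahlerPoisson
end

noncomputable section

namespace KahlerPoisson

/-! ### Smooth functions on a coordinate domain -/

section Domain

variable {n : ℕ} {M : Type*} [TopologicalSpace M] [ChartedSpace (Fin n → ℂ) M]

/-- `V` is an open subset of the domain of the chart `c` of the atlas. -/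
structure ChartDomain (c : OpenPartialHomeomorph M (Fin n → ℂ)) (V : Set M) : Prop where
  mem_atlas : c ∈ atlas (Fin n → ℂ) M
  isOpen : IsOpen V
  subset : V ⊆ c.source

variable (n) in
/-- Smoothness of a complex-valued function on a subset of `M`, as a real manifold. -/
abbrev SmoothOn (f : M → ℂ) (V : Set M) : Prop := ContMDiffOn 𝓘(ℝ, Fin n → ℂ) 𝓘(ℝ, ℂ) ∞ f V

/-- The derivatives of a function on `M` in the chart `c`. -/
def chartDeriv (c : OpenPartialHomeomorph M (Fin n → ℂ)) (i : Idx n) (f : M → ℂ) (x : M) : ℂ :=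
  dW i (f ∘ c.symm) (c x)

variable {c c' : OpenPartialHomeomorph M (Fin n → ℂ)} {V V' : Set M} {f f' : M → ℂ} {x : M}

theorem ChartDomain.mono (h : ChartDomain c V) (hV' : IsOpen V') (hs : V' ⊆ V) :
    ChartDomain c V' := ⟨h.mem_atlas, hV', hs.trans h.subset⟩

theorem ChartDomain.source (hc : c ∈ atlas (Fin n → ℂ) M) : ChartDomain c c.source :=
  ⟨hc, c.open_source, subset_rfl⟩

theorem ChartDomain.isOpen_image (h : ChartDomain c V) : IsOpen (c.target ∩ c.symm ⁻¹' V) :=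
  c.isOpen_inter_preimage_symm h.isOpen

theorem ChartDomain.mem_image (h : ChartDomain c V) (hx : x ∈ V) :
    c x ∈ c.target ∩ c.symm ⁻¹' V :=
  ⟨c.map_source (h.subset hx), by
    rw [Set.mem_preimage, c.left_inv (h.subset hx)]; exact hx⟩

theorem ChartDomain.eventually (h : ChartDomain c V) (hx : x ∈ V) :
    ∀ᶠ y in nhds (c x), c.symm y ∈ V := by
  filter_upwards [h.isOpen_image.mem_nhds (h.mem_image hx)] with y hy using hy.2

theorem chartDeriv_congr (h : ChartDomain c V) (hf : Set.EqOn f f' V) (i : Idx n) (hx : x ∈ V) :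
    chartDeriv c i f x = chartDeriv c i f' x := by
  refine dW_congr ?_ i
  filter_upwards [h.eventually hx] with y hy using hf hy

/-- The extension by zero of a function on `V`. -/
def extendZero {V : Set M} (f : V → ℂ) (x : M) : ℂ :=
  open Classical in if h : x ∈ V then f ⟨x, h⟩ else 0

theorem extendZero_apply (f : V → ℂ) (x : V) : extendZero f (x : M) = f x := by
  simp [extendZero]

theorem extendZero_restrict (f : M → ℂ) : Set.EqOn (extendZero (V.domRestrict f)) f V :=
  fun x hx => extendZero_apply (V.domRestrict f) ⟨x, hx⟩

variable (n) in
/-- The smooth functions on `V`, as a subalgebra of all functions. -/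
def locSubalgebra (V : Set M) : Subalgebra ℂ (V → ℂ) where
  carrier := {f | SmoothOn n (extendZero f) V}
  mul_mem' := fun {f g} hf hg => by
    have h : ContDiff ℝ ∞ (fun p : ℂ × ℂ => p.1 * p.2) := contDiff_mul
    exact (h.contMDiff.comp_contMDiffOn (hf.prodMk_space hg)).congr fun x hx => by
      simp only [Function.comp_apply, extendZero_apply _ (⟨x, hx⟩ : V), Pi.mul_apply]
  add_mem' := fun {f g} hf hg => (ContMDiffOn.add hf hg).congr fun x hx => by
      simp only [Pi.add_apply, extendZero_apply _ (⟨x, hx⟩ : V)]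
  algebraMap_mem' := fun r => (contMDiffOn_const (c := r)).congr fun x hx => by
      simp only [extendZero_apply _ (⟨x, hx⟩ : V), Pi.algebraMap_apply, Algebra.algebraMap_self,
        RingHom.id_apply]

variable (n) in
/-- The algebra of smooth functions on `V`. -/
def LocFun (V : Set M) : Type _ := locSubalgebra n V

namespace LocFun

instance : CommRing (LocFun n V) := inferInstanceAs (CommRing (locSubalgebra n V))

instance : Algebra ℂ (LocFun n V) := inferInstanceAs (Algebra ℂ (locSubalgebra n V))

/-- The restriction to `V` of a function on `M` which is smooth on `V`. -/
def mk (f : M → ℂ) (hf : SmoothOn n f V) : LocFun n V :=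
  ⟨V.domRestrict f, hf.congr (extendZero_restrict f)⟩

theorem mk_apply (f : M → ℂ) (hf : SmoothOn n f V) (x : V) : (mk f hf).1 x = f x := rfl

/-- The function on `M` which is zero outside `V`. -/
def fn (f : LocFun n V) : M → ℂ := extendZero f.1

theorem smoothOn (f : LocFun n V) : SmoothOn n f.fn V := f.2

theorem fn_apply (f : LocFun n V) (x : V) : f.fn x = f.1 x := extendZero_apply _ _

theorem fn_mk (f : M → ℂ) (hf : SmoothOn n f V) : Set.EqOn (mk f hf).fn f V :=
  extendZero_restrict f

theorem ext' {f g : LocFun n V} (h : ∀ x : V, f.1 x = g.1 x) : f = g := Subtype.ext (funext h)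

/-- Evaluation at a point. -/
def ev (x : V) : LocFun n V →+* ℂ :=
  (Pi.evalRingHom (fun _ : V => ℂ) x).comp (locSubalgebra n V).val.toRingHom

theorem ev_apply (x : V) (f : LocFun n V) : ev x f = f.1 x := rfl

/-- Restriction to a smaller set. -/
def res (hV : V' ⊆ V) : LocFun n V →+* LocFun n V' where
  toFun f := mk f.fn (f.smoothOn.mono hV)
  map_one' := ext' fun x => fn_apply 1 ⟨x.1, hV x.2⟩
  map_mul' f g := ext' fun x => by
    change (f * g).fn x = f.fn x * g.fn x
    rw [fn_apply _ ⟨x.1, hV x.2⟩, fn_apply _ ⟨x.1, hV x.2⟩, fn_apply _ ⟨x.1, hV x.2⟩]; rfl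
  map_zero' := ext' fun x => fn_apply 0 ⟨x.1, hV x.2⟩
  map_add' f g := ext' fun x => by
    change (f + g).fn x = f.fn x + g.fn x
    rw [fn_apply _ ⟨x.1, hV x.2⟩, fn_apply _ ⟨x.1, hV x.2⟩, fn_apply _ ⟨x.1, hV x.2⟩]; rfl

theorem ev_res (hV : V' ⊆ V) (x : V') (f : LocFun n V) : ev x (res hV f) = ev ⟨x.1, hV x.2⟩ f :=
  f.fn_apply ⟨x.1, hV x.2⟩

end LocFun

variable [IsManifold 𝓘(ℂ, Fin n → ℂ) ω M]

theorem ChartDomain.contDiffOn (h : ChartDomain c V) (hf : SmoothOn n f V) :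
    ContDiffOn ℝ ∞ (f ∘ c.symm) (c.target ∩ c.symm ⁻¹' V) := by
  have := isManifold_real (n := n) (M := M)
  have h2 : ContMDiffOn 𝓘(ℝ, Fin n → ℂ) 𝓘(ℝ, Fin n → ℂ) ∞ c.symm c.target :=
    contMDiffOn_symm_of_mem_maximalAtlas (IsManifold.subset_maximalAtlas h.mem_atlas)
  exact contMDiffOn_iff_contDiffOn.1 (hf.comp' h2)

theorem ChartDomain.smoothOn_comp (h : ChartDomain c V) {F : (Fin n → ℂ) → ℂ}
    (hF : ContDiffOn ℝ ∞ F (c.target ∩ c.symm ⁻¹' V)) : SmoothOn n (F ∘ c) V := by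
  have := isManifold_real (n := n) (M := M)
  have hcs : ContMDiffOn 𝓘(ℝ, Fin n → ℂ) 𝓘(ℝ, Fin n → ℂ) ∞ c c.source :=
    contMDiffOn_of_mem_maximalAtlas (IsManifold.subset_maximalAtlas h.mem_atlas)
  exact hF.contMDiffOn.comp (hcs.mono h.subset) fun x hx => h.mem_image hx

theorem ChartDomain.contDiffAt (h : ChartDomain c V) (hf : SmoothOn n f V) (hx : x ∈ V) :
    ContDiffAt ℝ ∞ (f ∘ c.symm) (c x) :=
  (h.contDiffOn hf).contDiffAt (h.isOpen_image.mem_nhds (h.mem_image hx))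

theorem ChartDomain.differentiableAt (h : ChartDomain c V) (hf : SmoothOn n f V) (hx : x ∈ V) :
    DifferentiableAt ℝ (f ∘ c.symm) (c x) := (h.contDiffAt hf hx).differentiableAt (by simp)

theorem chartDeriv_add (h : ChartDomain c V) (hf : SmoothOn n f V) (hf' : SmoothOn n f' V)
    (i : Idx n) (hx : x ∈ V) :
    chartDeriv c i (fun x => f x + f' x) x = chartDeriv c i f x + chartDeriv c i f' x :=
  dW_add (h.differentiableAt hf hx) (h.differentiableAt hf' hx) i

theorem chartDeriv_mul (h : ChartDomain c V) (hf : SmoothOn n f V) (hf' : SmoothOn n f' V)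
    (i : Idx n) (hx : x ∈ V) :
    chartDeriv c i (fun x => f x * f' x) x =
      f x * chartDeriv c i f' x + f' x * chartDeriv c i f x := by
  have := dW_mul (h.differentiableAt hf hx) (h.differentiableAt hf' hx) i
  simp only [Function.comp_apply, c.left_inv (h.subset hx)] at this
  exact this

theorem smoothOn_chartDeriv (h : ChartDomain c V) (hf : SmoothOn n f V) (i : Idx n) :
    SmoothOn n (chartDeriv c i f) V :=
  h.smoothOn_comp (contDiffOn_dW h.isOpen_image (h.contDiffOn hf) i)

theorem chartDeriv_comm (h : ChartDomain c V) (hf : SmoothOn n f V) (i j : Idx n) (hx : x ∈ V) :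
    chartDeriv c i (chartDeriv c j f) x = chartDeriv c j (chartDeriv c i f) x := by
  have key : ∀ i j, chartDeriv c i (chartDeriv c j f) x = dW i (dW j (f ∘ c.symm)) (c x) := by
    intro i j
    refine dW_congr ?_ i
    filter_upwards [h.isOpen_image.mem_nhds (h.mem_image hx)] with y hy
    simp only [Function.comp_apply, chartDeriv, c.right_inv hy.1]
  rw [key, key, dW_comm (h.contDiffAt hf hx)]

theorem smoothOn_coordFun (h : ChartDomain c V) (i : Idx n) : SmoothOn n (coordFun i ∘ c) V :=
  h.smoothOn_comp (contDiff_coordFun i).contDiffOn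

theorem chartDeriv_coordFun (h : ChartDomain c V) (i j : Idx n) (hx : x ∈ V) :
    chartDeriv c i (coordFun j ∘ c) x = if i = j then 1 else 0 := by
  rw [← dW_coordFun i j (c x)]
  refine dW_congr ?_ i
  filter_upwards [h.isOpen_image.mem_nhds (h.mem_image hx)] with y hy
  simp only [Function.comp_apply, c.right_inv hy.1]

/-- The Jacobian matrix of the change from the coordinates of `c'` to those of `c`. -/
def chartJac (c c' : OpenPartialHomeomorph M (Fin n → ℂ)) (x : M) (k j : Idx n) : ℂ :=
  chartDeriv c' j (coordFun k ∘ c) x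

theorem differentiableAt_transition (hc : c ∈ atlas (Fin n → ℂ) M)
    (hc' : c' ∈ atlas (Fin n → ℂ) M) (hx : x ∈ c.source) (hx' : x ∈ c'.source) :
    DifferentiableAt ℂ (c ∘ c'.symm) (c' x) := by
  have hmem : c' x ∈ (c'.symm.trans c).source := by
    simp [c'.map_source hx', c'.left_inv hx', hx]
  exact ((contDiffOn_transition hc hc').contDiffAt
    ((c'.symm.trans c).open_source.mem_nhds hmem)).differentiableAt (by simp)

theorem chartJac_eq_zero (hc : c ∈ atlas (Fin n → ℂ) M) (hc' : c' ∈ atlas (Fin n → ℂ) M)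
    (hx : x ∈ c.source) (hx' : x ∈ c'.source) {k j : Idx n} (h : holType n k ≠ holType n j) :
    chartJac c c' x k j = 0 := by
  have hφ := differentiableAt_transition hc hc' hx hx'
  rcases k with k | k <;> rcases j with j | j
  · simp at h
  · exact (dW_coordFun_comp hφ k j).2.1
  · exact (dW_coordFun_comp hφ k j).2.2.1
  · simp at h

/-- The chain rule for a change of charts. -/
theorem chartDeriv_eq_sum (h : ChartDomain c V) (h' : ChartDomain c' V) (hf : SmoothOn n f V)
    (j : Idx n) (hx : x ∈ V) :
    chartDeriv c' j f x = ∑ k, chartJac c c' x k j * chartDeriv c k f x := by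
  have hφ := differentiableAt_transition h.mem_atlas h'.mem_atlas (h.subset hx) (h'.subset hx)
  have hφx : (c ∘ c'.symm) (c' x) = c x := by simp [c'.left_inv (h'.subset hx)]
  have hF := h.differentiableAt hf hx
  rw [← hφx] at hF
  have e := dW_comp hF hφ j
  rw [hφx] at e
  refine (dW_congr ?_ j).trans e
  filter_upwards [h'.eventually hx] with y hy
  simp only [Function.comp_apply, c.left_inv (h.subset hy)]

/-- The coordinates of a chart. -/
def chartCoords (h : ChartDomain c V) : Coords (Idx n) (LocFun n V) where
  d i := Derivation.mk'
    { toFun := fun f => LocFun.mk (chartDeriv c i f.fn) (smoothOn_chartDeriv h f.smoothOn i)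
      map_add' := fun f g => LocFun.ext' fun x => by
        refine Eq.trans ?_ (chartDeriv_add h f.smoothOn g.smoothOn i x.2)
        exact chartDeriv_congr h (fun y hy => (LocFun.fn_apply (f + g) ⟨y, hy⟩).trans (by
          rw [LocFun.fn_apply f ⟨y, hy⟩, LocFun.fn_apply g ⟨y, hy⟩]; rfl)) i x.2
      map_smul' := fun r f => LocFun.ext' fun x => by
        refine Eq.trans ?_ ((chartDeriv_mul h (contMDiffOn_const (c := r)) f.smoothOn i x.2).trans
          ?_)
        · exact chartDeriv_congr h (fun y hy => (LocFun.fn_apply (r • f) ⟨y, hy⟩).trans (by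
            rw [LocFun.fn_apply f ⟨y, hy⟩]; rfl)) i x.2
        · rw [show chartDeriv c i (fun _ => r) x = 0 from dW_const r i _, mul_zero, add_zero]
          rfl }
    (fun f g => LocFun.ext' fun x => by
      refine Eq.trans ?_ ((chartDeriv_mul h f.smoothOn g.smoothOn i x.2).trans ?_)
      · exact chartDeriv_congr h (fun y hy => (LocFun.fn_apply (f * g) ⟨y, hy⟩).trans (by
          rw [LocFun.fn_apply f ⟨y, hy⟩, LocFun.fn_apply g ⟨y, hy⟩]; rfl)) i x.2
      · rw [LocFun.fn_apply, LocFun.fn_apply]; rfl)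
  x i := LocFun.mk (coordFun i ∘ c) (smoothOn_coordFun h i)
  comm i j f := LocFun.ext' fun x => by
    have e : ∀ i j, chartDeriv c i (LocFun.mk (chartDeriv c j f.fn)
        (smoothOn_chartDeriv h f.smoothOn j)).fn x = chartDeriv c i (chartDeriv c j f.fn) x :=
      fun i j => chartDeriv_congr h (LocFun.fn_mk _ _) i x.2
    exact (e i j).trans ((chartDeriv_comm h f.smoothOn i j x.2).trans (e j i).symm)
  d_x i j := LocFun.ext' fun x => by
    refine (chartDeriv_congr h (LocFun.fn_mk _ _) i x.2).trans
      ((chartDeriv_coordFun h i j x.2).trans ?_)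
    split_ifs <;> rfl

theorem chartCoords_d_apply (h : ChartDomain c V) (i : Idx n) (f : LocFun n V) (x : V) :
    ((chartCoords h).d i f).1 x = chartDeriv c i f.fn x := rfl

theorem chartCoords_d_mk (h : ChartDomain c V) (i : Idx n) (hf : SmoothOn n f V) (x : V) :
    ((chartCoords h).d i (LocFun.mk f hf)).1 x = chartDeriv c i f x :=
  chartDeriv_congr h (LocFun.fn_mk _ _) i x.2

theorem chartCoords_jac_apply (h : ChartDomain c V) (h' : ChartDomain c' V) (k j : Idx n) (x : V) :
    ((chartCoords h).jac (chartCoords h') k j).1 x = chartJac c c' x k j :=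
  chartCoords_d_mk h' j (smoothOn_coordFun h k) x

/-- Transition maps are holomorphic: the chain rule gives the compatibility, and the Cauchy–Riemann
equations kill the mixed blocks of the Jacobian. -/
theorem typeCompatible_chartCoords (h : ChartDomain c V) (h' : ChartDomain c' V) :
    (chartCoords h).TypeCompatible (chartCoords h') (holType n) := by
  refine ⟨fun j f => LocFun.ext' fun x => ?_, fun i j hij => LocFun.ext' fun x => ?_⟩
  · rw [chartCoords_d_apply, chartDeriv_eq_sum h h' f.smoothOn j x.2, ← LocFun.ev_apply, map_sum]
    refine Finset.sum_congr rfl fun k _ => ?_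
    rw [map_mul, LocFun.ev_apply, chartCoords_jac_apply, LocFun.ev_apply, chartCoords_d_apply]
  · rw [chartCoords_jac_apply]
    exact chartJac_eq_zero h.mem_atlas h'.mem_atlas (h.subset x.2) (h'.subset x.2) hij

theorem chartCoords_d_res (h : ChartDomain c V) (h' : ChartDomain c V') (hV : V' ⊆ V) (i : Idx n)
    (f : LocFun n V) :
    (chartCoords h').d i (LocFun.res hV f) = LocFun.res hV ((chartCoords h).d i f) :=
  LocFun.ext' fun x => by
    refine (chartCoords_d_mk h' i (f.smoothOn.mono hV) x).trans ?_
    exact (LocFun.ev_res hV x ((chartCoords h).d i f)).symm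

end Domain

end KahlerPoisson
end

noncomputable section

namespace KahlerPoisson

open MvPowerSeries

/-! ### Composition of linear substitutions and change of the coefficient ring. -/

section LinSubst

variable {σ A B : Type*} [CommRing A] [Algebra ℂ A] [CommRing B] [Algebra ℂ B] [DecidableEq σ]
  [Fintype σ]

theorem map_linSubst (f : A →+* B) (J : σ → σ → A) (P : MvPowerSeries σ A) :
    MvPowerSeries.map f (linSubst J P) =
      linSubst (fun k j => f (J k j)) (MvPowerSeries.map f P) := by
  rw [linSubst_apply, linSubst_apply, map_subst (hasSubst_linForm _)]
  congr 1
  ext1 i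
  simp only [linForm, map_sum, map_mul, map_C, map_X]

theorem linSubst_linSubst (J J' : σ → σ → A) (P : MvPowerSeries σ A) :
    linSubst J (linSubst J' P) = linSubst (fun i j => ∑ k, J i k * J' k j) P := by
  rw [linSubst_apply J, linSubst_apply, linSubst_apply,
    subst_comp_subst_apply (hasSubst_linForm J') (hasSubst_linForm J)]
  congr 1
  ext1 j
  rw [← linSubst_apply, linForm, linForm, map_sum]
  simp only [map_mul, linSubst_C, linSubst_X, linForm, map_sum, Finset.mul_sum, Finset.sum_mul]
  rw [Finset.sum_comm]
  refine Finset.sum_congr rfl fun i _ => Finset.sum_congr rfl fun k _ => by ring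

theorem linSubst_delta (P : MvPowerSeries σ A) :
    linSubst (fun i j => if j = i then (1 : A) else 0) P = P := by
  rw [linSubst_apply]
  have : linForm (fun i j => if j = i then (1 : A) else 0) = (X : σ → MvPowerSeries σ A) := by
    ext1 j
    rw [linForm, Finset.sum_eq_single j] <;> simp +contextual [eq_comm]
  rw [this]
  exact congrFun subst_self P

theorem map_dxi (f : A →+* B) (i : σ) (P : MvPowerSeries σ A) :
    MvPowerSeries.map f (dxi i P) = dxi i (MvPowerSeries.map f P) := by
  ext m; simp [coeff_dxi]

theorem map_mem_fil (f : A →+* B) {N : ℕ} {P : MvPowerSeries σ A} (hP : P ∈ fil σ A N) :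
    MvPowerSeries.map f P ∈ fil σ B N := fun m hm => by rw [coeff_map, hP m hm, map_zero]

theorem Coords.map_br {c : Coords σ A} {c' : Coords σ B} (f : A →+* B)
    (h : ∀ i a, c'.d i (f a) = f (c.d i a)) (P Q : MvPowerSeries σ A) :
    MvPowerSeries.map f (c.br P Q) = c'.br (MvPowerSeries.map f P) (MvPowerSeries.map f Q) := by
  have hdx : ∀ i (P : MvPowerSeries σ A),
      MvPowerSeries.map f (c.dx i P) = c'.dx i (MvPowerSeries.map f P) := fun i P => by
    ext m; simp [dx, h]
  simp only [br_def, map_sum, map_sub, map_mul, map_dxi, hdx]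

end LinSubst

/-! ### Formal functions in a chart -/

section Rep

variable {n : ℕ} {M : Type*} [TopologicalSpace M] [ChartedSpace (Fin n → ℂ) M]
  [IsManifold 𝓘(ℂ, Fin n → ℂ) ω M]
  {c c' c'' : OpenPartialHomeomorph M (Fin n → ℂ)} {V V' : Set M} {x : M}

theorem chartJac_self (hc : c ∈ atlas (Fin n → ℂ) M) (hx : x ∈ c.source) :
    chartJac c c x = fun i j => if j = i then 1 else 0 := by
  ext i j
  exact chartDeriv_coordFun (ChartDomain.source hc) j i hx

theorem chartJac_trans (hc : c ∈ atlas (Fin n → ℂ) M) (hc' : c' ∈ atlas (Fin n → ℂ) M)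
    (hc'' : c'' ∈ atlas (Fin n → ℂ) M) (hx : x ∈ c.source) (hx' : x ∈ c'.source)
    (hx'' : x ∈ c''.source) :
    chartJac c c'' x = fun i j => ∑ k, chartJac c c' x i k * chartJac c' c'' x k j := by
  ext i j
  have hV : IsOpen (c.source ∩ (c'.source ∩ c''.source)) :=
    c.open_source.inter (c'.open_source.inter c''.open_source)
  have h := (ChartDomain.source hc).mono hV Set.inter_subset_left
  have h' := (ChartDomain.source hc').mono hV (Set.inter_subset_right.trans Set.inter_subset_left)
  have h'' := (ChartDomain.source hc'').mono hV
    (Set.inter_subset_right.trans Set.inter_subset_right)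
  rw [chartJac, chartDeriv_eq_sum h' h'' (smoothOn_coordFun h i) j ⟨hx, hx', hx''⟩]
  exact Finset.sum_congr rfl fun k _ => mul_comm _ _

/-- The value at `x` of a formal function, in the fibre coordinates given by the chart `c`. -/
def chartValue (c : OpenPartialHomeomorph M (Fin n → ℂ)) (Φ : FormalFun n M) (x : M) :
    FiberSeries n :=
  linSubst (chartJac c (chartAt (Fin n → ℂ) x) x) (Φ x)

/-- The holomorphic and conjugate blocks used in `FormalFun.coord` are the diagonal blocks of the
full Jacobian `chartJac`, and its off-diagonal blocks vanish. -/
theorem coord_eq_chartValue (hc : c ∈ atlas (Fin n → ℂ) M) (Φ : FormalFun n M) {y : Fin n → ℂ}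
    (hy : y ∈ c.target) : FormalFun.coord Φ c y = chartValue c Φ (c.symm y) := by
  have hφ := differentiableAt_transition hc (chart_mem_atlas (Fin n → ℂ) (c.symm y))
    (c.map_target hy) (mem_chart_source _ _)
  rw [chartValue, linSubst_apply, FormalFun.coord]
  congr 1
  ext1 j
  rw [linForm, Fintype.sum_sum_type]
  have hC : ∀ (r : ℂ) (P : FiberSeries n), C r * P = r • P := fun r P =>
    (MvPowerSeries.smul_eq_C_mul P r).symm
  rcases j with j | j
  · simp only [Sum.elim_inl, hC, chartJac]
    have e1 : ∀ k : Fin n, chartDeriv (chartAt (Fin n → ℂ) (c.symm y)) (Sum.inl j)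
        (coordFun (Sum.inl k) ∘ c) (c.symm y) = jacobian c (c.symm y) k j :=
      fun k => (dW_coordFun_comp hφ k j).1
    have e2 : ∀ k : Fin n, chartDeriv (chartAt (Fin n → ℂ) (c.symm y)) (Sum.inl j)
        (coordFun (Sum.inr k) ∘ c) (c.symm y) = 0 := fun k => (dW_coordFun_comp hφ k j).2.2.1
    simp only [e1, e2, zero_smul, Finset.sum_const_zero, add_zero]
  · simp only [Sum.elim_inr, hC, chartJac]
    have e1 : ∀ k : Fin n, chartDeriv (chartAt (Fin n → ℂ) (c.symm y)) (Sum.inr j)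
        (coordFun (Sum.inr k) ∘ c) (c.symm y) = conj (jacobian c (c.symm y) k j) :=
      fun k => (dW_coordFun_comp hφ k j).2.2.2
    have e2 : ∀ k : Fin n, chartDeriv (chartAt (Fin n → ℂ) (c.symm y)) (Sum.inr j)
        (coordFun (Sum.inl k) ∘ c) (c.symm y) = 0 := fun k => (dW_coordFun_comp hφ k j).2.1
    simp only [e1, e2, zero_smul, Finset.sum_const_zero, zero_add]

theorem chartValue_chartAt (Φ : FormalFun n M) (x : M) :
    chartValue (chartAt (Fin n → ℂ) x) Φ x = Φ x := by
  rw [chartValue, chartJac_self (chart_mem_atlas _ x) (mem_chart_source _ x), linSubst_delta]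

theorem chartValue_trans (hc : c ∈ atlas (Fin n → ℂ) M) (hc' : c' ∈ atlas (Fin n → ℂ) M)
    (hx : x ∈ c.source) (hx' : x ∈ c'.source) (Φ : FormalFun n M) :
    chartValue c Φ x = linSubst (chartJac c c' x) (chartValue c' Φ x) := by
  rw [chartValue, chartValue, linSubst_linSubst,
    chartJac_trans hc hc' (chart_mem_atlas _ x) hx hx' (mem_chart_source _ x)]

theorem eq_linSubst_chartValue (hc : c ∈ atlas (Fin n → ℂ) M) (hx : x ∈ c.source)
    (Φ : FormalFun n M) :
    Φ x = linSubst (chartJac (chartAt (Fin n → ℂ) x) c x) (chartValue c Φ x) := by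
  rw [← chartValue_trans (chart_mem_atlas _ x) hc (mem_chart_source _ x) hx, chartValue_chartAt]

theorem chartValue_eq_of_eq_linSubst (hc : c ∈ atlas (Fin n → ℂ) M) (hx : x ∈ c.source)
    {Φ : FormalFun n M} {P : FiberSeries n}
    (h : Φ x = linSubst (chartJac (chartAt (Fin n → ℂ) x) c x) P) : chartValue c Φ x = P := by
  rw [chartValue, h, linSubst_linSubst,
    ← chartJac_trans hc (chart_mem_atlas _ x) hc hx (mem_chart_source _ x) hx,
    chartJac_self hc hx, linSubst_delta]

/-- On `V`, the formal function `Φ` is given in the chart `c` by the power series `P`. -/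
def Rep (c : OpenPartialHomeomorph M (Fin n → ℂ)) (V : Set M) (Φ : FormalFun n M)
    (P : MvPowerSeries (Idx n) (LocFun n V)) : Prop :=
  ∀ x : V, chartValue c Φ x = MvPowerSeries.map (LocFun.ev x) P

variable {Φ Ψ : FormalFun n M} {P Q : MvPowerSeries (Idx n) (LocFun n V)}

theorem locSeries_ext (h : ∀ x : V, MvPowerSeries.map (LocFun.ev x) P =
    MvPowerSeries.map (LocFun.ev x) Q) : P = Q := by
  ext m
  refine LocFun.ext' fun x => ?_
  have e := congrArg (coeff m) (h x)
  rwa [coeff_map, coeff_map] at e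

theorem Rep.unique (hP : Rep c V Φ P) (hQ : Rep c V Φ Q) : P = Q :=
  locSeries_ext fun x => (hP x).symm.trans (hQ x)

theorem Rep.eqOn (h : ChartDomain c V) (hP : Rep c V Φ P) (hQ : Rep c V Ψ P) : Set.EqOn Φ Ψ V :=
  fun x hx => by
    rw [eq_linSubst_chartValue h.mem_atlas (h.subset hx) Φ, hP ⟨x, hx⟩, ← hQ ⟨x, hx⟩,
      ← eq_linSubst_chartValue h.mem_atlas (h.subset hx) Ψ]

theorem Rep.congr (hP : Rep c V Φ P) (h : Set.EqOn Φ Ψ V) : Rep c V Ψ P := fun x => by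
  rw [← hP x, chartValue, chartValue, h x.2]

theorem Rep.zero : Rep c V 0 0 := fun x => by rw [chartValue, Pi.zero_apply, map_zero, map_zero]

theorem Rep.add (hP : Rep c V Φ P) (hQ : Rep c V Ψ Q) : Rep c V (Φ + Ψ) (P + Q) := fun x => by
  rw [map_add, ← hP x, ← hQ x, chartValue, chartValue, chartValue, Pi.add_apply, map_add]

theorem Rep.neg (hP : Rep c V Φ P) : Rep c V (-Φ) (-P) := fun x => by
  rw [map_neg, ← hP x, chartValue, chartValue, Pi.neg_apply, map_neg]

theorem Rep.mul (hP : Rep c V Φ P) (hQ : Rep c V Ψ Q) : Rep c V (Φ * Ψ) (P * Q) := fun x => by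
  rw [map_mul, ← hP x, ← hQ x, chartValue, chartValue, chartValue, Pi.mul_apply, map_mul]

theorem Rep.ofFun {f : M → ℂ} (hf : SmoothOn n f V) :
    Rep c V (FormalFun.ofFun f) (C (LocFun.mk f hf)) := fun x => by
  rw [chartValue, FormalFun.ofFun, linSubst_C, map_C]; rfl

theorem Rep.res (hP : Rep c V Φ P) (hV : V' ⊆ V) :
    Rep c V' Φ (MvPowerSeries.map (LocFun.res hV) P) := fun x => by
  refine (hP ⟨x.1, hV x.2⟩).trans ?_
  ext m
  simp only [coeff_map, LocFun.ev_res]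

theorem Rep.trans (h : ChartDomain c V) (h' : ChartDomain c' V) (hP : Rep c V Φ P) :
    Rep c' V Φ ((chartCoords h').trans (chartCoords h) P) := fun x => by
  rw [chartValue_trans h'.mem_atlas h.mem_atlas (h'.subset x.2) (h.subset x.2), hP x, Coords.trans,
    map_linSubst]
  congr 2
  ext k j
  exact (chartCoords_jac_apply h' h k j x).symm

theorem Rep.coeff_coord (h : ChartDomain c V) (hP : Rep c V Φ P) (m : Idx n →₀ ℕ) {y : Fin n → ℂ}
    (hy : y ∈ c.target) (hy' : c.symm y ∈ V) :
    coeff m (FormalFun.coord Φ c y) = (coeff m P).fn (c.symm y) := by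
  rw [coord_eq_chartValue h.mem_atlas Φ hy, hP ⟨_, hy'⟩, coeff_map,
    LocFun.fn_apply _ ⟨c.symm y, hy'⟩]
  rfl

/-- Links the pointwise bracket of the definitions with the algebraic one. Derivatives at a point
see only a neighbourhood, and there `P` and `Q` represent the functions because `V` is open. -/
theorem Rep.localBracket (h : ChartDomain c V) (hP : Rep c V Φ P) (hQ : Rep c V Ψ Q) (x : V) :
    localBracket (FormalFun.coord Φ c) (FormalFun.coord Ψ c) (c x) =
      MvPowerSeries.map (LocFun.ev x) ((chartCoords h).br P Q) := by
  have hcx : c x ∈ c.target := c.map_source (h.subset x.2)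
  have hval : ∀ {Φ P}, Rep c V Φ P → FormalFun.coord Φ c (c x) =
      MvPowerSeries.map (LocFun.ev x) P := fun {Φ P} hP => by
    rw [coord_eq_chartValue h.mem_atlas Φ hcx, c.left_inv (h.subset x.2), hP x]
  have hd : ∀ {Φ P}, Rep c V Φ P → ∀ (m : Idx n →₀ ℕ) (i : Idx n),
      dW i (fun y => coeff m (FormalFun.coord Φ c y)) (c x) =
        coeff m (MvPowerSeries.map (LocFun.ev x) ((chartCoords h).dx i P)) := by
    intro Φ P hP m i
    rw [coeff_map, Coords.dx, coeff_coeffDer, LocFun.ev_apply, chartCoords_d_apply]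
    refine dW_congr ?_ i
    filter_upwards [h.isOpen_image.mem_nhds (h.mem_image x.2)] with y hy
    exact hP.coeff_coord h m hy.1 hy.2
  have hdz : ∀ {Φ P}, Rep c V Φ P → ∀ k, dzSeries k (FormalFun.coord Φ c) (c x) =
      MvPowerSeries.map (LocFun.ev x) ((chartCoords h).dx (Sum.inl k) P) := by
    intro Φ P hP k
    ext m
    rw [← hd hP, dW_inl]; rfl
  have hdzb : ∀ {Φ P}, Rep c V Φ P → ∀ k, dzbarSeries k (FormalFun.coord Φ c) (c x) =
      MvPowerSeries.map (LocFun.ev x) ((chartCoords h).dx (Sum.inr k) P) := by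
    intro Φ P hP k
    ext m
    rw [← hd hP, dW_inr]; rfl
  rw [KahlerPoisson.localBracket, Coords.br_def, map_sum, Fintype.sum_sum_type,
    ← Finset.sum_add_distrib]
  refine Finset.sum_congr rfl fun k _ => ?_
  rw [hval hP, hval hQ, hdz hP, hdz hQ, hdzb hP, hdzb hQ, ← dxi_apply, ← dxi_apply, ← dxi_apply,
    ← dxi_apply]
  simp only [map_sub, map_mul, map_dxi]
  ring

/-- The canonical bracket may be computed in any chart. -/
theorem Rep.bracket (h : ChartDomain c V) (hP : Rep c V Φ P) (hQ : Rep c V Ψ Q) :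
    Rep c V (FormalFun.bracket Φ Ψ) ((chartCoords h).br P Q) := fun x => by
  set c' := chartAt (Fin n → ℂ) x.1 with hc'
  have hc'a : c' ∈ atlas (Fin n → ℂ) M := chart_mem_atlas _ _
  have hV : IsOpen (V ∩ c'.source) := h.isOpen.inter c'.open_source
  have h1 := h.mono hV Set.inter_subset_left
  have h2 := (ChartDomain.source hc'a).mono hV Set.inter_subset_right
  have hx : x.1 ∈ V ∩ c'.source := ⟨x.2, mem_chart_source _ _⟩
  -- The bracket at `x` is defined in the preferred chart of `x`. The series are restricted to the
  -- overlap and transported to that chart, and invariance of the bracket brings the result back.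
  refine chartValue_eq_of_eq_linSubst h.mem_atlas (h.subset x.2) ?_
  have e := ((hP.res Set.inter_subset_left).trans h1 h2).localBracket h2
    ((hQ.res Set.inter_subset_left).trans h1 h2) ⟨x.1, hx⟩
  refine e.trans ?_
  rw [← (typeCompatible_chartCoords h2 h1).compatible.trans_br,
    ← Coords.map_br (c := chartCoords h) _ (chartCoords_d_res h h1 _), Coords.trans, map_linSubst]
  refine congrArg₂ (fun J (R : FiberSeries n) => linSubst J R)
    (funext₂ fun k j => chartCoords_jac_apply h2 h1 k j ⟨x.1, hx⟩) ?_
  · ext m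
    simp only [coeff_map, LocFun.ev_res]

/-- `expSum` truncates according to the degree in the preferred fibre coordinates. Linear changes of
the fibre variables preserve the filtration by order, so the cut-off is harmless in every chart. -/
theorem Rep.expSum (h : ChartDomain c V) {u : ℕ → FormalFun n M}
    {U : ℕ → MvPowerSeries (Idx n) (LocFun n V)} (hu : ∀ k, Rep c V (u k) (U k))
    (hP : ∀ N, P - ∑ k ∈ Finset.range N, ((k.factorial : ℂ))⁻¹ • U k ∈ fil _ _ N) :
    Rep c V (FormalFun.expSum u) P := fun x => by
  refine chartValue_eq_of_eq_linSubst h.mem_atlas (h.subset x.2) ?_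
  ext m
  have hsmul : ∀ (r : ℂ) (R : MvPowerSeries (Idx n) (LocFun n V)),
      MvPowerSeries.map (LocFun.ev x) (r • R) = r • MvPowerSeries.map (LocFun.ev x) R := by
    intro r R
    ext m
    rw [coeff_map, coeff_smul_complex, coeff_smul_complex, coeff_map]
    rfl
  have e := linSubst_mem_fil (chartJac (chartAt (Fin n → ℂ) x.1) c x)
    (map_mem_fil (LocFun.ev x) (hP (m.degree + 1))) m (Nat.lt_succ_self _)
  rw [map_sub, map_sub, map_sub, sub_eq_zero] at e
  rw [e, map_sum, map_sum, map_sum]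
  change ∑ k ∈ Finset.range (m.degree + 1), ((k.factorial : ℂ))⁻¹ * coeff m (u k x.1) = _
  refine Finset.sum_congr rfl fun k _ => ?_
  rw [hsmul, linSubst_smul, coeff_smul_complex, ← hu k x,
    ← eq_linSubst_chartValue h.mem_atlas (h.subset x.2), smul_eq_mul]

theorem Rep.isSmooth (hΦ : ∀ c ∈ atlas (Fin n → ℂ) M, ∃ P, Rep c c.source Φ P) :
    FormalFun.IsSmooth Φ := fun c hc m => by
  obtain ⟨P, hP⟩ := hΦ c hc
  have h := ChartDomain.source hc
  refine (h.contDiffOn (coeff m P).smoothOn).congr_mono (fun y hy => ?_) (fun y hy => ?_)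
  · exact hP.coeff_coord h m hy (c.map_target hy)
  · exact ⟨hy, c.map_target hy⟩

theorem FormalFun.IsSmooth.exists_rep (hΦ : FormalFun.IsSmooth Φ) (h : ChartDomain c V) :
    ∃ P, Rep c V Φ P := by
  refine ⟨mkSeries fun m => LocFun.mk ((fun y => coeff m (FormalFun.coord Φ c y)) ∘ c)
    (h.smoothOn_comp ((hΦ c h.mem_atlas m).mono Set.inter_subset_left)), fun x => ?_⟩
  ext m
  rw [coeff_map, coeff_mkSeries, LocFun.ev_apply, LocFun.mk_apply, Function.comp_apply,
    coord_eq_chartValue h.mem_atlas Φ (c.map_source (h.subset x.2)), c.left_inv (h.subset x.2)]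

end Rep

end KahlerPoisson
end

noncomputable section

namespace KahlerPoisson

open MvPowerSeries TrivSqZeroExt

/-! ### Change of the coefficient algebra -/

section Map

variable {σ A B : Type*} [CommRing A] [Algebra ℂ A] [CommRing B] [Algebra ℂ B] [DecidableEq σ]
  [Fintype σ]

/-- The extension of a homomorphism to dual numbers. -/
def dualMap (f : A →ₐ[ℂ] B) : A[ε] →ₐ[ℂ] B[ε] where
  toFun a := inl (f a.fst) + inr (f a.snd)
  map_one' := by ext <;> simp
  map_mul' a b := by ext <;> simp
  map_zero' := by ext <;> simp
  map_add' a b := by ext <;> simp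
  commutes' r := by
    rw [TrivSqZeroExt.algebraMap_eq_inl', TrivSqZeroExt.algebraMap_eq_inl']
    ext <;> simp

@[simp]
theorem fst_dualMap (f : A →ₐ[ℂ] B) (a : A[ε]) : (dualMap f a).fst = f a.fst := by
  change (inl (f a.fst) + inr (f a.snd) : B[ε]).fst = _
  simp

@[simp]
theorem snd_dualMap (f : A →ₐ[ℂ] B) (a : A[ε]) : (dualMap f a).snd = f a.snd := by
  change (inl (f a.fst) + inr (f a.snd) : B[ε]).snd = _
  simp

/-- A homomorphism of algebras applied to the coefficients of a power series. -/
def mapLin (f : A →ₐ[ℂ] B) : MvPowerSeries σ A →ₗ[ℂ] MvPowerSeries σ B where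
  toFun P := MvPowerSeries.map f.toRingHom P
  map_add' P Q := map_add _ P Q
  map_smul' r P := by
    ext m
    rw [coeff_map, coeff_smul_complex, RingHom.id_apply, coeff_smul_complex, coeff_map]
    exact map_smul f r _

theorem hess_map (f : A →+* B) (P : MvPowerSeries σ A) (i j : σ) :
    hess (MvPowerSeries.map f P) i j = f (hess P i j) := by
  rw [hess, ← map_dxi, ← map_dxi, hess, constantCoeff_map]

theorem sfst_map_dualMap (f : A →ₐ[ℂ] B) (P : MvPowerSeries σ A[ε]) :
    sfst (MvPowerSeries.map (dualMap f).toRingHom P) = MvPowerSeries.map f.toRingHom (sfst P) := by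
  ext m
  rw [coeff_sfst, coeff_map, coeff_map, coeff_sfst]
  exact fst_dualMap f _

theorem ssnd_map_dualMap (f : A →ₐ[ℂ] B) (P : MvPowerSeries σ A[ε]) :
    ssnd (MvPowerSeries.map (dualMap f).toRingHom P) = MvPowerSeries.map f.toRingHom (ssnd P) := by
  ext m
  rw [coeff_ssnd, coeff_map, coeff_map, coeff_ssnd]
  exact snd_dualMap f _

namespace Coords

variable {c : Coords σ A} {c' : Coords σ B} {typ : σ → Bool} {P : MvPowerSeries σ A}

variable (c c') in
/-- A homomorphism of algebras which respects the coordinates and the derivations. -/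
structure IsMorphism (f : A →ₐ[ℂ] B) : Prop where
  map_d : ∀ i a, c'.d i (f a) = f (c.d i a)
  map_x : ∀ i, c'.x i = f (c.x i)

theorem IsMorphism.dualMap {f : A →ₐ[ℂ] B} (hf : IsMorphism c c' f) :
    IsMorphism c.eps c'.eps (dualMap f) where
  map_d i a := by ext <;> simp [eps_d, hf.map_d]
  map_x i := by ext <;> simp [eps_x, hf.map_x]

theorem IsMorphism.map_flow {f : A →ₐ[ℂ] B} (hf : IsMorphism c c' f)
    (hP : P ∈ fil σ A 2) (Q : MvPowerSeries σ A) :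
    MvPowerSeries.map f.toRingHom (c.flow P Q) =
      c'.flow (MvPowerSeries.map f.toRingHom P) (MvPowerSeries.map f.toRingHom Q) :=
  expSeries_natural (c.raises_hamLin hP) (c'.raises_hamLin (map_mem_fil _ hP)) (mapLin f)
    (fun _ _ h => map_mem_fil _ h) (fun Q => map_br (c := c) f.toRingHom hf.map_d P Q) Q

theorem IsMorphism.isK {f : A →ₐ[ℂ] B} (hf : IsMorphism c c' f) (hP : c.IsK typ P) :
    c'.IsK typ (MvPowerSeries.map f.toRingHom P) := by
  refine ⟨map_mem_fil _ hP.1, fun i j hij => ?_⟩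
  have e := hf.map_flow hP.1 (C (c.x i))
  rw [map_C] at e
  rw [hf.map_x, show f (c.x i) = f.toRingHom (c.x i) from rfl, ← e, ← map_dxi, hP.2 i j hij,
    map_zero]

theorem IsMorphism.map_src {f : A →ₐ[ℂ] B} (hf : IsMorphism c c' f) {g : σ → σ → A}
    {g' : σ → σ → B} (hg : c.IsKP typ g) (hg' : c'.IsKP typ g') (h : ∀ i j, g' i j = f (g i j))
    (t : Bool) (u : A) :
    MvPowerSeries.map f.toRingHom (c.src typ g t u) = c'.src typ g' t (f u) := by
  refine hg'.src_unique t (fun u => f u) (fun u => MvPowerSeries.map f.toRingHom (c.src typ g t u))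
    (fun u => ?_) (fun i u => c.vf typ g t i u) (fun i u => ?_) (fun i u => ?_) u
  · rw [constantCoeff_map, constantCoeff_src]; rfl
  · rw [← map_dxi, hg.dxi_src]
  · by_cases hi : typ i = t
    · rw [vf_apply c typ g t hi, vf_apply c' typ g' t hi, map_sum]
      exact Finset.sum_congr rfl fun j _ => by rw [map_mul, h, hf.map_d]
    · rw [vf_eq_zero c typ g t hi, vf_eq_zero c' typ g' t hi, map_zero]

end Coords

end Map

section Rep

variable {n : ℕ} {M : Type*} [TopologicalSpace M] [ChartedSpace (Fin n → ℂ) M]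
  {c c' c'' : OpenPartialHomeomorph M (Fin n → ℂ)} {V V' : Set M} {x : M}

/-- Restriction to a smaller set, as a homomorphism of algebras. -/
def LocFun.resAlg (hV : V' ⊆ V) : LocFun n V →ₐ[ℂ] LocFun n V' :=
  { LocFun.res hV with
    commutes' := fun r => LocFun.ext' fun x => LocFun.fn_apply (algebraMap ℂ _ r) ⟨x.1, hV x.2⟩ }

variable [IsManifold 𝓘(ℂ, Fin n → ℂ) ω M]

theorem isMorphism_resAlg (h : ChartDomain c V) (h' : ChartDomain c V') (hV : V' ⊆ V) :
    Coords.IsMorphism (chartCoords h) (chartCoords h') (LocFun.resAlg hV) where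
  map_d i a := chartCoords_d_res h h' hV i a
  map_x i := LocFun.ext' fun x => (LocFun.ev_res hV x ((chartCoords h).x i)).symm

/-! ### Deformed formal functions in a chart -/

/-- On `V`, the deformed formal function `F` is given in the chart `c` by the power series `P`. -/
def RepE (c : OpenPartialHomeomorph M (Fin n → ℂ)) (V : Set M) (F : (FormalFun n M)[ε])
    (P : MvPowerSeries (Idx n) (LocFun n V)[ε]) : Prop :=
  Rep c V F.fst (sfst P) ∧ Rep c V F.snd (ssnd P)

variable {F G : (FormalFun n M)[ε]} {P Q : MvPowerSeries (Idx n) (LocFun n V)[ε]}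

theorem RepE.unique (hP : RepE c V F P) (hQ : RepE c V F Q) : P = Q :=
  eps_series_ext (hP.1.unique hQ.1) (hP.2.unique hQ.2)

theorem RepE.eqOn (h : ChartDomain c V) (hP : RepE c V F P) (hQ : RepE c V G P) :
    FormalFun.EqOnEps F G V := ⟨hP.1.eqOn h hQ.1, hP.2.eqOn h hQ.2⟩

theorem RepE.zero : RepE c V 0 0 := by
  refine ⟨?_, ?_⟩
  · rw [map_zero]; exact Rep.zero
  · rw [map_zero]; exact Rep.zero

theorem RepE.add (hP : RepE c V F P) (hQ : RepE c V G Q) : RepE c V (F + G) (P + Q) :=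
  ⟨by rw [map_add]; exact hP.1.add hQ.1, by rw [map_add]; exact hP.2.add hQ.2⟩

theorem RepE.neg (hP : RepE c V F P) : RepE c V (-F) (-P) :=
  ⟨by rw [map_neg]; exact hP.1.neg, by rw [map_neg]; exact hP.2.neg⟩

theorem RepE.mul (hP : RepE c V F P) (hQ : RepE c V G Q) : RepE c V (F * G) (P * Q) := by
  refine ⟨by rw [map_mul]; exact hP.1.mul hQ.1, ?_⟩
  have e : (F * G).snd = F.fst * G.snd + F.snd * G.fst := by
    simp [mul_comm]
  rw [ssnd_mul, e]
  exact (hP.1.mul hQ.2).add (hP.2.mul hQ.1)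

theorem RepE.inl_ofFun {f : M → ℂ} (hf : SmoothOn n f V) :
    RepE c V (inl (FormalFun.ofFun f)) (C (inl (LocFun.mk f hf))) := by
  refine ⟨?_, ?_⟩
  · rw [sfst_C]; exact Rep.ofFun hf
  · rw [ssnd_C, snd_inl, snd_inl, map_zero]; exact Rep.zero

theorem fst_bracketEps (F G : (FormalFun n M)[ε]) :
    (FormalFun.bracketEps F G).fst = FormalFun.bracket F.fst G.fst := by
  simp [FormalFun.bracketEps]

theorem snd_bracketEps (F G : (FormalFun n M)[ε]) : (FormalFun.bracketEps F G).snd =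
    FormalFun.bracket F.fst G.snd + FormalFun.bracket F.snd G.fst := by
  simp [FormalFun.bracketEps]

theorem RepE.bracketEps (h : ChartDomain c V) (hP : RepE c V F P) (hQ : RepE c V G Q) :
    RepE c V (FormalFun.bracketEps F G) ((chartCoords h).eps.br P Q) := by
  refine ⟨?_, ?_⟩
  · rw [fst_bracketEps, Coords.sfst_br]; exact hP.1.bracket h hQ.1
  · rw [snd_bracketEps, Coords.ssnd_br]
    exact (hP.1.bracket h hQ.2).add (hP.2.bracket h hQ.1)

/-- Iterated brackets are represented by powers of the Hamiltonian operator, and the order estimate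
for `flow` holds separately in each `ε`-component. -/
theorem RepE.expHEps (h : ChartDomain c V) (hP : RepE c V F P) (hQ : RepE c V G Q)
    (hP2 : P ∈ fil _ _ 2) :
    RepE c V (FormalFun.expHEps F G) ((chartCoords h).eps.flow P Q) := by
  set H := (chartCoords h).eps.hamLin P with hH
  have hk : ∀ k, RepE c V ((FormalFun.bracketEps F)^[k] G) ((H ^ k) Q) := by
    intro k
    induction k with
    | zero => simpa using hQ
    | succ k ih =>
      rw [Function.iterate_succ_apply', pow_succ', Module.End.mul_apply]
      exact hP.bracketEps h ih
  have hN : ∀ N, (chartCoords h).eps.flow P Q - ∑ k ∈ Finset.range N, expTerm H k Q ∈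
      fil _ _ N := fun N => by
    have := ((chartCoords h).eps.raises_hamLin hP2).expSeries_sub_mem (b := 0) (Q := Q)
      (by simp) N
    rwa [zero_add] at this
  have e1 : (FormalFun.expHEps F G).fst =
      FormalFun.expSum fun k => ((FormalFun.bracketEps F)^[k] G).fst := by
    simp [FormalFun.expHEps]
  have e2 : (FormalFun.expHEps F G).snd =
      FormalFun.expSum fun k => ((FormalFun.bracketEps F)^[k] G).snd := by
    simp [FormalFun.expHEps]
  refine ⟨?_, ?_⟩
  · rw [e1]
    refine Rep.expSum h (fun k => (hk k).1) fun N => ?_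
    have := (mem_fil_eps.1 (hN N)).1
    rw [map_sub, map_sum] at this
    convert this using 3 with k
    ext m
    simp [expTerm]
  · rw [e2]
    refine Rep.expSum h (fun k => (hk k).2) fun N => ?_
    have := (mem_fil_eps.1 (hN N)).2
    rw [map_sub, map_sum] at this
    convert this using 3 with k
    ext m
    simp [expTerm]

theorem exists_repE (h1 : FormalFun.IsSmooth F.fst) (h2 : FormalFun.IsSmooth F.snd)
    (h : ChartDomain c V) : ∃ P, RepE c V F P := by
  obtain ⟨P, hP⟩ := h1.exists_rep h
  obtain ⟨Q, hQ⟩ := h2.exists_rep h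
  exact ⟨mkEps P Q, by rwa [sfst_mkEps], by rwa [ssnd_mkEps]⟩

theorem RepE.isSmooth (hF : ∀ c ∈ atlas (Fin n → ℂ) M, ∃ P, RepE c c.source F P) :
    FormalFun.IsSmooth F.fst ∧ FormalFun.IsSmooth F.snd :=
  ⟨Rep.isSmooth fun c hc => let ⟨_, hP⟩ := hF c hc; ⟨_, hP.1⟩,
    Rep.isSmooth fun c hc => let ⟨_, hP⟩ := hF c hc; ⟨_, hP.2⟩⟩

theorem eqOnEps_of_local (h : ∀ x ∈ V, ∃ c V', ∃ _ : ChartDomain c V', x ∈ V' ∧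
    ∃ P, RepE c V' F P ∧ RepE c V' G P) : FormalFun.EqOnEps F G V := by
  refine ⟨fun x hx => ?_, fun x hx => ?_⟩ <;> obtain ⟨c, V', hd, hx', P, hF, hG⟩ := h x hx
  · exact (hF.eqOn hd hG).1 hx'
  · exact (hF.eqOn hd hG).2 hx'

theorem eq_of_repE (h : ∀ c ∈ atlas (Fin n → ℂ) M, ∃ P, RepE c c.source F P ∧
    RepE c c.source G P) : F = G := by
  have e : FormalFun.EqOnEps F G Set.univ := eqOnEps_of_local fun x _ =>
    ⟨chartAt _ x, _, ChartDomain.source (chart_mem_atlas _ x), mem_chart_source _ x,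
      h _ (chart_mem_atlas _ x)⟩
  exact TrivSqZeroExt.ext (funext fun x => e.1 (Set.mem_univ x))
    (funext fun x => e.2 (Set.mem_univ x))

/-! ### Gluing -/

/-- The value at `x` is taken from the preferred chart of `x`; compatibility with restriction and
with changes of chart then identifies it with every other member of the family. -/
theorem exists_rep_of_family
    (R : ∀ (c : OpenPartialHomeomorph M (Fin n → ℂ)) (V : Set M), ChartDomain c V →
      MvPowerSeries (Idx n) (LocFun n V))
    (hres : ∀ c V V' (h : ChartDomain c V) (h' : ChartDomain c V') (hV : V' ⊆ V),
      MvPowerSeries.map (LocFun.res hV) (R c V h) = R c V' h')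
    (htrans : ∀ c c' V (h : ChartDomain c V) (h' : ChartDomain c' V),
      (chartCoords h').trans (chartCoords h) (R c V h) = R c' V h') :
    ∃ Φ : FormalFun n M, ∀ c V h, Rep c V Φ (R c V h) := by
  have hev : ∀ c V V' (h : ChartDomain c V) (h' : ChartDomain c V') (hV : V' ⊆ V) (x : M)
      (hx : x ∈ V'), MvPowerSeries.map (LocFun.ev ⟨x, hx⟩) (R c V' h') =
        MvPowerSeries.map (LocFun.ev ⟨x, hV hx⟩) (R c V h) := by
    intro c V V' h h' hV x hx
    rw [← hres c V V' h h' hV]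
    ext m
    simp only [coeff_map, LocFun.ev_res]
  refine ⟨fun x => MvPowerSeries.map (LocFun.ev ⟨x, mem_chart_source (Fin n → ℂ) x⟩)
    (R _ _ (ChartDomain.source (chart_mem_atlas (Fin n → ℂ) x))), fun c V h x => ?_⟩
  set c' := chartAt (Fin n → ℂ) x.1 with hc'
  have h' : ChartDomain c' c'.source := ChartDomain.source (chart_mem_atlas _ _)
  have hV : IsOpen (V ∩ c'.source) := h.isOpen.inter c'.open_source
  have h1 := h.mono hV Set.inter_subset_left
  have h2 := h'.mono hV Set.inter_subset_right
  have hx : x.1 ∈ V ∩ c'.source := ⟨x.2, mem_chart_source _ _⟩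
  refine chartValue_eq_of_eq_linSubst h.mem_atlas (h.subset x.2) ?_
  refine (hev c' _ _ h' h2 Set.inter_subset_right x hx).symm.trans ?_
  rw [← htrans c c' _ h1 h2, Coords.trans, map_linSubst]
  exact congrArg₂ (fun J (R : FiberSeries n) => linSubst J R)
    (funext₂ fun k j => chartCoords_jac_apply h2 h1 k j ⟨x.1, hx⟩)
    (hev c _ _ h h1 Set.inter_subset_left x hx)

theorem exists_repE_of_family
    (R : ∀ (c : OpenPartialHomeomorph M (Fin n → ℂ)) (V : Set M), ChartDomain c V →
      MvPowerSeries (Idx n) (LocFun n V)[ε])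
    (hres : ∀ c V V' (h : ChartDomain c V) (h' : ChartDomain c V') (hV : V' ⊆ V),
      MvPowerSeries.map (dualMap (LocFun.resAlg hV)).toRingHom (R c V h) = R c V' h')
    (htrans : ∀ c c' V (h : ChartDomain c V) (h' : ChartDomain c' V),
      (chartCoords h').eps.trans (chartCoords h).eps (R c V h) = R c' V h') :
    ∃ F : (FormalFun n M)[ε], ∀ c V h, RepE c V F (R c V h) := by
  have e : ∀ {c c' : OpenPartialHomeomorph M (Fin n → ℂ)} {V : Set M}
      (h : ChartDomain c V) (h' : ChartDomain c' V),
      (chartCoords h').eps.jac (chartCoords h).eps =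
        fun k j => inl ((chartCoords h').jac (chartCoords h) k j) :=
    fun h h' => funext₂ fun k j => Coords.eps_jac _ _ k j
  obtain ⟨Φ, hΦ⟩ := exists_rep_of_family (fun c V h => sfst (R c V h))
    (fun c V V' h h' hV => by rw [← hres c V V' h h' hV, sfst_map_dualMap]; rfl)
    (fun c c' V h h' => by rw [← htrans c c' V h h', Coords.trans, Coords.trans, e, sfst_linSubst])
  obtain ⟨Ψ, hΨ⟩ := exists_rep_of_family (fun c V h => ssnd (R c V h))
    (fun c V V' h h' hV => by rw [← hres c V V' h h' hV, ssnd_map_dualMap]; rfl)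
    (fun c c' V h h' => by rw [← htrans c c' V h h', Coords.trans, Coords.trans, e, ssnd_linSubst])
  refine ⟨inl Φ + inr Ψ, fun c V h => ⟨?_, ?_⟩⟩
  · simpa using hΦ c V h
  · simpa using hΨ c V h

/-! ### Local holomorphic functions -/

theorem HolOn.mono {a : M → ℂ} (ha : HolOn n a V) (hV : V' ⊆ V) : HolOn n a V' :=
  MDifferentiableOn.mono ha hV

theorem HolOn.differentiableOn {a : M → ℂ} (ha : HolOn n a V) (h : ChartDomain c V) :
    DifferentiableOn ℂ (a ∘ c.symm) (c.target ∩ c.symm ⁻¹' V) := by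
  have h2 : MDifferentiableOn 𝓘(ℂ, Fin n → ℂ) 𝓘(ℂ, Fin n → ℂ) c.symm c.target :=
    (contMDiffOn_symm_of_mem_maximalAtlas (n := ω)
      (IsManifold.subset_maximalAtlas h.mem_atlas)).mdifferentiableOn (by simp)
  refine mdifferentiableOn_iff_differentiableOn.1 ?_
  exact MDifferentiableOn.comp ha (h2.mono Set.inter_subset_left) fun y hy => hy.2

/-- `HolOn` asks only for complex differentiability, so smoothness has to be drawn from Cauchy's
formula. -/
theorem HolOn.contDiffOn {a : M → ℂ} (ha : HolOn n a V) (h : ChartDomain c V) :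
    ContDiffOn ℝ ∞ (a ∘ c.symm) (c.target ∩ c.symm ⁻¹' V) :=
  (contDiffOn_of_differentiableOn_complex h.isOpen_image
    (ha.differentiableOn h)).restrict_scalars ℝ

theorem smoothOn_of_contDiffOn {f : M → ℂ} (h : ChartDomain c V)
    (hf : ContDiffOn ℝ ∞ (f ∘ c.symm) (c.target ∩ c.symm ⁻¹' V)) : SmoothOn n f V :=
  (h.smoothOn_comp hf).congr fun x hx => by
    simp only [Function.comp_apply, c.left_inv (h.subset hx)]

theorem HolOn.smoothOn {a : M → ℂ} (ha : HolOn n a V) (h : ChartDomain c V) : SmoothOn n a V :=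
  smoothOn_of_contDiffOn h (ha.contDiffOn h)

theorem AntiholOn.smoothOn {b : M → ℂ} (hb : AntiholOn n b V) (h : ChartDomain c V) :
    SmoothOn n b V := by
  refine smoothOn_of_contDiffOn h ?_
  refine (Complex.conjCLE.contDiff.comp_contDiffOn (HolOn.contDiffOn hb h)).congr fun y _ => ?_
  simp

theorem HolOn.d_eq_zero {a : M → ℂ} (ha : HolOn n a V) (h : ChartDomain c V)
    (has : SmoothOn n a V) {i : Idx n} (hi : holType n i ≠ true) :
    (chartCoords h).d i (LocFun.mk a has) = 0 := LocFun.ext' fun x => by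
  rw [chartCoords_d_mk]
  rcases i with k | k
  · simp at hi
  · exact (dW_of_differentiableAt ((ha.differentiableOn h).differentiableAt
      (h.isOpen_image.mem_nhds (h.mem_image x.2))) k).2

theorem AntiholOn.d_eq_zero {b : M → ℂ} (hb : AntiholOn n b V) (h : ChartDomain c V)
    (hbs : SmoothOn n b V) {i : Idx n} (hi : holType n i ≠ false) :
    (chartCoords h).d i (LocFun.mk b hbs) = 0 := LocFun.ext' fun x => by
  rw [chartCoords_d_mk]
  rcases i with k | k
  · have e := (dW_of_differentiableAt_conj ((HolOn.differentiableOn hb h).differentiableAt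
      (h.isOpen_image.mem_nhds (h.mem_image x.2))) k).2
    simp only [Function.comp_apply, Complex.conj_conj] at e
    exact e
  · simp at hi

theorem holOn_coordFun (h : ChartDomain c V) (k : Fin n) :
    HolOn n (coordFun (Sum.inl k) ∘ c) V := by
  have h2 : MDifferentiableOn 𝓘(ℂ, Fin n → ℂ) 𝓘(ℂ, Fin n → ℂ) c c.source :=
    (contMDiffOn_of_mem_maximalAtlas (n := ω)
      (IsManifold.subset_maximalAtlas h.mem_atlas)).mdifferentiableOn (by simp)
  have h3 : MDifferentiable 𝓘(ℂ, Fin n → ℂ) 𝓘(ℂ, ℂ) (fun y : Fin n → ℂ => y k) :=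
    mdifferentiable_iff_differentiable.2 (differentiable_apply k)
  exact h3.comp_mdifferentiableOn (h2.mono h.subset)

theorem antiholOn_coordFun (h : ChartDomain c V) (k : Fin n) :
    AntiholOn n (coordFun (Sum.inr k) ∘ c) V := by
  have := holOn_coordFun h k
  refine MDifferentiableOn.congr this fun x _ => ?_
  simp [coordFun]

end Rep

end KahlerPoisson
end

noncomputable section

namespace KahlerPoisson

open MvPowerSeries TrivSqZeroExt

/-- The bracket with a function of type `t` involves only fibre derivatives of type `t`, and those
vanish by `dxi_flow_C_eq_zero`. -/
theorem Coords.IsK.br_flow_C {σ A : Type*} [CommRing A] [Algebra ℂ A] [DecidableEq σ] [Fintype σ]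
    {c : Coords σ A} {typ : σ → Bool} {F : MvPowerSeries σ A} (h : c.IsK typ F) {t : Bool} {a b : A}
    (ha : ∀ i, typ i ≠ t → c.d i a = 0) (hb : ∀ i, typ i ≠ t → c.d i b = 0) :
    c.br (c.flow F (C a)) (C b) = 0 := by
  rw [c.br_C_right]
  refine Finset.sum_eq_zero fun i _ => ?_
  by_cases hi : typ i = t
  · rw [h.dxi_flow_C_eq_zero ha hi, zero_mul]
  · rw [hb i hi, map_zero, mul_zero]

theorem Coords.eps_d_inl {σ A : Type*} [CommRing A] [Algebra ℂ A] [DecidableEq σ] [Fintype σ]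
    {c : Coords σ A} {i : σ} {a : A} (h : c.d i a = 0) : c.eps.d i (inl a) = 0 := by
  rw [c.eps_d, dualDer_inl, h, inl_zero]

/-! ### The set `𝒦[ε]` in a chart -/

section KSet

variable {n : ℕ} {M : Type*} [TopologicalSpace M] [ChartedSpace (Fin n → ℂ) M]
  [IsManifold 𝓘(ℂ, Fin n → ℂ) ω M]
  {c c' : OpenPartialHomeomorph M (Fin n → ℂ)} {V : Set M} {x : M}
  {Φ : FormalFun n M} {F G : (FormalFun n M)[ε]}

theorem Rep.mem_fil {P : MvPowerSeries (Idx n) (LocFun n V)} {N : ℕ} (hP : Rep c V Φ P)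
    (h : ∀ x, Φ x ∈ fil (Idx n) ℂ N) : P ∈ fil (Idx n) (LocFun n V) N := by
  intro m hm
  refine LocFun.ext' fun x => ?_
  have e := congrArg (coeff m) (hP x)
  rw [chartValue, linSubst_mem_fil _ (h x) m hm, coeff_map] at e
  exact e.symm

theorem Rep.apply_mem_fil {P : MvPowerSeries (Idx n) (LocFun n V)} {N : ℕ} (hP : Rep c V Φ P)
    (h : ChartDomain c V) (hN : P ∈ fil (Idx n) (LocFun n V) N) (hx : x ∈ V) :
    Φ x ∈ fil (Idx n) ℂ N := by
  rw [eq_linSubst_chartValue h.mem_atlas (h.subset hx) Φ, hP ⟨x, hx⟩]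
  exact linSubst_mem_fil _ (map_mem_fil _ hN)

theorem RepE.congr {P : MvPowerSeries (Idx n) (LocFun n V)[ε]} (hP : RepE c V F P)
    (h : FormalFun.EqOnEps F G V) : RepE c V G P := ⟨hP.1.congr h.1, hP.2.congr h.2⟩

/-- The coordinates are themselves local holomorphic or antiholomorphic functions, and bracketing
with them gives the fibre derivatives occurring in `IsK`. -/
theorem isK_of_mem_KEpsSet (hF : F ∈ KEpsSet n M) (h : ChartDomain c V)
    {P : MvPowerSeries (Idx n) (LocFun n V)[ε]} (hP : RepE c V F P) :
    (chartCoords h).eps.IsK (holType n) P := by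
  obtain ⟨-, hq, hhol, hanti⟩ := hF
  have hP2 : P ∈ fil _ _ 2 := mem_fil_eps.2 ⟨hP.1.mem_fil hq.1, hP.2.mem_fil hq.2⟩
  refine ⟨hP2, fun i j hij => ?_⟩
  have key : FormalFun.EqOnEps (FormalFun.bracketEps
      (FormalFun.expHEps F (inl (FormalFun.ofFun (coordFun i ∘ c))))
      (inl (FormalFun.ofFun (coordFun j ∘ c)))) 0 V := by
    rcases i with i | i <;> rcases j with j | j
    · exact hhol V h.isOpen _ _ (holOn_coordFun h i) (holOn_coordFun h j)
    · simp at hij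
    · simp at hij
    · exact hanti V h.isOpen _ _ (antiholOn_coordFun h i) (antiholOn_coordFun h j)
  have hR := RepE.bracketEps h (hP.expHEps h (RepE.inl_ofFun (smoothOn_coordFun h i)) hP2)
    (RepE.inl_ofFun (smoothOn_coordFun h j))
  have hz := (hR.congr key).unique RepE.zero
  rw [← (chartCoords h).eps.br_x]
  exact hz

/-- The condition on coordinates extends to all local holomorphic and antiholomorphic functions by
the chain rule. The bracket being local, each point may be treated in its preferred chart. -/
theorem mem_KEpsSet_of_isK (hF : ∀ c V (h : ChartDomain c V), ∃ P, RepE c V F P ∧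
    (chartCoords h).eps.IsK (holType n) P) : F ∈ KEpsSet n M := by
  have hchart := fun x : M => ChartDomain.source (chart_mem_atlas (Fin n → ℂ) x)
  have key : ∀ (t : Bool) (V : Set M), IsOpen V → ∀ a a' : M → ℂ,
      (∀ c V', V' ⊆ V → ∀ h : ChartDomain c V', ∃ (has : SmoothOn n a V') (has' : SmoothOn n a' V'),
        ∀ i, holType n i ≠ t → (chartCoords h).d i (LocFun.mk a has) = 0 ∧
          (chartCoords h).d i (LocFun.mk a' has') = 0) →
      FormalFun.EqOnEps (FormalFun.bracketEps
        (FormalFun.expHEps F (inl (FormalFun.ofFun a))) (inl (FormalFun.ofFun a'))) 0 V := by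
    intro t V hV a a' H
    refine eqOnEps_of_local fun x hx => ?_
    have h := (hchart x).mono (hV.inter (hchart x).isOpen) Set.inter_subset_right
    obtain ⟨P, hP, hK⟩ := hF _ _ h
    obtain ⟨has, has', hd⟩ := H _ _ Set.inter_subset_left h
    refine ⟨_, _, h, ⟨hx, mem_chart_source _ x⟩, _, RepE.bracketEps h
      (hP.expHEps h (RepE.inl_ofFun has) hK.1) (RepE.inl_ofFun has'), ?_⟩
    rw [hK.br_flow_C (t := t) (fun i hi => Coords.eps_d_inl (hd i hi).1)
      (fun i hi => Coords.eps_d_inl (hd i hi).2)]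
    exact RepE.zero
  refine ⟨RepE.isSmooth fun c hc => ?_, ⟨fun x => ?_, fun x => ?_⟩, fun V hV a a' ha ha' => ?_,
    fun V hV b b' hb hb' => ?_⟩
  · obtain ⟨P, hP, -⟩ := hF _ _ (ChartDomain.source hc)
    exact ⟨P, hP⟩
  · obtain ⟨P, hP, hK⟩ := hF _ _ (hchart x)
    exact hP.1.apply_mem_fil (hchart x) (mem_fil_eps.1 hK.1).1 (mem_chart_source _ x)
  · obtain ⟨P, hP, hK⟩ := hF _ _ (hchart x)
    exact hP.2.apply_mem_fil (hchart x) (mem_fil_eps.1 hK.1).2 (mem_chart_source _ x)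
  · exact key true V hV a a' fun c V' hV' h =>
      ⟨(ha.mono hV').smoothOn h, (ha'.mono hV').smoothOn h, fun i hi =>
        ⟨(ha.mono hV').d_eq_zero h _ hi, (ha'.mono hV').d_eq_zero h _ hi⟩⟩
  · exact key false V hV b b' fun c V' hV' h =>
      ⟨AntiholOn.smoothOn (HolOn.mono hb hV') h, AntiholOn.smoothOn (HolOn.mono hb' hV') h,
        fun i hi => ⟨AntiholOn.d_eq_zero (HolOn.mono hb hV') h _ hi,
          AntiholOn.d_eq_zero (HolOn.mono hb' hV') h _ hi⟩⟩

theorem exists_repE_chartAt (hF : F ∈ KEpsSet n M) (x : M) :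
    ∃ P, RepE (chartAt (Fin n → ℂ) x) (chartAt (Fin n → ℂ) x).source F P ∧
      (chartCoords (ChartDomain.source (chart_mem_atlas (Fin n → ℂ) x))).eps.IsK (holType n) P := by
  obtain ⟨P, hP⟩ := exists_repE hF.1.1 hF.1.2
    (ChartDomain.source (chart_mem_atlas (Fin n → ℂ) x))
  exact ⟨P, hP, isK_of_mem_KEpsSet hF _ hP⟩

theorem isEven_of_mem_KEpsSet (hF : F ∈ KEpsSet n M) :
    FormalFun.IsEven F.fst ∧ FormalFun.IsEven F.snd := by
  refine ⟨fun x m hm => ?_, fun x m hm => ?_⟩ <;> obtain ⟨P, hP, hK⟩ := exists_repE_chartAt hF x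
  · rw [← chartValue_chartAt F.fst x, hP.1 ⟨x, mem_chart_source _ x⟩, coeff_map, coeff_sfst,
      hK.even hm, fst_zero, map_zero]
  · rw [← chartValue_chartAt F.snd x, hP.2 ⟨x, mem_chart_source _ x⟩, coeff_map, coeff_ssnd,
      hK.even hm, snd_zero, map_zero]

/-! ### Tensors and quadratic parts -/

/-- The symmetric matrix on all indices given by a matrix pairing indices of opposite type. -/
def blockMat {R : Type*} [Zero R] (v : Fin n → Fin n → R) : Idx n → Idx n → R
  | Sum.inl k, Sum.inr l => v l k
  | Sum.inr l, Sum.inl k => v l k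
  | _, _ => 0

theorem blockMat_symm {R : Type*} [Zero R] (v : Fin n → Fin n → R) (i j : Idx n) :
    blockMat v i j = blockMat v j i := by
  rcases i with i | i <;> rcases j with j | j <;> rfl

theorem blockMat_eq_zero {R : Type*} [Zero R] (v : Fin n → Fin n → R) {i j : Idx n}
    (h : holType n i = holType n j) : blockMat v i j = 0 := by
  rcases i with i | i <;> rcases j with j | j
  · rfl
  · simp at h
  · simp at h
  · rfl

theorem eq_blockMat {R : Type*} [Zero R] {H : Idx n → Idx n → R} (hs : ∀ i j, H i j = H j i)
    (h0 : ∀ i j, holType n i = holType n j → H i j = 0) :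
    H = blockMat fun l k => H (Sum.inl k) (Sum.inr l) := by
  ext i j
  rcases i with i | i <;> rcases j with j | j
  · exact h0 _ _ rfl
  · rfl
  · exact hs _ _
  · exact h0 _ _ rfl

theorem blockMat_injective {R : Type*} [Zero R] :
    Function.Injective (blockMat : (Fin n → Fin n → R) → Idx n → Idx n → R) := fun v w h => by
  ext l k
  exact congrFun₂ h (Sum.inl k) (Sum.inr l)

/-- The quadratic form with a given matrix. -/
def quadForm (v : Fin n → Fin n → ℂ) : FiberSeries n :=
  ∑ l, ∑ k, v l k • (X (Sum.inl k) * X (Sum.inr l) : FiberSeries n)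

theorem hess_quadForm (v : Fin n → Fin n → ℂ) : hess (quadForm v) = blockMat v := by
  ext i j
  have hX : ∀ (i : Idx n) (r : ℂ) (P : FiberSeries n), dxi i (r • P) = r • dxi i P :=
    fun i r P => (dxi i).map_smul r P
  have hc : ∀ (r : ℂ) (P : FiberSeries n), constantCoeff (r • P) = r * constantCoeff P :=
    fun r P => by
      rw [MvPowerSeries.smul_eq_C_mul, map_mul, constantCoeff_C]
  rw [hess, quadForm]
  simp only [map_sum, hX, hc, Derivation.leibniz, dxi_X, smul_eq_mul, map_add, map_mul]
  rcases i with i | i <;> rcases j with j | j <;> simp [blockMat, apply_ite (dxi _),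
    apply_ite constantCoeff]

theorem quadForm_mem_fil (v : Fin n → Fin n → ℂ) : quadForm v ∈ fil (Idx n) ℂ 2 :=
  Submodule.sum_mem _ fun _ _ => Submodule.sum_mem _ fun _ _ =>
    smul_mem_fil (mul_mem_fil (a := 1) (b := 1) (X_mem_fil _) (X_mem_fil _)) _

theorem coeff_quadForm_of_degree_ne (v : Fin n → Fin n → ℂ) {m : Idx n →₀ ℕ} (hm : m.degree ≠ 2) :
    coeff m (quadForm v) = 0 := by
  classical
  rw [quadForm, map_sum]
  refine Finset.sum_eq_zero fun l _ => ?_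
  rw [map_sum]
  refine Finset.sum_eq_zero fun k _ => ?_
  rw [coeff_smul_complex, X, X, monomial_mul_monomial, coeff_monomial, if_neg, smul_zero]
  rintro rfl
  exact hm (by simp)

/-- A quadratic form and its matrix of second derivatives carry the same information, and second
derivatives at the origin ignore the terms of other degrees. -/
theorem quadraticPartEq_iff (hΦ : FormalFun.StartsQuadratic Φ) (g : Tensor n M) :
    FormalFun.QuadraticPartEq Φ g ↔ ∀ x, hess (Φ x) = blockMat (g.val x) := by
  have hfil : ∀ x, Φ x ∈ fil (Idx n) ℂ 2 := hΦ
  refine forall_congr' fun x => ?_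
  change homogeneousComponent 2 (Φ x) = quadForm (g.val x) ↔ _
  rw [← hess_quadForm]
  constructor
  · intro h
    rw [← h]
    ext i j
    rw [hess, hess, ← coeff_zero_eq_constantCoeff_apply, ← coeff_zero_eq_constantCoeff_apply]
    simp only [coeff_dxi, coeff_homogeneousComponent]
    rw [if_pos (by simp)]
  · intro h
    have h3 := sub_mem_fil_three (hfil x) (quadForm_mem_fil (g.val x)) h
    ext m
    rw [coeff_homogeneousComponent]
    split_ifs with hm
    · exact coeff_eq_of_sub_mem_fil h3 (by omega)
    · exact (coeff_quadForm_of_degree_ne _ hm).symm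

theorem hess_chartValue (c : OpenPartialHomeomorph M (Fin n → ℂ)) (Φ : FormalFun n M) (x : M)
    (i j : Idx n) : hess (chartValue c Φ x) i j =
      ∑ k, ∑ l, chartJac c (chartAt (Fin n → ℂ) x) x i k * chartJac c (chartAt (Fin n → ℂ) x) x j l
        * hess (Φ x) k l := hess_linSubst _ _ i j

theorem blockMat_jacobian (hc : c ∈ atlas (Fin n → ℂ) M) (hx : x ∈ c.source)
    (v : Fin n → Fin n → ℂ) (i j : Idx n) :
    blockMat (fun l k => ∑ j : Fin n, ∑ i : Fin n,
      conj (jacobian c x l j) * jacobian c x k i * v j i) i j =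
      ∑ k, ∑ l, chartJac c (chartAt (Fin n → ℂ) x) x i k * chartJac c (chartAt (Fin n → ℂ) x) x j l
        * blockMat v k l := by
  have hφ := differentiableAt_transition hc (chart_mem_atlas (Fin n → ℂ) x) hx
    (mem_chart_source _ x)
  have e1 : ∀ k j : Fin n, chartJac c (chartAt (Fin n → ℂ) x) x (Sum.inl k) (Sum.inl j) =
      jacobian c x k j := fun k j => (dW_coordFun_comp hφ k j).1
  have e2 : ∀ k j : Fin n, chartJac c (chartAt (Fin n → ℂ) x) x (Sum.inl k) (Sum.inr j) = 0 :=
    fun k j => (dW_coordFun_comp hφ k j).2.1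
  have e3 : ∀ k j : Fin n, chartJac c (chartAt (Fin n → ℂ) x) x (Sum.inr k) (Sum.inl j) = 0 :=
    fun k j => (dW_coordFun_comp hφ k j).2.2.1
  have e4 : ∀ k j : Fin n, chartJac c (chartAt (Fin n → ℂ) x) x (Sum.inr k) (Sum.inr j) =
      conj (jacobian c x k j) := fun k j => (dW_coordFun_comp hφ k j).2.2.2
  rcases i with i | i <;> rcases j with j | j <;>
    simp only [Fintype.sum_sum_type, e1, e2, e3, e4, blockMat, mul_zero, zero_mul,
      Finset.sum_const_zero, add_zero, zero_add]
  · rw [Finset.sum_comm]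
    exact Finset.sum_congr rfl fun _ _ => Finset.sum_congr rfl fun _ _ => by ring

theorem blockMat_coord (hc : c ∈ atlas (Fin n → ℂ) M) (hx : x ∈ c.source) (g : Tensor n M)
    (i j : Idx n) : blockMat (fun l k => g.coord c l k (c x)) i j =
      ∑ k, ∑ l, chartJac c (chartAt (Fin n → ℂ) x) x i k * chartJac c (chartAt (Fin n → ℂ) x) x j l
        * blockMat (g.val x) k l := by
  rw [← blockMat_jacobian hc hx]
  simp only [Tensor.coord, c.left_inv hx]

end KSet

end KahlerPoisson
end

noncomputable section

namespace KahlerPoisson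

open MvPowerSeries TrivSqZeroExt

/-! ### Tensors in a chart -/

/-- The Jacobi equation is empty unless `q` has the type opposite to that of `i` and `k`; the two
choices of that type give the two Kähler–Poisson equations. -/
theorem Coords.isKP_blockMat_iff {n : ℕ} {A : Type*} [CommRing A] [Algebra ℂ A]
    (c : Coords (Idx n) A) (v : Fin n → Fin n → A) : c.IsKP (holType n) (blockMat v) ↔
      (∀ l q p : Fin n, ∑ k, v l k * c.d (Sum.inl k) (v q p) =
        ∑ k, v q k * c.d (Sum.inl k) (v l p)) ∧
      (∀ k q p : Fin n, ∑ l, v l k * c.d (Sum.inr l) (v q p) =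
        ∑ l, v l p * c.d (Sum.inr l) (v q k)) := by
  constructor
  · intro h
    refine ⟨fun l q p => ?_, fun k q p => ?_⟩
    · simpa [Fintype.sum_sum_type, blockMat] using h.jacobi (Sum.inr l) (Sum.inr q) rfl (Sum.inl p)
    · simpa [Fintype.sum_sum_type, blockMat] using h.jacobi (Sum.inl k) (Sum.inl p) rfl (Sum.inr q)
  · rintro ⟨h1, h2⟩
    refine ⟨blockMat_symm v, fun i j => blockMat_eq_zero v, fun i k hik q => ?_⟩
    rcases i with i | i <;> rcases k with k | k
    · rcases q with q | q
      · simp [blockMat]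
      · simpa [Fintype.sum_sum_type, blockMat] using h2 i q k
    · simp at hik
    · simp at hik
    · rcases q with q | q
      · simpa [Fintype.sum_sum_type, blockMat] using h1 i k q
      · simp [blockMat]

/-- Written as `G ↦ J G Jᵀ`, this is associativity of the matrix product. -/
theorem congruence_trans {σ : Type*} [Fintype σ] {J J' J'' : σ → σ → ℂ} {G G' G'' : σ → σ → ℂ}
    (hJ : J'' = fun i j => ∑ k, J i k * J' k j)
    (h' : ∀ i j, G' i j = ∑ k, ∑ l, J' i k * J' j l * G k l)
    (h'' : ∀ i j, G'' i j = ∑ k, ∑ l, J'' i k * J'' j l * G k l) (i j : σ) :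
    G'' i j = ∑ k, ∑ l, J i k * J j l * G' k l := by
  have key : ∀ (J G : σ → σ → ℂ) (i j : σ), ∑ k, ∑ l, J i k * J j l * G k l =
      (Matrix.of J * Matrix.of G * (Matrix.of J).transpose) i j := by
    intro J G i j
    simp only [Matrix.mul_apply, Matrix.of_apply, Matrix.transpose_apply, Finset.sum_mul]
    rw [Finset.sum_comm]
    exact Finset.sum_congr rfl fun _ _ => Finset.sum_congr rfl fun _ _ => by ring
  have eJ : Matrix.of J'' = Matrix.of J * Matrix.of J' := by
    ext i j
    simp only [hJ, Matrix.mul_apply, Matrix.of_apply]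
  have eG : Matrix.of G' = Matrix.of J' * Matrix.of G * (Matrix.of J').transpose := by
    ext i j
    rw [Matrix.of_apply, h', key]
  rw [h'', key, key, eJ, eG, Matrix.transpose_mul]
  simp only [Matrix.mul_assoc]

section Tensor

variable {n : ℕ} {M : Type*} [TopologicalSpace M] [ChartedSpace (Fin n → ℂ) M]
  [IsManifold 𝓘(ℂ, Fin n → ℂ) ω M]
  {c c' : OpenPartialHomeomorph M (Fin n → ℂ)} {V V' : Set M} {x : M}

theorem chartDeriv_comp_chart (h : ChartDomain c V) (f : (Fin n → ℂ) → ℂ) (i : Idx n)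
    (hx : x ∈ V) : chartDeriv c i (f ∘ c) x = dW i f (c x) := by
  refine dW_congr ?_ i
  filter_upwards [h.isOpen_image.mem_nhds (h.mem_image hx)] with y hy
  simp only [Function.comp_apply, c.right_inv hy.1]

theorem blockMat_coord_trans (hc : c ∈ atlas (Fin n → ℂ) M) (hc' : c' ∈ atlas (Fin n → ℂ) M)
    (hx : x ∈ c.source) (hx' : x ∈ c'.source) (g : Tensor n M) (i j : Idx n) :
    blockMat (fun l k => g.coord c l k (c x)) i j =
      ∑ k, ∑ l, chartJac c c' x i k * chartJac c c' x j l *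
        blockMat (fun l k => g.coord c' l k (c' x)) k l :=
  congruence_trans (chartJac_trans hc hc' (chart_mem_atlas _ x) hx hx' (mem_chart_source _ x))
    (blockMat_coord hc' hx' g) (blockMat_coord hc hx g) i j

/-- The components of a tensor in a chart, as smooth functions on a coordinate domain. -/
def Tensor.loc (g : Tensor n M) (h : ChartDomain c V) (l k : Fin n) : LocFun n V :=
  LocFun.mk (g.coord c l k ∘ c)
    (h.smoothOn_comp ((g.smooth' c h.mem_atlas l k).mono Set.inter_subset_left))

theorem Tensor.loc_apply (g : Tensor n M) (h : ChartDomain c V) (l k : Fin n) (x : V) :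
    (g.loc h l k).1 x = g.coord c l k (c x) := rfl

theorem Tensor.d_loc_apply (g : Tensor n M) (h : ChartDomain c V) (l k : Fin n) (i : Idx n)
    (x : V) : ((chartCoords h).d i (g.loc h l k)).1 x = dW i (g.coord c l k) (c x) :=
  (chartCoords_d_mk h i _ x).trans (chartDeriv_comp_chart h _ i x.2)

/-- The deformed tensor `g + ε h` on a coordinate domain, as a symmetric matrix. -/
def locTensor (g g' : Tensor n M) (h : ChartDomain c V) : Idx n → Idx n → (LocFun n V)[ε] :=
  blockMat fun l k => inl (g.loc h l k) + inr (g'.loc h l k)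

theorem fst_locTensor_apply (g g' : Tensor n M) (h : ChartDomain c V) (i j : Idx n) (x : V) :
    ((locTensor g g' h i j).fst).1 x = blockMat (fun l k => g.coord c l k (c x)) i j := by
  rcases i with i | i <;> rcases j with j | j <;>
    simp [locTensor, blockMat, Tensor.loc_apply] <;> rfl

theorem snd_locTensor_apply (g g' : Tensor n M) (h : ChartDomain c V) (i j : Idx n) (x : V) :
    ((locTensor g g' h i j).snd).1 x = blockMat (fun l k => g'.coord c l k (c x)) i j := by
  rcases i with i | i <;> rcases j with j | j <;>
    simp [locTensor, blockMat, Tensor.loc_apply] <;> rfl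

theorem locTensor_trans (g g' : Tensor n M) (h : ChartDomain c V) (h' : ChartDomain c' V)
    (i j : Idx n) : locTensor g g' h i j =
      ∑ k, ∑ l, (chartCoords h).eps.jac (chartCoords h').eps i k *
        (chartCoords h).eps.jac (chartCoords h').eps j l * locTensor g g' h' k l := by
  simp only [Coords.eps_jac]
  ext
  · refine LocFun.ext' fun x => ?_
    rw [fst_locTensor_apply, blockMat_coord_trans h.mem_atlas h'.mem_atlas (h.subset x.2)
      (h'.subset x.2), ← LocFun.ev_apply]
    simp only [fst_sum, fst_mul, fst_inl, map_sum, map_mul]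
    refine Finset.sum_congr rfl fun k _ => Finset.sum_congr rfl fun l _ => ?_
    rw [LocFun.ev_apply, LocFun.ev_apply, LocFun.ev_apply, chartCoords_jac_apply,
      chartCoords_jac_apply, fst_locTensor_apply]
  · refine LocFun.ext' fun x => ?_
    rw [snd_locTensor_apply, blockMat_coord_trans h.mem_atlas h'.mem_atlas (h.subset x.2)
      (h'.subset x.2), ← LocFun.ev_apply]
    rw [snd_sum, map_sum]
    refine Finset.sum_congr rfl fun k _ => ?_
    rw [snd_sum, map_sum]
    refine Finset.sum_congr rfl fun l _ => ?_
    rw [← inl_mul, snd_mul, fst_inl, snd_inl, smul_eq_mul, smul_zero, add_zero, map_mul, map_mul,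
      LocFun.ev_apply, LocFun.ev_apply, LocFun.ev_apply, chartCoords_jac_apply,
      chartCoords_jac_apply, snd_locTensor_apply]

theorem locTensor_res (g g' : Tensor n M) (h : ChartDomain c V) (h' : ChartDomain c V')
    (hV : V' ⊆ V) (i j : Idx n) :
    locTensor g g' h' i j = dualMap (LocFun.resAlg hV) (locTensor g g' h i j) := by
  ext
  · refine LocFun.ext' fun x => ?_
    rw [fst_dualMap, fst_locTensor_apply]
    exact ((LocFun.ev_res hV x _).trans (fst_locTensor_apply g g' h i j ⟨x.1, hV x.2⟩)).symm
  · refine LocFun.ext' fun x => ?_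
    rw [snd_dualMap, snd_locTensor_apply]
    exact ((LocFun.ev_res hV x _).trans (snd_locTensor_apply g g' h i j ⟨x.1, hV x.2⟩)).symm

/-- Over the dual numbers one Jacobi equation for `g + ε g'` splits into the Jacobi equations for
`g` and their linearisation along `g'`. This reduces the deformation problem to the undeformed
algebra. -/
theorem isKP_locTensor_iff (g g' : Tensor n M) (h : ChartDomain c V) :
    (chartCoords h).eps.IsKP (holType n) (locTensor g g' h) ↔ ∀ x ∈ V,
      ((∀ l q p : Fin n, ∑ k, g.coord c l k (c x) * dz k (g.coord c q p) (c x)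
          = ∑ k, g.coord c q k (c x) * dz k (g.coord c l p) (c x)) ∧
        (∀ k q p : Fin n, ∑ l, g.coord c l k (c x) * dzbar l (g.coord c q p) (c x)
          = ∑ l, g.coord c l p (c x) * dzbar l (g.coord c q k) (c x))) ∧
      ((∀ l q p : Fin n, ∑ k, (g.coord c l k (c x) * dz k (g'.coord c q p) (c x)
            + g'.coord c l k (c x) * dz k (g.coord c q p) (c x))
          = ∑ k, (g.coord c q k (c x) * dz k (g'.coord c l p) (c x)
            + g'.coord c q k (c x) * dz k (g.coord c l p) (c x))) ∧
        (∀ k q p : Fin n, ∑ l, (g.coord c l k (c x) * dzbar l (g'.coord c q p) (c x)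
            + g'.coord c l k (c x) * dzbar l (g.coord c q p) (c x))
          = ∑ l, (g.coord c l p (c x) * dzbar l (g'.coord c q k) (c x)
            + g'.coord c l p (c x) * dzbar l (g.coord c q k) (c x)))) := by
  -- Index pairs depending on the summation variable let one computation serve both sides of both
  -- equations.
  have hf : ∀ (i : Fin n → Idx n) (a a' : Fin n → Fin n × Fin n) (x : V),
      (∑ k, (inl (g.loc h (a k).1 (a k).2) + inr (g'.loc h (a k).1 (a k).2)) *
        (chartCoords h).eps.d (i k) (inl (g.loc h (a' k).1 (a' k).2) +
          inr (g'.loc h (a' k).1 (a' k).2)) : (LocFun n V)[ε]).fst.1 x =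
      ∑ k, g.coord c (a k).1 (a k).2 (c x) * dW (i k) (g.coord c (a' k).1 (a' k).2) (c x) := by
    intro i a a' x
    rw [fst_sum, ← LocFun.ev_apply, map_sum]
    refine Finset.sum_congr rfl fun k _ => ?_
    rw [← Tensor.d_loc_apply _ h, ← Tensor.loc_apply _ h, ← LocFun.ev_apply,
      ← LocFun.ev_apply, ← map_mul]
    simp [Coords.eps_d]
  have hs : ∀ (i : Fin n → Idx n) (a a' : Fin n → Fin n × Fin n) (x : V),
      (∑ k, (inl (g.loc h (a k).1 (a k).2) + inr (g'.loc h (a k).1 (a k).2)) *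
        (chartCoords h).eps.d (i k) (inl (g.loc h (a' k).1 (a' k).2) +
          inr (g'.loc h (a' k).1 (a' k).2)) : (LocFun n V)[ε]).snd.1 x =
      ∑ k, (g.coord c (a k).1 (a k).2 (c x) * dW (i k) (g'.coord c (a' k).1 (a' k).2) (c x) +
        g'.coord c (a k).1 (a k).2 (c x) * dW (i k) (g.coord c (a' k).1 (a' k).2) (c x)) := by
    intro i a a' x
    rw [snd_sum, ← LocFun.ev_apply, map_sum]
    refine Finset.sum_congr rfl fun k _ => ?_
    rw [← Tensor.d_loc_apply _ h, ← Tensor.d_loc_apply _ h, ← Tensor.loc_apply _ h,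
      ← Tensor.loc_apply _ h,
      ← LocFun.ev_apply, ← LocFun.ev_apply, ← LocFun.ev_apply, ← LocFun.ev_apply, ← map_mul,
      ← map_mul, ← map_add]
    simp [Coords.eps_d, mul_comm]
  have heq : ∀ (i : Fin n → Idx n) (a a' b b' : Fin n → Fin n × Fin n),
      ((∑ k, (inl (g.loc h (a k).1 (a k).2) + inr (g'.loc h (a k).1 (a k).2)) *
        (chartCoords h).eps.d (i k) (inl (g.loc h (a' k).1 (a' k).2) +
          inr (g'.loc h (a' k).1 (a' k).2)) : (LocFun n V)[ε]) =
      ∑ k, (inl (g.loc h (b k).1 (b k).2) + inr (g'.loc h (b k).1 (b k).2)) *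
        (chartCoords h).eps.d (i k) (inl (g.loc h (b' k).1 (b' k).2) +
          inr (g'.loc h (b' k).1 (b' k).2))) ↔ ∀ x ∈ V,
      (∑ k, g.coord c (a k).1 (a k).2 (c x) * dW (i k) (g.coord c (a' k).1 (a' k).2) (c x) =
        ∑ k, g.coord c (b k).1 (b k).2 (c x) * dW (i k) (g.coord c (b' k).1 (b' k).2) (c x)) ∧
      (∑ k, (g.coord c (a k).1 (a k).2 (c x) * dW (i k) (g'.coord c (a' k).1 (a' k).2) (c x) +
        g'.coord c (a k).1 (a k).2 (c x) * dW (i k) (g.coord c (a' k).1 (a' k).2) (c x)) =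
        ∑ k, (g.coord c (b k).1 (b k).2 (c x) * dW (i k) (g'.coord c (b' k).1 (b' k).2) (c x) +
        g'.coord c (b k).1 (b k).2 (c x) * dW (i k) (g.coord c (b' k).1 (b' k).2) (c x))) := by
    intro i a a' b b'
    constructor
    · intro e x hx
      rw [← hf i a a' ⟨x, hx⟩, ← hf i b b' ⟨x, hx⟩, ← hs i a a' ⟨x, hx⟩, ← hs i b b' ⟨x, hx⟩, e]
      exact ⟨rfl, rfl⟩
    · intro e
      refine TrivSqZeroExt.ext (LocFun.ext' fun x => ?_) (LocFun.ext' fun x => ?_)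
      · rw [hf, hf]; exact (e x x.2).1
      · rw [hs, hs]; exact (e x x.2).2
  rw [locTensor, Coords.isKP_blockMat_iff]
  have h1 : ∀ l q p : Fin n, _ := fun l q p => heq Sum.inl (fun k => (l, k)) (fun _ => (q, p))
    (fun k => (q, k)) (fun _ => (l, p))
  have h2 : ∀ k q p : Fin n, _ := fun k q p => heq Sum.inr (fun l => (l, k)) (fun _ => (q, p))
    (fun l => (l, p)) (fun _ => (q, k))
  simp only [dW_inl, dW_inr] at h1 h2
  simp only [h1, h2]
  constructor
  · rintro ⟨e1, e2⟩ x hx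
    exact ⟨⟨fun l q p => (e1 l q p x hx).1, fun k q p => (e2 k q p x hx).1⟩,
      fun l q p => (e1 l q p x hx).2, fun k q p => (e2 k q p x hx).2⟩
  · intro e
    exact ⟨fun l q p x hx => ⟨(e x hx).1.1 l q p, (e x hx).2.1 l q p⟩,
      fun k q p x hx => ⟨(e x hx).1.2 k q p, (e x hx).2.2 k q p⟩⟩

theorem Deformation.isKP (d : Deformation n M) (h : ChartDomain c V) :
    (chartCoords h).eps.IsKP (holType n) (locTensor d.g d.h h) :=
  (isKP_locTensor_iff d.g d.h h).2 fun x hx =>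
    ⟨d.isKahlerPoisson c h.mem_atlas (c x) (c.map_source (h.subset hx)),
      d.isDeformation c h.mem_atlas (c x) (c.map_source (h.subset hx))⟩

end Tensor

end KahlerPoisson
end

noncomputable section

namespace KahlerPoisson

open MvPowerSeries TrivSqZeroExt

/-! ### Deformations and the set `𝒦[ε]` -/

section Theta

variable {n : ℕ} {M : Type*} [TopologicalSpace M] [ChartedSpace (Fin n → ℂ) M]
  [IsManifold 𝓘(ℂ, Fin n → ℂ) ω M]
  {c c' : OpenPartialHomeomorph M (Fin n → ℂ)} {V : Set M} {x : M}
  {Φ : FormalFun n M} {F F' : (FormalFun n M)[ε]}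

theorem Rep.hess_apply {P : MvPowerSeries (Idx n) (LocFun n V)} (hP : Rep c V Φ P) (i j : Idx n)
    (x : V) : (hess P i j).1 x = hess (chartValue c Φ x) i j := by
  rw [hP x, hess_map]; rfl

theorem blockMat_coord_chartAt (g : Tensor n M) (x : M) :
    blockMat (fun l k => g.coord (chartAt (Fin n → ℂ) x) l k (chartAt (Fin n → ℂ) x x)) =
      blockMat (g.val x) := by
  ext i j
  rw [blockMat_coord (chart_mem_atlas _ x) (mem_chart_source _ x),
    chartJac_self (chart_mem_atlas _ x) (mem_chart_source _ x)]
  simp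

theorem hess_eq_locTensor {g g' : Tensor n M} (hg : FormalFun.StartsQuadratic F.fst)
    (hg' : FormalFun.StartsQuadratic F.snd) (h1 : FormalFun.QuadraticPartEq F.fst g)
    (h2 : FormalFun.QuadraticPartEq F.snd g') (h : ChartDomain c V)
    {P : MvPowerSeries (Idx n) (LocFun n V)[ε]} (hP : RepE c V F P) :
    hess P = locTensor g g' h := by
  rw [quadraticPartEq_iff hg] at h1
  rw [quadraticPartEq_iff hg'] at h2
  ext i j
  · refine LocFun.ext' fun x => ?_
    rw [fst_hess, hP.1.hess_apply, hess_chartValue, fst_locTensor_apply,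
      blockMat_coord h.mem_atlas (h.subset x.2), h1]
  · refine LocFun.ext' fun x => ?_
    rw [snd_hess, hP.2.hess_apply, hess_chartValue, snd_locTensor_apply,
      blockMat_coord h.mem_atlas (h.subset x.2), h2]

/-- Chart by chart, the two representing series satisfy `IsK` and have the same Hessian. -/
theorem eq_of_quadraticPartEq {g g' : Tensor n M} (hF : F ∈ KEpsSet n M) (hF' : F' ∈ KEpsSet n M)
    (h1 : FormalFun.QuadraticPartEq F.fst g) (h2 : FormalFun.QuadraticPartEq F.snd g')
    (h1' : FormalFun.QuadraticPartEq F'.fst g) (h2' : FormalFun.QuadraticPartEq F'.snd g') :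
    F = F' := by
  refine eq_of_repE fun c hc => ?_
  have h := ChartDomain.source hc
  obtain ⟨P, hP⟩ := exists_repE hF.1.1 hF.1.2 h
  obtain ⟨P', hP'⟩ := exists_repE hF'.1.1 hF'.1.2 h
  have e : P = P' := (isK_of_mem_KEpsSet hF h hP).eq_of_hess_eq (isK_of_mem_KEpsSet hF' h hP')
    ((hess_eq_locTensor hF.2.1.1 hF.2.1.2 h1 h2 h hP).trans
      (hess_eq_locTensor hF'.2.1.1 hF'.2.1.2 h1' h2' h hP').symm)
  exact ⟨P, hP, e ▸ hP'⟩

/-- Local Hamiltonians come from `IsKP.exists_isK`. Being determined by their Hessians, they are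
compatible with restriction and change of chart, so they glue. -/
theorem Deformation.exists_mem_KEpsSet (d : Deformation n M) : ∃ F ∈ KEpsSet n M,
    FormalFun.QuadraticPartEq F.fst d.g ∧ FormalFun.QuadraticPartEq F.snd d.h := by
  choose R hR hess_R using fun c V (h : ChartDomain c V) => (d.isKP h).exists_isK
  obtain ⟨F, hF⟩ := exists_repE_of_family R
    (fun c V V' h h' hV => by
      refine ((isMorphism_resAlg h h' hV).dualMap.isK (hR c V h)).eq_of_hess_eq (hR c V' h') ?_
      ext1 i
      ext1 j
      rw [hess_map, hess_R, hess_R, locTensor_res d.g d.h h h' hV]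
      rfl)
    (fun c c' V h h' => by
      refine Coords.IsK.trans_eq (typeCompatible_chartCoords h' h).eps (hR c' V h') (hR c V h) ?_
      intro i j
      rw [hess_R, hess_R, locTensor_trans d.g d.h h' h])
  have hmem : F ∈ KEpsSet n M := mem_KEpsSet_of_isK fun c V h => ⟨R c V h, hF c V h, hR c V h⟩
  refine ⟨F, hmem, (quadraticPartEq_iff hmem.2.1.1 d.g).2 fun x => ?_,
    (quadraticPartEq_iff hmem.2.1.2 d.h).2 fun x => ?_⟩
  · have h := ChartDomain.source (chart_mem_atlas (Fin n → ℂ) x)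
    rw [← chartValue_chartAt F.fst x, ← blockMat_coord_chartAt]
    ext i j
    rw [← (hF _ _ h).1.hess_apply i j ⟨x, mem_chart_source _ x⟩, ← fst_hess, hess_R,
      fst_locTensor_apply]
  · have h := ChartDomain.source (chart_mem_atlas (Fin n → ℂ) x)
    rw [← chartValue_chartAt F.snd x, ← blockMat_coord_chartAt]
    ext i j
    rw [← (hF _ _ h).2.hess_apply i j ⟨x, mem_chart_source _ x⟩, ← snd_hess, hess_R,
      snd_locTensor_apply]

/-- The tensor formed by the second derivatives of a formal function on the zero section. -/
def hessTensor (Φ : FormalFun n M) (hΦ : FormalFun.IsSmooth Φ)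
    (h0 : ∀ x i j, holType n i = holType n j → hess (Φ x) i j = 0) : Tensor n M where
  val x l k := hess (Φ x) (Sum.inl k) (Sum.inr l)
  smooth' c hc l k := by
    have h := ChartDomain.source hc
    obtain ⟨P, hP⟩ := hΦ.exists_rep h
    refine (h.contDiffOn (hess P (Sum.inl k) (Sum.inr l)).smoothOn).congr_mono (fun y hy => ?_)
      (fun y hy => ⟨hy, c.map_target hy⟩)
    have hx := c.map_target hy
    have e := blockMat_jacobian hc hx (fun l k => hess (Φ (c.symm y)) (Sum.inl k) (Sum.inr l))
      (Sum.inl k) (Sum.inr l)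
    rw [← eq_blockMat (hess_symm _) (h0 _), ← hess_chartValue,
      ← hP.hess_apply _ _ ⟨c.symm y, hx⟩] at e
    rw [Function.comp_apply, LocFun.fn_apply _ ⟨c.symm y, hx⟩]
    exact e

/-- The Hessian along the zero section transforms as a tensor of type `(1,1)` because its blocks of
equal type vanish. `IsK.isKP` over the dual numbers supplies the equations for both components at
once. -/
theorem exists_deformation (hF : F ∈ KEpsSet n M) : ∃ d : Deformation n M,
    FormalFun.QuadraticPartEq F.fst d.g ∧ FormalFun.QuadraticPartEq F.snd d.h := by
  have h0 : ∀ x i j, holType n i = holType n j →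
      hess (F.fst x) i j = 0 ∧ hess (F.snd x) i j = 0 := by
    intro x i j hij
    obtain ⟨P, hP, hK⟩ := exists_repE_chartAt hF x
    have e := hK.hess_eq_zero hij
    rw [← chartValue_chartAt F.fst x, ← chartValue_chartAt F.snd x,
      ← hP.1.hess_apply i j ⟨x, mem_chart_source _ x⟩,
      ← hP.2.hess_apply i j ⟨x, mem_chart_source _ x⟩, ← fst_hess, ← snd_hess, e]
    exact ⟨rfl, rfl⟩
  set g := hessTensor F.fst hF.1.1 fun x i j hij => (h0 x i j hij).1 with hg
  set g' := hessTensor F.snd hF.1.2 fun x i j hij => (h0 x i j hij).2 with hg'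
  have h1 : FormalFun.QuadraticPartEq F.fst g := (quadraticPartEq_iff hF.2.1.1 g).2 fun x =>
    eq_blockMat (hess_symm _) fun i j hij => (h0 x i j hij).1
  have h2 : FormalFun.QuadraticPartEq F.snd g' := (quadraticPartEq_iff hF.2.1.2 g').2 fun x =>
    eq_blockMat (hess_symm _) fun i j hij => (h0 x i j hij).2
  have hkp : ∀ c (hc : c ∈ atlas (Fin n → ℂ) M),
      (chartCoords (ChartDomain.source hc)).eps.IsKP (holType n)
        (locTensor g g' (ChartDomain.source hc)) := fun c hc => by
    obtain ⟨P, hP⟩ := exists_repE hF.1.1 hF.1.2 (ChartDomain.source hc)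
    rw [← hess_eq_locTensor hF.2.1.1 hF.2.1.2 h1 h2 (ChartDomain.source hc) hP]
    exact (isK_of_mem_KEpsSet hF _ hP).isKP
  refine ⟨⟨g, g', fun c hc y hy => ?_, fun c hc y hy => ?_⟩, h1, h2⟩ <;>
    have e := (isKP_locTensor_iff g g' _).1 (hkp c hc) (c.symm y) (c.map_target hy) <;>
    rw [c.right_inv hy] at e
  · exact e.1
  · exact e.2

theorem Tensor.ext_of_val {g g' : Tensor n M} (h : g.val = g'.val) : g = g' := by
  cases g; cases g'; simpa using h

theorem tensor_eq_of_quadraticPartEq {g g' : Tensor n M} (hΦ : FormalFun.StartsQuadratic Φ)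
    (h : FormalFun.QuadraticPartEq Φ g) (h' : FormalFun.QuadraticPartEq Φ g') : g = g' := by
  rw [quadraticPartEq_iff hΦ] at h h'
  exact Tensor.ext_of_val (funext fun x => blockMat_injective ((h x).symm.trans (h' x)))

theorem Deformation.ext' {d d' : Deformation n M} (h1 : d.g = d'.g) (h2 : d.h = d'.h) : d = d' := by
  cases d; cases d'; simp_all

/-- The element of `𝒦[ε]` with given quadratic part. -/
def theta (d : Deformation n M) : KEpsSet n M :=
  ⟨d.exists_mem_KEpsSet.choose, d.exists_mem_KEpsSet.choose_spec.1⟩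

theorem theta_spec (d : Deformation n M) : FormalFun.QuadraticPartEq (theta d).1.fst d.g ∧
    FormalFun.QuadraticPartEq (theta d).1.snd d.h := d.exists_mem_KEpsSet.choose_spec.2

theorem eq_theta_iff (d : Deformation n M) (F : KEpsSet n M) :
    F = theta d ↔ FormalFun.QuadraticPartEq F.1.fst d.g ∧
      FormalFun.QuadraticPartEq F.1.snd d.h := by
  refine ⟨fun h => h ▸ theta_spec d, fun h => Subtype.ext ?_⟩
  exact eq_of_quadraticPartEq F.2 (theta d).2 h.1 h.2 (theta_spec d).1 (theta_spec d).2

theorem theta_bijective : Function.Bijective (theta : Deformation n M → KEpsSet n M) := by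
  refine ⟨fun d d' h => ?_, fun F => ?_⟩
  · have h1 := theta_spec d
    have h2 := theta_spec d'
    rw [← h] at h2
    exact Deformation.ext' (tensor_eq_of_quadraticPartEq (theta d).2.2.1.1 h1.1 h2.1)
      (tensor_eq_of_quadraticPartEq (theta d).2.2.1.2 h1.2 h2.2)
  · obtain ⟨d, hd⟩ := exists_deformation F.2
    exact ⟨d, ((eq_theta_iff d F).2 hd).symm⟩

end Theta

end KahlerPoisson
end

noncomputable section

namespace KahlerPoisson

open MvPowerSeries TrivSqZeroExt

/-! ### The bracket of functions in a chart -/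

/-- The sign distinguishing source from target arises here: the algebraic bracket is the Poisson
bracket for type `true` and its opposite for type `false`. -/
theorem Coords.pb_blockMat {n : ℕ} {A : Type*} [CommRing A] [Algebra ℂ A]
    (c : Coords (Idx n) A) (v : Fin n → Fin n → A) (u w : A) :
    c.pb (holType n) (blockMat v) true u w = ∑ l, ∑ k, v l k *
      (c.d (Sum.inr l) u * c.d (Sum.inl k) w - c.d (Sum.inl k) u * c.d (Sum.inr l) w) ∧
    c.pb (holType n) (blockMat v) false u w = -∑ l, ∑ k, v l k *
      (c.d (Sum.inr l) u * c.d (Sum.inl k) w - c.d (Sum.inl k) u * c.d (Sum.inr l) w) := by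
  have h1 : ∀ (k : Fin n) (u : A), c.vf (holType n) (blockMat v) true (Sum.inl k) u =
      ∑ l, v l k * c.d (Sum.inr l) u := fun k u => by
    rw [vf_apply _ _ _ _ (by rfl)]; simp [Fintype.sum_sum_type, blockMat]
  have h2 : ∀ (k : Fin n) (u : A), c.vf (holType n) (blockMat v) true (Sum.inr k) u = 0 :=
    fun k u => vf_eq_zero _ _ _ _ (by simp) u
  have h3 : ∀ (k : Fin n) (u : A), c.vf (holType n) (blockMat v) false (Sum.inl k) u = 0 :=
    fun k u => vf_eq_zero _ _ _ _ (by simp) u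
  have h4 : ∀ (l : Fin n) (u : A), c.vf (holType n) (blockMat v) false (Sum.inr l) u =
      ∑ k, v l k * c.d (Sum.inl k) u := fun k u => by
    rw [vf_apply _ _ _ _ (by rfl)]; simp [Fintype.sum_sum_type, blockMat]
  constructor
  · simp only [pb, Fintype.sum_sum_type, h1, h2, zero_mul, mul_zero, sub_zero,
      Finset.sum_const_zero, add_zero, Finset.sum_mul, Finset.mul_sum, ← Finset.sum_sub_distrib]
    rw [Finset.sum_comm]
    exact Finset.sum_congr rfl fun _ _ => Finset.sum_congr rfl fun _ _ => by ring
  · simp only [pb, Fintype.sum_sum_type, h3, h4, zero_mul, mul_zero, sub_zero,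
      Finset.sum_const_zero, zero_add, Finset.sum_mul, Finset.mul_sum, ← Finset.sum_sub_distrib,
      ← Finset.sum_neg_distrib]
    exact Finset.sum_congr rfl fun _ _ => Finset.sum_congr rfl fun _ _ => by ring

section Source

variable {n : ℕ} {M : Type*} [TopologicalSpace M] [ChartedSpace (Fin n → ℂ) M]
  {c c' : OpenPartialHomeomorph M (Fin n → ℂ)} {V V' : Set M} {x : M}

theorem SmoothFun.smoothOn (f : SmoothFun n M) (V : Set M) : SmoothOn n (f : M → ℂ) V :=
  ContMDiff.contMDiffOn f.2

/-- The restriction of a smooth function to `V`. -/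
def SmoothFun.toLoc (V : Set M) : SmoothFun n M →ₐ[ℂ] LocFun n V where
  toFun f := LocFun.mk f (SmoothFun.smoothOn f V)
  map_one' := rfl
  map_mul' _ _ := rfl
  map_zero' := rfl
  map_add' _ _ := rfl
  commutes' _ := rfl

theorem SmoothFun.toLoc_apply (f : SmoothFun n M) (V : Set M) :
    SmoothFun.toLoc V f = LocFun.mk f (SmoothFun.smoothOn f V) := rfl

variable [IsManifold 𝓘(ℂ, Fin n → ℂ) ω M]

theorem Tensor.toLoc_bracket (g : Tensor n M) (h : ChartDomain c V) (f f' : SmoothFun n M) :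
    SmoothFun.toLoc V (g.bracket f f') = ∑ l, ∑ k, g.loc h l k *
      ((chartCoords h).d (Sum.inr l) (SmoothFun.toLoc V f) *
          (chartCoords h).d (Sum.inl k) (SmoothFun.toLoc V f') -
        (chartCoords h).d (Sum.inl k) (SmoothFun.toLoc V f) *
          (chartCoords h).d (Sum.inr l) (SmoothFun.toLoc V f')) := LocFun.ext' fun x => by
  refine (g.bracketAt_eq f f' h.mem_atlas (h.subset x.2)).trans ?_
  rw [← LocFun.ev_apply, map_sum]
  refine Finset.sum_congr rfl fun l _ => ?_
  rw [map_sum]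
  refine Finset.sum_congr rfl fun k _ => ?_
  have hd : ∀ (u : SmoothFun n M) (i : Idx n),
      LocFun.ev x ((chartCoords h).d i (SmoothFun.toLoc V u)) = dW i ((u : M → ℂ) ∘ c.symm) (c x) :=
    fun u i => chartCoords_d_mk h i (SmoothFun.smoothOn u V) x
  rw [map_mul, map_sub, map_mul, map_mul, hd, hd, hd, hd, dW_inl, dW_inl, dW_inr, dW_inr]
  rfl

theorem Deformation.toLoc_bracket (d : Deformation n M) (h : ChartDomain c V)
    (f f' : (SmoothFun n M)[ε]) :
    dualMap (SmoothFun.toLoc V) (d.bracket f f') = (chartCoords h).eps.pb (holType n)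
      (locTensor d.g d.h h) true (dualMap (SmoothFun.toLoc V) f)
        (dualMap (SmoothFun.toLoc V) f') := by
  rw [locTensor, (Coords.pb_blockMat _ _ _ _).1]
  ext
  · simp only [fst_dualMap, Deformation.bracket, fst_add, fst_inl, fst_inr, add_zero, fst_sum,
      fst_mul, fst_sub, Coords.eps_d, fst_dualDer, d.g.toLoc_bracket h]
  · simp only [snd_dualMap, Deformation.bracket, snd_add, snd_inl, snd_inr, zero_add, snd_sum,
      snd_mul, snd_sub, Coords.eps_d, snd_dualDer, fst_dualDer, fst_dualMap, map_add, fst_mul,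
      fst_sub, fst_add, fst_inl, fst_inr, add_zero, smul_eq_mul, MulOpposite.smul_eq_mul_unop,
      MulOpposite.unop_op, d.g.toLoc_bracket h, d.h.toLoc_bracket h, ← Finset.sum_add_distrib,
      map_zero,
      zero_add]
    exact Finset.sum_congr rfl fun _ _ => Finset.sum_congr rfl fun _ _ => by ring

/-! ### The source and target mappings -/

/-- The local exponentials are compatible with restriction (`map_src`) and with changes of chart
(`trans_src`), so they glue. -/
theorem Deformation.exists_srcFun (d : Deformation n M) (t : Bool) (u : (SmoothFun n M)[ε]) :
    ∃ F : (FormalFun n M)[ε], ∀ c V (h : ChartDomain c V),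
      RepE c V F ((chartCoords h).eps.src (holType n) (locTensor d.g d.h h) t
        (dualMap (SmoothFun.toLoc V) u)) := by
  refine exists_repE_of_family (fun c V h => (chartCoords h).eps.src (holType n)
    (locTensor d.g d.h h) t (dualMap (SmoothFun.toLoc V) u)) (fun c V V' h h' hV => ?_)
    (fun c c' V h h' => ?_)
  · rw [(isMorphism_resAlg h h' hV).dualMap.map_src (d.isKP h) (d.isKP h')
      (locTensor_res d.g d.h h h' hV)]
    congr 1
    ext
    · simp only [fst_dualMap]
      exact LocFun.ext' fun x => LocFun.ev_res hV x (SmoothFun.toLoc V u.fst)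
    · simp only [snd_dualMap]
      exact LocFun.ext' fun x => LocFun.ev_res hV x (SmoothFun.toLoc V u.snd)
  · exact Coords.IsKP.trans_src (typeCompatible_chartCoords h' h).eps (d.isKP h') (d.isKP h)
      (locTensor_trans d.g d.h h' h) t _

/-- The source mapping (for `t = true`) and the target mapping (for `t = false`). -/
def Deformation.srcFun (d : Deformation n M) (t : Bool) (u : (SmoothFun n M)[ε]) :
    (FormalFun n M)[ε] := (d.exists_srcFun t u).choose

theorem Deformation.repE_srcFun (d : Deformation n M) (t : Bool) (u : (SmoothFun n M)[ε])
    (h : ChartDomain c V) : RepE c V (d.srcFun t u) ((chartCoords h).eps.src (holType n)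
      (locTensor d.g d.h h) t (dualMap (SmoothFun.toLoc V) u)) :=
  (d.exists_srcFun t u).choose_spec c V h

theorem Rep.one : Rep c V (1 : FormalFun n M) 1 := fun x => by
  rw [chartValue, Pi.one_apply, map_one, map_one]

theorem Deformation.srcFun_add (d : Deformation n M) (t : Bool) (u v : (SmoothFun n M)[ε]) :
    d.srcFun t (u + v) = d.srcFun t u + d.srcFun t v := eq_of_repE fun c hc => by
  have h := ChartDomain.source hc
  refine ⟨_, d.repE_srcFun t (u + v) h, ?_⟩
  rw [map_add, Coords.src_add]
  exact (d.repE_srcFun t u h).add (d.repE_srcFun t v h)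

theorem Deformation.srcFun_mul (d : Deformation n M) (t : Bool) (u v : (SmoothFun n M)[ε]) :
    d.srcFun t (u * v) = d.srcFun t u * d.srcFun t v := eq_of_repE fun c hc => by
  have h := ChartDomain.source hc
  refine ⟨_, d.repE_srcFun t (u * v) h, ?_⟩
  rw [map_mul, Coords.src_mul]
  exact (d.repE_srcFun t u h).mul (d.repE_srcFun t v h)

theorem Deformation.srcFun_algebraMap (d : Deformation n M) (t : Bool) (r : ℂ) :
    d.srcFun t (algebraMap ℂ _ r) = algebraMap ℂ _ r := eq_of_repE fun c hc => by
  have h := ChartDomain.source hc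
  refine ⟨_, d.repE_srcFun t _ h, ?_⟩
  rw [AlgHom.commutes, (d.isKP h).src_eq_C t fun i _ => Derivation.map_algebraMap _ r]
  exact RepE.inl_ofFun (f := fun _ => r) contMDiffOn_const

theorem Deformation.srcFun_eps (d : Deformation n M) (t : Bool) :
    d.srcFun t DualNumber.eps = DualNumber.eps := eq_of_repE fun c hc => by
  have h := ChartDomain.source hc
  refine ⟨_, d.repE_srcFun t _ h, ?_⟩
  have e : dualMap (SmoothFun.toLoc c.source) (DualNumber.eps : (SmoothFun n M)[ε]) =
      DualNumber.eps := by
    ext <;> simp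
  rw [e, (d.isKP h).src_eq_C t fun i _ => by ext <;> simp [Coords.eps_d]]
  refine ⟨?_, ?_⟩
  · rw [sfst_C, DualNumber.fst_eps, DualNumber.fst_eps, map_zero]; exact Rep.zero
  · rw [ssnd_C, DualNumber.snd_eps, DualNumber.snd_eps, map_one]; exact Rep.one

/-- The source and target mappings as homomorphisms of algebras. -/
def Deformation.srcHom (d : Deformation n M) (t : Bool) :
    (SmoothFun n M)[ε] →ₐ[ℂ] (FormalFun n M)[ε] where
  toFun := d.srcFun t
  map_one' := by simpa using d.srcFun_algebraMap t 1
  map_mul' := d.srcFun_mul t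
  map_zero' := by simpa using d.srcFun_algebraMap t 0
  map_add' := d.srcFun_add t
  commutes' := d.srcFun_algebraMap t

theorem RepE.E_eq {F : (FormalFun n M)[ε]} {P : MvPowerSeries (Idx n) (LocFun n V)[ε]}
    (hP : RepE c V F P) (x : V) :
    FormalFun.E F.fst x = (constantCoeff P).fst.1 x ∧
      FormalFun.E F.snd x = (constantCoeff P).snd.1 x := by
  have key : ∀ {Φ : FormalFun n M} {P}, Rep c V Φ P → FormalFun.E Φ x = (coeff 0 P).1 x := by
    intro Φ P hP
    have e := congrArg constantCoeff (hP x)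
    rw [chartValue, constantCoeff_linSubst, constantCoeff_map] at e
    exact e
  refine ⟨(key hP.1).trans ?_, (key hP.2).trans ?_⟩
  · rw [coeff_sfst]; rfl
  · rw [coeff_ssnd]; rfl

theorem Deformation.E_srcFun (d : Deformation n M) (t : Bool) (u : (SmoothFun n M)[ε]) :
    FormalFun.E (d.srcFun t u).fst = u.fst ∧ FormalFun.E (d.srcFun t u).snd = u.snd := by
  have key := fun x : M => (d.repE_srcFun t u (ChartDomain.source
    (chart_mem_atlas (Fin n → ℂ) x))).E_eq
    ⟨x, mem_chart_source _ x⟩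
  simp only [Coords.constantCoeff_src, fst_dualMap, snd_dualMap] at key
  exact ⟨funext fun x => (key x).1, funext fun x => (key x).2⟩

/-- The deformation formal symplectic groupoid with separation of variables. -/
def Deformation.groupoid (d : Deformation n M) : DefGroupoid d where
  S := d.srcHom true
  T := d.srcHom false
  eps_S := d.srcFun_eps true
  eps_T := d.srcFun_eps false
  smooth_S u := RepE.isSmooth fun _ hc => ⟨_, d.repE_srcFun true u (ChartDomain.source hc)⟩
  smooth_T u := RepE.isSmooth fun _ hc => ⟨_, d.repE_srcFun false u (ChartDomain.source hc)⟩
  unit_S := d.E_srcFun true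
  unit_T := d.E_srcFun false
  poisson_S u v := eq_of_repE fun c hc => by
    have h := ChartDomain.source hc
    refine ⟨_, d.repE_srcFun true _ h, ?_⟩
    rw [d.toLoc_bracket h, ← (d.isKP h).br_src]
    exact RepE.bracketEps h (d.repE_srcFun true u h) (d.repE_srcFun true v h)
  poisson_T u v := eq_of_repE fun c hc => by
    have h := ChartDomain.source hc
    refine ⟨_, d.repE_srcFun false _ h, ?_⟩
    have e : ∀ u v, (chartCoords h).eps.pb (holType n) (locTensor d.g d.h h) true u v =
        -(chartCoords h).eps.pb (holType n) (locTensor d.g d.h h) false u v := fun u v => by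
      rw [locTensor, (Coords.pb_blockMat _ _ _ _).1, (Coords.pb_blockMat _ _ _ _).2, neg_neg]
    have e' : ∀ u, (chartCoords h).eps.src (holType n) (locTensor d.g d.h h) false (-u) =
        -(chartCoords h).eps.src (holType n) (locTensor d.g d.h h) false u := fun u => by
      rw [eq_neg_iff_add_eq_zero, ← Coords.src_add, neg_add_cancel, Coords.src_zero]
    rw [d.toLoc_bracket h, e, e', ← (d.isKP h).br_src]
    exact (RepE.bracketEps h (d.repE_srcFun false u h) (d.repE_srcFun false v h)).neg
  commute u v := eq_of_repE fun c hc => by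
    have h := ChartDomain.source hc
    refine ⟨_, RepE.bracketEps h (d.repE_srcFun true u h) (d.repE_srcFun false v h), ?_⟩
    have e := (d.isKP h).br_src_src true (dualMap (SmoothFun.toLoc c.source) u)
      (dualMap (SmoothFun.toLoc c.source) v)
    rw [Bool.not_true] at e
    rw [e]
    exact RepE.zero

theorem dualMap_inl {A B : Type*} [CommRing A] [Algebra ℂ A] [CommRing B] [Algebra ℂ B]
    (f : A →ₐ[ℂ] B) (a : A) : dualMap f (inl a) = inl (f a) := by
  ext <;> simp

theorem Deformation.groupoid_separatesVariables (d : Deformation n M) :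
    d.groupoid.SeparatesVariables := by
  refine ⟨fun V hV a ha => eqOnEps_of_local fun x hx => ?_,
    fun V hV b hb => eqOnEps_of_local fun x hx => ?_⟩
  · have h := (ChartDomain.source (chart_mem_atlas (Fin n → ℂ) x)).mono
      (hV.inter (chartAt (Fin n → ℂ) x).open_source) Set.inter_subset_right
    refine ⟨_, _, h, ⟨hx, mem_chart_source _ x⟩, _, d.repE_srcFun true _ h, ?_⟩
    rw [dualMap_inl, SmoothFun.toLoc_apply, (d.isKP h).src_eq_C true fun i hi => Coords.eps_d_inl
      ((ha.mono Set.inter_subset_left).d_eq_zero h (SmoothFun.smoothOn a _) hi)]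
    exact RepE.inl_ofFun (SmoothFun.smoothOn a _)
  · have h := (ChartDomain.source (chart_mem_atlas (Fin n → ℂ) x)).mono
      (hV.inter (chartAt (Fin n → ℂ) x).open_source) Set.inter_subset_right
    refine ⟨_, _, h, ⟨hx, mem_chart_source _ x⟩, _, d.repE_srcFun false _ h, ?_⟩
    rw [dualMap_inl, SmoothFun.toLoc_apply, (d.isKP h).src_eq_C false fun i hi => Coords.eps_d_inl
      (AntiholOn.d_eq_zero (HolOn.mono hb Set.inter_subset_left) h (SmoothFun.smoothOn b _) hi)]
    exact RepE.inl_ofFun (SmoothFun.smoothOn b _)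

/-- Locally `S(ab) = S(a) S(b) = a S(b)`, and `flow_C_eq_src` identifies `S(b)` with `e^{H_F} b`,
the Hessian of `F` being the tensor that defines `S`. The argument for `T` is symmetric. -/
theorem Deformation.groupoid_givenBy (d : Deformation n M) : d.groupoid.GivenBy (theta d).1 := by
  intro V hV a b ha hb f hf
  have key : ∀ x ∈ V, ∃ c V', ∃ h : ChartDomain c V', x ∈ V' ∧ ∃ (has : SmoothOn n a V')
      (hbs : SmoothOn n b V'),
      (∀ i, holType n i ≠ true → (chartCoords h).d i (LocFun.mk a has) = 0) ∧
      (∀ i, holType n i ≠ false → (chartCoords h).d i (LocFun.mk b hbs) = 0) ∧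
      dualMap (SmoothFun.toLoc V') (inl f) = inl (LocFun.mk a has) * inl (LocFun.mk b hbs) ∧
      ∃ P, RepE c V' (theta d).1 P ∧ (chartCoords h).eps.IsK (holType n) P ∧
        hess P = locTensor d.g d.h h := by
    intro x hx
    have h := (ChartDomain.source (chart_mem_atlas (Fin n → ℂ) x)).mono
      (hV.inter (chartAt (Fin n → ℂ) x).open_source) Set.inter_subset_right
    have ha' := ha.mono (V' := V ∩ (chartAt (Fin n → ℂ) x).source) Set.inter_subset_left
    have hb' : AntiholOn n b (V ∩ (chartAt (Fin n → ℂ) x).source) :=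
      HolOn.mono hb Set.inter_subset_left
    obtain ⟨P, hP⟩ := exists_repE (theta d).2.1.1 (theta d).2.1.2 h
    refine ⟨_, _, h, ⟨hx, mem_chart_source _ x⟩, ha'.smoothOn h, hb'.smoothOn h,
      fun i hi => ha'.d_eq_zero h _ hi, fun i hi => hb'.d_eq_zero h _ hi, ?_, P, hP,
      isK_of_mem_KEpsSet (theta d).2 h hP, hess_eq_locTensor (theta d).2.2.1.1 (theta d).2.2.1.2
        (theta_spec d).1 (theta_spec d).2 h hP⟩
    rw [dualMap_inl, ← inl_mul]
    congr 1
    exact LocFun.ext' fun y => hf y.2.1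
  constructor
  · refine eqOnEps_of_local fun x hx => ?_
    obtain ⟨c, V', h, hxV, has, hbs, hda, hdb, hmul, P, hP, hK, hh⟩ := key x hx
    refine ⟨c, V', h, hxV, _, d.repE_srcFun true _ h, ?_⟩
    rw [hmul, Coords.src_mul, (d.isKP h).src_eq_C true fun i hi => Coords.eps_d_inl (hda i hi),
      ← hh, ← hK.flow_C_eq_src fun i hi => Coords.eps_d_inl (hdb i (by simp [hi]))]
    exact (RepE.inl_ofFun has).mul (hP.expHEps h (RepE.inl_ofFun hbs) hK.1)
  · refine eqOnEps_of_local fun x hx => ?_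
    obtain ⟨c, V', h, hxV, has, hbs, hda, hdb, hmul, P, hP, hK, hh⟩ := key x hx
    refine ⟨c, V', h, hxV, _, d.repE_srcFun false _ h, ?_⟩
    rw [hmul, Coords.src_mul, (d.isKP h).src_eq_C false fun i hi => Coords.eps_d_inl (hdb i hi),
      ← hh, ← hK.flow_C_eq_src fun i hi => Coords.eps_d_inl (hda i (by simp [hi]))]
    exact (hP.expHEps h (RepE.inl_ofFun has) hK.1).mul (RepE.inl_ofFun hbs)

end Source

end KahlerPoisson
end

noncomputable section

namespace KahlerPoisson

open MvPowerSeries TrivSqZeroExt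

/-! ### Uniqueness of the source and target mappings -/

section Unique

variable {n : ℕ} {M : Type*} [TopologicalSpace M] [ChartedSpace (Fin n → ℂ) M]
  [IsManifold 𝓘(ℂ, Fin n → ℂ) ω M] {x : M}

/-- A smooth function on `M` is a local coordinate near `x`. -/
structure IsCoordAt (x : M) (i : Idx n) (f : SmoothFun n M) (V : Set M) : Prop where
  domain : ChartDomain (chartAt (Fin n → ℂ) x) V
  mem : x ∈ V
  eqOn : Set.EqOn (f : M → ℂ) (coordFun i ∘ chartAt (Fin n → ℂ) x) V

/-- The separation conditions concern global smooth functions, so a coordinate is multiplied by a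
bump function equal to one near `x`. The Hausdorff property makes the product globally smooth. -/
theorem exists_isCoordAt [T2Space M] (x : M) (i : Idx n) :
    ∃ (f : SmoothFun n M) (V : Set M), IsCoordAt x i f V := by
  have := isManifold_real (n := n) (M := M)
  have hc := ChartDomain.source (chart_mem_atlas (Fin n → ℂ) x)
  obtain ⟨χ⟩ : Nonempty (SmoothBumpFunction 𝓘(ℝ, Fin n → ℂ) x) := inferInstance
  have hf : ContMDiff 𝓘(ℝ, Fin n → ℂ) 𝓘(ℝ, ℂ) ∞
      fun y => χ y • (coordFun i ∘ chartAt (Fin n → ℂ) x) y :=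
    χ.contMDiff_smul (smoothOn_coordFun hc i)
  obtain ⟨U, hU, hUo, hxU⟩ := eventually_nhds_iff.1 χ.eventuallyEq_one
  refine ⟨⟨_, hf⟩, U ∩ (chartAt (Fin n → ℂ) x).source,
    hc.mono (hUo.inter hc.isOpen) Set.inter_subset_right, ⟨hxU, mem_chart_source _ x⟩,
    fun y hy => ?_⟩
  change χ y • (coordFun i ∘ chartAt (Fin n → ℂ) x) y = _
  rw [hU y hy.1, Pi.one_apply, one_smul]

theorem IsCoordAt.holOn {k : Fin n} {f : SmoothFun n M} {V : Set M}
    (h : IsCoordAt x (Sum.inl k) f V) : HolOn n (f : M → ℂ) V :=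
  MDifferentiableOn.congr (holOn_coordFun h.domain k) h.eqOn

theorem IsCoordAt.antiholOn {k : Fin n} {f : SmoothFun n M} {V : Set M}
    (h : IsCoordAt x (Sum.inr k) f V) : AntiholOn n (f : M → ℂ) V :=
  MDifferentiableOn.congr (antiholOn_coordFun h.domain k) fun y hy => by
    rw [h.eqOn hy]

/-- Near `x` the function is a coordinate, so `br_x` applies at `x` whatever the function is
elsewhere. -/
theorem IsCoordAt.bracket_apply {i : Idx n} {f : SmoothFun n M} {V : Set M}
    (h : IsCoordAt x i f V) {Φ Ψ : FormalFun n M} (hΦ : FormalFun.IsSmooth Φ)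
    (hΨ : Set.EqOn Ψ (FormalFun.ofFun f) V) : FormalFun.bracket Φ Ψ x = dxi i (Φ x) := by
  obtain ⟨P, hP⟩ := hΦ.exists_rep h.domain
  have hQ : Rep (chartAt (Fin n → ℂ) x) V Ψ (C ((chartCoords h.domain).x i)) :=
    (Rep.ofFun (smoothOn_coordFun h.domain i)).congr fun y hy => by
      rw [hΨ hy, FormalFun.ofFun, FormalFun.ofFun, h.eqOn hy]
  have e := hP.bracket h.domain hQ ⟨x, h.mem⟩
  rw [Coords.br_x, map_dxi, ← hP ⟨x, h.mem⟩, chartValue_chartAt, chartValue_chartAt] at e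
  exact e

theorem bracket_apply_eq_zero {V : Set M} (h : ChartDomain (chartAt (Fin n → ℂ) x) V) (hx : x ∈ V)
    {Φ Ψ : FormalFun n M} (hΦ : FormalFun.IsSmooth Φ) (hΨ : Set.EqOn Ψ 0 V) :
    FormalFun.bracket Φ Ψ x = 0 := by
  obtain ⟨P, hP⟩ := hΦ.exists_rep h
  have e := hP.bracket h (Rep.zero.congr hΨ.symm) ⟨x, hx⟩
  rw [Coords.br_zero_right, map_zero, chartValue_chartAt] at e
  exact e

theorem IsCoordAt.bracketEps_apply {i : Idx n} {f : SmoothFun n M} {V : Set M}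
    (h : IsCoordAt x i f V) {F G : (FormalFun n M)[ε]}
    (hF : FormalFun.IsSmooth F.fst ∧ FormalFun.IsSmooth F.snd)
    (hG : FormalFun.EqOnEps G (inl (FormalFun.ofFun f)) V) :
    (FormalFun.bracketEps F G).fst x = dxi i (F.fst x) ∧
      (FormalFun.bracketEps F G).snd x = dxi i (F.snd x) := by
  refine ⟨?_, ?_⟩
  · rw [fst_bracketEps]; exact h.bracket_apply hF.1 hG.1
  · rw [snd_bracketEps, Pi.add_apply, bracket_apply_eq_zero h.domain h.mem hF.1 hG.2, zero_add]
    exact h.bracket_apply hF.2 hG.1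

theorem bracket_swap (Φ Ψ : FormalFun n M) : FormalFun.bracket Φ Ψ = -FormalFun.bracket Ψ Φ := by
  ext1 x
  rw [Pi.neg_apply, FormalFun.bracket, FormalFun.bracket, localBracket, localBracket,
    ← Finset.sum_neg_distrib]
  exact Finset.sum_congr rfl fun k _ => by ring

theorem bracketEps_swap (F G : (FormalFun n M)[ε]) :
    FormalFun.bracketEps F G = -FormalFun.bracketEps G F := by
  refine TrivSqZeroExt.ext ?_ ?_
  · rw [fst_neg, fst_bracketEps, fst_bracketEps, bracket_swap]
  · rw [snd_neg, snd_bracketEps, snd_bracketEps, bracket_swap F.fst, bracket_swap F.snd]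
    abel

/-- Two families solving the same closed linear system in the fibre variables agree if they agree on
the zero section. The scalar `r` will be `0`, `1` or `-1`, according to the mapping and the type of
the coordinate. -/
theorem eq_of_dxi {ι : Type*} (A B : ι → FiberSeries n)
    (h0 : ∀ u, constantCoeff (A u) = constantCoeff (B u))
    (h : ∀ i, ∃ (s : ι → ι) (r : ℂ), ∀ u, dxi i (A u) = r • A (s u) ∧ dxi i (B u) = r • B (s u))
    (u : ι) : A u = B u := by
  refine sub_eq_zero.1 (eq_zero_of_pderiv_mem_span (fun u => A u - B u)
    (fun u => by rw [map_sub, h0, sub_self]) (fun u i => ?_) u)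
  obtain ⟨s, r, hs⟩ := h i
  rw [← dxi_apply, map_sub, (hs u).1, (hs u).2, ← smul_sub, MvPowerSeries.smul_eq_C_mul]
  exact Ideal.mul_mem_left _ _ (Ideal.subset_span ⟨s u, rfl⟩)

theorem DefGroupoid.ext' {d : Deformation n M} {G G' : DefGroupoid d} (hS : G.S = G'.S)
    (hT : G.T = G'.T) : G = G' := by
  cases G; cases G'; simp_all

theorem Groupoid.ext' {g : Tensor n M} {G G' : Groupoid g} (hS : G.S = G'.S)
    (hT : G.T = G'.T) : G = G' := by
  cases G; cases G'; simp_all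

/-- For a holomorphic coordinate, `{S u, z} = {S u, S z} = S{u, z}`; for an antiholomorphic one, `{S
u, z̄} = {S u, T z̄} = 0`. So the axioms prescribe all fibre derivatives of `S u`. -/
theorem DefGroupoid.dxi_S {d : Deformation n M} {G : DefGroupoid d} (hG : G.SeparatesVariables)
    {i : Idx n} {f : SmoothFun n M} {V : Set M} (h : IsCoordAt x i f V)
    (u : (SmoothFun n M)[ε]) :
    let r : ℂ := if holType n i then 1 else 0
    dxi i ((G.S u).fst x) = r • (G.S (d.bracket u (inl f))).fst x ∧
      dxi i ((G.S u).snd x) = r • (G.S (d.bracket u (inl f))).snd x := by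
  rcases i with k | k
  · have e := h.bracketEps_apply (G.smooth_S u) (hG.1 V h.domain.isOpen f h.holOn)
    rw [← G.poisson_S] at e
    simp [e]
  · have e := h.bracketEps_apply (G.smooth_S u) (hG.2 V h.domain.isOpen f h.antiholOn)
    rw [G.commute] at e
    simp [← e]

/-- The types exchange their roles, and the minus sign reflects that `T` reverses the bracket. -/
theorem DefGroupoid.dxi_T {d : Deformation n M} {G : DefGroupoid d} (hG : G.SeparatesVariables)
    {i : Idx n} {f : SmoothFun n M} {V : Set M} (h : IsCoordAt x i f V)
    (u : (SmoothFun n M)[ε]) :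
    let r : ℂ := if holType n i then 0 else -1
    dxi i ((G.T u).fst x) = r • (G.T (d.bracket u (inl f))).fst x ∧
      dxi i ((G.T u).snd x) = r • (G.T (d.bracket u (inl f))).snd x := by
  rcases i with k | k
  · have e := h.bracketEps_apply (G.smooth_T u) (hG.1 V h.domain.isOpen f h.holOn)
    rw [bracketEps_swap, G.commute] at e
    simp [← e]
  · have e := h.bracketEps_apply (G.smooth_T u) (hG.2 V h.domain.isOpen f h.antiholOn)
    simp [G.poisson_T, e]

/-- At each point both groupoids satisfy the same system, with step `u ↦ {u, χ}` for cut-off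
coordinates `χ` fixed beforehand, and the unit axioms give them the same initial values. -/
theorem DefGroupoid.eq_of_separatesVariables [T2Space M] {d : Deformation n M}
    {G G' : DefGroupoid d} (hG : G.SeparatesVariables) (hG' : G'.SeparatesVariables) : G = G' := by
  choose χ V hχ using fun (x : M) (i : Idx n) => exists_isCoordAt x i
  refine DefGroupoid.ext' (AlgHom.ext fun u => TrivSqZeroExt.ext (funext fun x => ?_)
    (funext fun x => ?_)) (AlgHom.ext fun u => TrivSqZeroExt.ext (funext fun x => ?_)
    (funext fun x => ?_))
  · exact eq_of_dxi (fun u => (G.S u).fst x) (fun u => (G'.S u).fst x)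
      (fun u => congrFun ((G.unit_S u).1.trans (G'.unit_S u).1.symm) x)
      (fun i => ⟨_, _, fun u => ⟨(dxi_S hG (hχ x i) u).1, (dxi_S hG' (hχ x i) u).1⟩⟩) u
  · exact eq_of_dxi (fun u => (G.S u).snd x) (fun u => (G'.S u).snd x)
      (fun u => congrFun ((G.unit_S u).2.trans (G'.unit_S u).2.symm) x)
      (fun i => ⟨_, _, fun u => ⟨(dxi_S hG (hχ x i) u).2, (dxi_S hG' (hχ x i) u).2⟩⟩) u
  · exact eq_of_dxi (fun u => (G.T u).fst x) (fun u => (G'.T u).fst x)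
      (fun u => congrFun ((G.unit_T u).1.trans (G'.unit_T u).1.symm) x)
      (fun i => ⟨_, _, fun u => ⟨(dxi_T hG (hχ x i) u).1, (dxi_T hG' (hχ x i) u).1⟩⟩) u
  · exact eq_of_dxi (fun u => (G.T u).snd x) (fun u => (G'.T u).snd x)
      (fun u => congrFun ((G.unit_T u).2.trans (G'.unit_T u).2.symm) x)
      (fun i => ⟨_, _, fun u => ⟨(dxi_T hG (hχ x i) u).2, (dxi_T hG' (hχ x i) u).2⟩⟩) u

theorem Groupoid.dxi_S {g : Tensor n M} {G : Groupoid g} (hG : G.SeparatesVariables)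
    {i : Idx n} {f : SmoothFun n M} {V : Set M} (h : IsCoordAt x i f V) (u : SmoothFun n M) :
    dxi i (G.S u x) = (if holType n i then 1 else 0 : ℂ) • G.S (g.bracket u f) x := by
  rcases i with k | k
  · have e := h.bracket_apply (G.smooth_S u) (hG.1 V h.domain.isOpen f h.holOn)
    rw [← G.poisson_S] at e
    simp [e]
  · have e := h.bracket_apply (G.smooth_S u) (hG.2 V h.domain.isOpen f h.antiholOn)
    rw [G.commute] at e
    simp [← e]

theorem Groupoid.dxi_T {g : Tensor n M} {G : Groupoid g} (hG : G.SeparatesVariables)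
    {i : Idx n} {f : SmoothFun n M} {V : Set M} (h : IsCoordAt x i f V) (u : SmoothFun n M) :
    dxi i (G.T u x) = (if holType n i then 0 else -1 : ℂ) • G.T (g.bracket u f) x := by
  rcases i with k | k
  · have e := h.bracket_apply (G.smooth_T u) (hG.1 V h.domain.isOpen f h.holOn)
    rw [bracket_swap, G.commute] at e
    simp [← e]
  · have e := h.bracket_apply (G.smooth_T u) (hG.2 V h.domain.isOpen f h.antiholOn)
    simp [G.poisson_T, e]

theorem Groupoid.eq_of_separatesVariables [T2Space M] {g : Tensor n M} {G G' : Groupoid g}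
    (hG : G.SeparatesVariables) (hG' : G'.SeparatesVariables) : G = G' := by
  choose χ V hχ using fun (x : M) (i : Idx n) => exists_isCoordAt x i
  refine Groupoid.ext' (AlgHom.ext fun u => funext fun x => ?_)
    (AlgHom.ext fun u => funext fun x => ?_)
  · exact eq_of_dxi (fun u => G.S u x) (fun u => G'.S u x)
      (fun u => congrFun ((G.unit_S u).trans (G'.unit_S u).symm) x)
      (fun i => ⟨_, _, fun u => ⟨dxi_S hG (hχ x i) u, dxi_S hG' (hχ x i) u⟩⟩) u
  · exact eq_of_dxi (fun u => G.T u x) (fun u => G'.T u x)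
      (fun u => congrFun ((G.unit_T u).trans (G'.unit_T u).symm) x)
      (fun i => ⟨_, _, fun u => ⟨dxi_T hG (hχ x i) u, dxi_T hG' (hχ x i) u⟩⟩) u

/-! ### The undeformed objects -/

theorem fst_iterate_bracketEps (F Q : (FormalFun n M)[ε]) (k : ℕ) :
    ((FormalFun.bracketEps F)^[k] Q).fst = (FormalFun.bracket F.fst)^[k] Q.fst := by
  induction k with
  | zero => rfl
  | succ k ih => rw [Function.iterate_succ_apply', Function.iterate_succ_apply', fst_bracketEps, ih]

theorem fst_expHEps (F Q : (FormalFun n M)[ε]) :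
    (FormalFun.expHEps F Q).fst = FormalFun.expH F.fst Q.fst := by
  simp [FormalFun.expHEps, FormalFun.expH, fst_iterate_bracketEps]

theorem coord_zero (c : OpenPartialHomeomorph M (Fin n → ℂ)) (y : Fin n → ℂ) :
    FormalFun.coord (0 : FormalFun n M) c y = 0 := by
  rw [FormalFun.coord, Pi.zero_apply, ← coe_substAlgHom, map_zero]
  refine hasSubst_of_constantCoeff_zero fun j => ?_
  rcases j with j | j <;> simp [MvPowerSeries.smul_eq_C_mul]

theorem bracket_zero_right (Φ : FormalFun n M) : FormalFun.bracket Φ 0 = 0 := by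
  ext1 x
  have h1 : ∀ k, dzSeries k (fun _ : Fin n → ℂ => (0 : FiberSeries n)) = 0 := fun k => by
    funext y m
    simp [dzSeries, dz]
    rfl
  have h2 : ∀ k, dzbarSeries k (fun _ : Fin n → ℂ => (0 : FiberSeries n)) = 0 := fun k => by
    funext y m
    simp [dzbarSeries, dzbar]
    rfl
  have h3 : FormalFun.coord (0 : FormalFun n M) (chartAt (Fin n → ℂ) x) = fun _ => 0 :=
    funext (coord_zero _)
  rw [FormalFun.bracket, h3, localBracket]
  simp only [h1, h2, map_zero, Pi.zero_apply, mul_zero, sub_zero, add_zero, Finset.sum_const_zero]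

theorem bracket_zero_left (Φ : FormalFun n M) : FormalFun.bracket 0 Φ = 0 := by
  rw [bracket_swap, bracket_zero_right, neg_zero]

theorem bracketEps_inl (Φ Ψ : FormalFun n M) :
    FormalFun.bracketEps (inl Φ) (inl Ψ) = inl (FormalFun.bracket Φ Ψ) := by
  refine TrivSqZeroExt.ext ?_ ?_
  · rw [fst_bracketEps]; rfl
  · rw [snd_bracketEps, snd_inl, snd_inl, snd_inl, bracket_zero_right, bracket_zero_left, add_zero]

theorem expHEps_inl (Φ Ψ : FormalFun n M) :
    FormalFun.expHEps (inl Φ) (inl Ψ) = inl (FormalFun.expH Φ Ψ) := by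
  have hk : ∀ k, (FormalFun.bracketEps (inl Φ))^[k] (inl Ψ) =
      inl ((FormalFun.bracket Φ)^[k] Ψ) := fun k => by
    induction k with
    | zero => rfl
    | succ k ih =>
      rw [Function.iterate_succ_apply', ih, bracketEps_inl,
        ← Function.iterate_succ_apply' (FormalFun.bracket Φ) k Ψ]
  refine TrivSqZeroExt.ext (by rw [fst_expHEps]; rfl) ?_
  have e : (FormalFun.expHEps (inl Φ) (inl Ψ)).snd = FormalFun.expSum fun _ => 0 := by
    simp [FormalFun.expHEps, hk]
  rw [e]
  ext x m
  change ∑ k ∈ Finset.range (m.degree + 1), ((k.factorial : ℂ))⁻¹ * coeff m (0 : FiberSeries n) = 0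
  simp

theorem fst_mem_KSet {F : (FormalFun n M)[ε]} (hF : F ∈ KEpsSet n M) : F.fst ∈ KSet n M := by
  obtain ⟨hs, hq, h1, h2⟩ := hF
  refine ⟨hs.1, hq.1, fun V hV a a' ha ha' => ?_, fun V hV b b' hb hb' => ?_⟩
  · have e := (h1 V hV a a' ha ha').1
    rwa [fst_bracketEps, fst_expHEps] at e
  · have e := (h2 V hV b b' hb hb').1
    rwa [fst_bracketEps, fst_expHEps] at e

/-- Regarding `K` as a deformation with zero `ε`-part reduces uniqueness in `𝒦` to uniqueness in
`𝒦[ε]`. -/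
theorem inl_mem_KEpsSet {K : FormalFun n M} (hK : K ∈ KSet n M) : inl K ∈ KEpsSet n M := by
  obtain ⟨hs, hq, h1, h2⟩ := hK
  have hz : FormalFun.IsSmooth (0 : FormalFun n M) := Rep.isSmooth fun c _ => ⟨0, Rep.zero⟩
  refine ⟨⟨hs, hz⟩, ⟨hq, fun x m _ => map_zero _⟩, fun V hV a a' ha ha' => ?_,
    fun V hV b b' hb hb' => ?_⟩
  · rw [expHEps_inl, bracketEps_inl]
    exact ⟨h1 V hV a a' ha ha', fun x _ => rfl⟩
  · rw [expHEps_inl, bracketEps_inl]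
    exact ⟨h2 V hV b b' hb hb', fun x _ => rfl⟩

/-- The zero tensor. -/
def zeroTensor : Tensor n M where
  val _ _ _ := 0
  smooth' c _ l k := by
    simp only [mul_zero, Finset.sum_const_zero]
    exact contDiffOn_const

theorem quadraticPartEq_zero : FormalFun.QuadraticPartEq (0 : FormalFun n M) zeroTensor := by
  intro x
  simp [zeroTensor]

theorem KSet.eq_of_quadraticPartEq {K K' : FormalFun n M} (hK : K ∈ KSet n M)
    (hK' : K' ∈ KSet n M) {g : Tensor n M} (h : FormalFun.QuadraticPartEq K g)
    (h' : FormalFun.QuadraticPartEq K' g) : K = K' :=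
  inl_injective (KahlerPoisson.eq_of_quadraticPartEq (inl_mem_KEpsSet hK) (inl_mem_KEpsSet hK')
    h quadraticPartEq_zero h' quadraticPartEq_zero)

/-- By `ε`-linearity `ε b` is sent to `ε S(b)`, which does not contribute at `ε = 0`. -/
theorem fst_apply_inl_add_inr {A B : Type*} [CommRing A] [Algebra ℂ A] [CommRing B] [Algebra ℂ B]
    (S : A[ε] →ₐ[ℂ] B[ε]) (hS : S DualNumber.eps = DualNumber.eps) (a b : A) :
    (S (inl a + inr b)).fst = (S (inl a)).fst := by
  have e : (inr b : A[ε]) = inl b * DualNumber.eps := by ext <;> simp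
  rw [map_add, e, map_mul, hS]
  simp

/-- The undeformed groupoid of a deformation groupoid. -/
def DefGroupoid.undeformed {d : Deformation n M} (G : DefGroupoid d) : Groupoid d.g where
  S := (fstHom ℂ (FormalFun n M) (FormalFun n M)).comp
    (G.S.comp (inlAlgHom ℂ (SmoothFun n M) (SmoothFun n M)))
  T := (fstHom ℂ (FormalFun n M) (FormalFun n M)).comp
    (G.T.comp (inlAlgHom ℂ (SmoothFun n M) (SmoothFun n M)))
  smooth_S f := (G.smooth_S (inl f)).1
  smooth_T f := (G.smooth_T (inl f)).1
  unit_S f := (G.unit_S (inl f)).1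
  unit_T f := (G.unit_T (inl f)).1
  poisson_S f f' := by
    have e : (G.S (d.bracket (inl f) (inl f'))).fst = (G.S (inl (d.g.bracket f f'))).fst :=
      fst_apply_inl_add_inr G.S G.eps_S _ _
    refine e.symm.trans ?_
    exact (congrArg TrivSqZeroExt.fst (G.poisson_S (inl f) (inl f'))).trans (fst_bracketEps _ _)
  poisson_T f f' := by
    have e : (G.T (d.bracket (inl f) (inl f'))).fst = (G.T (inl (d.g.bracket f f'))).fst :=
      fst_apply_inl_add_inr G.T G.eps_T _ _
    refine e.symm.trans ?_
    refine (congrArg TrivSqZeroExt.fst (G.poisson_T (inl f) (inl f'))).trans ?_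
    rw [fst_neg, fst_bracketEps]
    rfl
  commute f f' := by
    have e := congrArg TrivSqZeroExt.fst (G.commute (inl f) (inl f'))
    rwa [fst_bracketEps] at e

theorem DefGroupoid.undeformed_separatesVariables {d : Deformation n M} {G : DefGroupoid d}
    (hG : G.SeparatesVariables) : G.undeformed.SeparatesVariables :=
  ⟨fun V hV a ha => (hG.1 V hV a ha).1, fun V hV b hb => (hG.2 V hV b hb).1⟩

theorem DefGroupoid.undeformed_givenBy {d : Deformation n M} {G : DefGroupoid d}
    {F : (FormalFun n M)[ε]} (hG : G.GivenBy F) : G.undeformed.GivenBy F.fst := by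
  intro V hV a b ha hb f hf
  have e := hG V hV a b ha hb f hf
  refine ⟨?_, ?_⟩
  · have e1 := e.1.1
    rwa [fst_mul, fst_expHEps] at e1
  · have e2 := e.2.1
    rwa [fst_mul, fst_expHEps] at e2

end Unique

end KahlerPoisson
end

/-! ### The theorem. -/

theorem mainTheorem3 (n : ℕ) (M : Type*) [TopologicalSpace M] [T2Space M]
    [ChartedSpace (Fin n → ℂ) M] [IsManifold 𝓘(ℂ, Fin n → ℂ) ω M] :
    (∀ F ∈ KEpsSet n M, FormalFun.IsEven F.fst ∧ FormalFun.IsEven F.snd) ∧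
    ∃ Θ : Deformation n M → KEpsSet n M, Function.Bijective Θ ∧
      (∀ (d : Deformation n M) (F : KEpsSet n M),
        F = Θ d ↔ (FormalFun.QuadraticPartEq F.1.fst d.g ∧
          FormalFun.QuadraticPartEq F.1.snd d.h)) ∧
      ∀ d : Deformation n M,
        (∃ G : DefGroupoid d, G.SeparatesVariables ∧
          (∀ G' : DefGroupoid d, G'.SeparatesVariables → G' = G) ∧
          G.GivenBy (Θ d).1 ∧
          ∃ G₀ : Groupoid d.g, G₀.SeparatesVariables ∧
            (∀ G' : Groupoid d.g, G'.SeparatesVariables → G' = G₀) ∧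
            G₀.GivenBy (Θ d).1.fst ∧
            ∀ f : SmoothFun n M, (G.S (TrivSqZeroExt.inl f)).fst = G₀.S f ∧
              (G.T (TrivSqZeroExt.inl f)).fst = G₀.T f) ∧
        (Θ d).1.fst ∈ KSet n M ∧
        ∀ K ∈ KSet n M, FormalFun.QuadraticPartEq K d.g → K = (Θ d).1.fst := by
  refine ⟨fun F hF => isEven_of_mem_KEpsSet hF, theta, theta_bijective, eq_theta_iff, fun d =>
    ⟨⟨d.groupoid, d.groupoid_separatesVariables, fun G' hG' =>
      DefGroupoid.eq_of_separatesVariables hG' d.groupoid_separatesVariables, d.groupoid_givenBy,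
      d.groupoid.undeformed, DefGroupoid.undeformed_separatesVariables
        d.groupoid_separatesVariables, fun G' hG' => Groupoid.eq_of_separatesVariables hG'
        (DefGroupoid.undeformed_separatesVariables d.groupoid_separatesVariables),
      DefGroupoid.undeformed_givenBy d.groupoid_givenBy, fun f => ⟨rfl, rfl⟩⟩,
      fst_mem_KSet (theta d).2, fun K hK h => ?_⟩⟩
  exact KSet.eq_of_quadraticPartEq hK (fst_mem_KSet (theta d).2) h (theta_spec d).1
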